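/- **Notation.** Let $G'=\widetilde{SL_2(\mathbb R)}$ be the universal covering group of $SL_2(\mathbb R)$, realised as the group of pairs of a matrix $\begin{pmatrix}a&b\\c&d\end{pmatrix}$ and a continuous branch of $z\mapsto\log(cz+d)$ on the upper half-plane $\Pi$. For $\lambda>1$ let $H^2_\lambda(\Pi)$ be the space of holomorphic functions on $\Pi$ that are square integrable for $y^{\lambda-2}\,dx\,dy$, with the holomorphic discrete series representation $$(\pi_\lambda(g)f)(z)=(cz+d)^{-\lambda}f\Big(\frac{az+b}{cz+d}\Big),\qquad g^{-1}=\begin{pmatrix}a&b\\c&d\end{pmatrix},$$ of $G'$, the branch of the power being the one given by $g^{-1}$. Let $L^2_\lambda(\mathbb R^+)=L^2((0,\infty),t^{1-\lambda}dt)$ and let $\mathcal F g(z)=\int_0^\infty g(t)e^{izt}\,dt$ be the Laplace transform, a bijection of $L^2_\lambda(\mathbb R^+)$ onto $H^2_\lambda(\Pi)$; put $\widehat{\pi_\lambda}(g)=\mathcal F^{-1}\circ\pi_\lambda(g)\circ\mathcal F$. For $\lambda',\lambda''>1$ the outer tensor product $\pi_{\lambda'}\boxtimes\pi_{\lambda''}$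 of $G'\times G'$ acts on the space $H^2_{\lambda',\lambda''}(\Pi\times\Pi)\simeq H^2_{\lambda'}(\Pi)\hat\otimes H^2_{\lambda''}(\Pi)$ of holomorphic functions on $\Pi\times\Pi$ that are square integrable for the product measure. Let $\mathcal F_2=\mathcal F\otimes\mathcal F$, a bijection onto it from $L^2((0,\infty)^2,x^{1-\lambda'}y^{1-\lambda''}dx\,dy)$. Let $$L^2_{\lambda',\lambda''}(\mathbb R^+\times(-1,1))=L^2\big((0,\infty)\times(-1,1),\ t^{\lambda'+\lambda''-1}(1-v)^{\lambda'-1}(1+v)^{\lambda''-1}dt\,dv\big),$$ let $\iota(t,v)=(\tfrac t2(1-v),\tfrac t2(1+v))$, and let $$T_\iota f(t,v)=\Big(\frac t2\Big)^{2-\lambda'-\lambda''}(1-v)^{1-\lambda'}(1+v)^{1-\lambda''}f(\iota(t,v)),$$ a bijection of $L^2((0,\infty)^2,x^{1-\lambda'}y^{1-\lambda''}dx\,dy)$ onto $L^2_{\lambda',\lambda''}(\mathbb R^+\times(-1,1))$. The *stratified $L^2$-model* is the action of $G'$ on $L^2_{\lambda',\lambda''}(\mathbb R^+\times(-1,1))$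 given by $$\sigma(g)=T_\iota\circ\mathcal F_2^{-1}\circ(\pi_{\lambda'}\boxtimes\pi_{\lambda''})(g,g)\circ\mathcal F_2\circ T_\iota^{-1}.$$ For $l\in\mathbb N$ put $\lambda'''=\lambda'+\lambda''+2l$, let $P_l=P_l^{\lambda'-1,\lambda''-1}$ be the Jacobi polynomial and $\|P_l\|$ its norm in $L^2((-1,1),(1-v)^{\lambda'-1}(1+v)^{\lambda''-1}dv)$. The *$l$-th Jacobi component* $V_l=V_l^{\lambda',\lambda''}$ is the closed subspace of $L^2_{\lambda',\lambda''}(\mathbb R^+\times(-1,1))$ of all functions $f(t)P_l(v)$ with $f\in L^2((0,\infty),t^{\lambda'+\lambda''-1}dt)$. The bijection $$\Theta:L^2_{\lambda'''}(\mathbb R^+)\to V_l,\qquad \Theta h(t,v)=t^{-(\lambda'+\lambda''+l-1)}\frac{P_l(v)}{\|P_l\|}h(t),$$ carries $\widehat{\pi_{\lambda'''}}$ over to the action $\rho_l(g)=\Theta\circ\widehat{\pi_{\lambda'''}}(g)\circ\Theta^{-1}$ of $G'$ on $V_l$. Let $\mathcal J_l=\mathcal J_l^{\lambda',\lambda''}$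 be the orthogonal projection of $L^2_{\lambda',\lambda''}(\mathbb R^+\times(-1,1))$ onto $V_l$. A *symmetry breaking operator* from a unitary representation $\sigma$ of $G'$ to an irreducible unitary representation $\rho$ of $G'$ is a continuous linear map $A$ with $A\circ\sigma(g)=\rho(g)\circ A$ for all $g\in G'$; a *holographic operator* is a continuous linear map $B$ in the other direction with $B\circ\rho(g)=\sigma(g)\circ B$ for all $g\in G'$. (Unitary representations are strongly continuous.) **Proposition.** Let $\lambda',\lambda''>1$ and $l\in\mathbb N$. Then $\sigma$ is a unitary representation of $G'$, $\rho_l$ is an irreducible unitary representation of $G'$, and the orthogonal projection $\mathcal J_l$ is a symmetry breaking operator from $\sigma$ to $\rho_l$. The canonical injection $V_l\hookrightarrow L^2_{\lambda',\lambda''}(\mathbb R^+\times(-1,1))$ is a holographic operator from $\rho_l$ to $\sigma$, and it is the adjoint of $\mathcal J_l$. -/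

import Mathlib

open MeasureTheory Set
open scoped UpperHalfPlane MatrixGroups ENNReal FourierTransform

noncomputable section

namespace JacobiModel

/-! ### The universal covering group of `SL(2, ℝ)` -/

/-- The universal covering group of `SL(2, ℝ)`: pairs of a matrix with bottom row `(c, d)` and a
continuous branch on the upper half-plane of the logarithm of `z ↦ c z + d`. -/
@[ext]
structure USL2 where
  mat : SL(2, ℝ)
  log : ℍ → ℂ
  continuous_log : Continuous log
  exp_log : ∀ z : ℍ, Complex.exp (log z) = (mat 1 0 : ℂ) * z + (mat 1 1 : ℂ)

namespace USL2

lemma denom_mul (a b : SL(2, ℝ)) (z : ℍ) :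
    ((a * b) 1 0 : ℂ) * z + ((a * b) 1 1 : ℂ) =
      ((a 1 0 : ℂ) * ((b • z : ℍ) : ℂ) + (a 1 1 : ℂ)) * ((b 1 0 : ℂ) * z + (b 1 1 : ℂ)) := by
  have h := UpperHalfPlane.denom_cocycle (a : GL (Fin 2) ℝ) (b : GL (Fin 2) ℝ) (z := z)
    z.im_ne_zero
  have hd := UpperHalfPlane.denom_ne_zero (b : GL (Fin 2) ℝ) z
  rw [UpperHalfPlane.coe_specialLinearGroup_apply]
  simp [UpperHalfPlane.denom, UpperHalfPlane.num, Matrix.mul_apply, Fin.sum_univ_two] at h hd ⊢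
  field_simp
  ring

lemma continuous_smul_mat (b : SL(2, ℝ)) : Continuous fun z : ℍ => b • z :=
  continuous_const_smul b

instance : Mul USL2 where
  mul a b :=
    { mat := a.mat * b.mat
      log := fun z => a.log (b.mat • z) + b.log z
      continuous_log :=
        (a.continuous_log.comp (continuous_smul_mat b.mat)).add b.continuous_log
      exp_log := fun z => by
        rw [Complex.exp_add, a.exp_log, b.exp_log, denom_mul] }

instance : One USL2 where
  one :=
    { mat := 1
      log := fun _ => 0
      continuous_log := continuous_const
      exp_log := fun z => by simp }

instance : Inv USL2 where
  inv a :=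
    { mat := a.mat⁻¹
      log := fun z => -a.log (a.mat⁻¹ • z)
      continuous_log := (a.continuous_log.comp (continuous_smul_mat a.mat⁻¹)).neg
      exp_log := fun z => by
        have h := denom_mul a.mat a.mat⁻¹ z
        rw [← a.exp_log, mul_inv_cancel] at h
        have h1 : Complex.exp (a.log (a.mat⁻¹ • z)) *
            (((a.mat⁻¹) 1 0 : ℂ) * z + ((a.mat⁻¹) 1 1 : ℂ)) = 1 := by
          rw [← h]; simp
        rw [Complex.exp_neg]
        exact inv_eq_of_mul_eq_one_right h1 }

@[simp] lemma mul_mat (a b : USL2) : (a * b).mat = a.mat * b.mat := rfl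
@[simp] lemma mul_log (a b : USL2) (z : ℍ) :
    (a * b).log z = a.log (b.mat • z) + b.log z := rfl
@[simp] lemma one_mat : (1 : USL2).mat = 1 := rfl
@[simp] lemma one_log (z : ℍ) : (1 : USL2).log z = 0 := rfl
@[simp] lemma inv_mat (a : USL2) : (a⁻¹).mat = a.mat⁻¹ := rfl
@[simp] lemma inv_log (a : USL2) (z : ℍ) : (a⁻¹).log z = -a.log (a.mat⁻¹ • z) := rfl

instance : Group USL2 where
  mul_assoc a b c := by
    ext
    · simp [mul_assoc]
    · simp [mul_smul, add_assoc]
  one_mul a := by ext <;> simp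
  mul_one a := by ext <;> simp
  inv_mul_cancel a := by ext <;> simp

/-- A branch is determined by the matrix and by its value at `i`; the group carries the topology
of the pairs (matrix, value at `i`) in `SL(2, ℝ) × ℂ`. -/
instance : TopologicalSpace USL2 :=
  TopologicalSpace.induced (fun g => (g.mat, g.log UpperHalfPlane.I)) inferInstance

end USL2

/-! ### Weighted composition operators between `L²` spaces -/

/-- If `φ` carries the measure `‖w‖² ν` to `c μ`, then `f ↦ w · (f ∘ φ)` maps `L²(μ)` to
`L²(ν)` and multiplies squared norms by `c`. -/
structure IsWeightedComp {X Y : Type*} [MeasurableSpace X] [MeasurableSpace Y]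
    (μ : Measure X) (ν : Measure Y) (φ : Y → X) (w : Y → ℂ) (c : ℝ≥0∞) : Prop where
  qmp : Measure.QuasiMeasurePreserving φ ν μ
  meas : Measurable w
  ne_top : c ≠ ∞
  map_eq : Measure.map φ (ν.withDensity fun y => ‖w y‖ₑ ^ 2) = c • μ

section WeightedComp

variable {X Y : Type*} [MeasurableSpace X] [MeasurableSpace Y]
  {μ : Measure X} {ν : Measure Y} {φ : Y → X} {w : Y → ℂ} {c : ℝ≥0∞}

lemma IsWeightedComp.lintegral_eq (h : IsWeightedComp μ ν φ w c) {f : X → ℂ}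
    (hf : AEStronglyMeasurable f μ) :
    ∫⁻ y, ‖w y * f (φ y)‖ₑ ^ 2 ∂ν = c * ∫⁻ x, ‖f x‖ₑ ^ 2 ∂μ := by
  have hm : Measurable fun y => ‖w y‖ₑ ^ 2 := (h.meas.enorm).pow_const 2
  have hfe : AEMeasurable (fun x => ‖f x‖ₑ ^ 2) (c • μ) :=
    (hf.enorm.pow_const 2).mono_ac Measure.smul_absolutelyContinuous
  have h1 : ∫⁻ x, ‖f x‖ₑ ^ 2 ∂(c • μ) = c * ∫⁻ x, ‖f x‖ₑ ^ 2 ∂μ := by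
    rw [lintegral_smul_measure]; rfl
  rw [← h1, ← h.map_eq, lintegral_map' (by rw [h.map_eq]; exact hfe) h.qmp.measurable.aemeasurable]
  have hfφ : AEMeasurable (fun y => ‖f (φ y)‖ₑ ^ 2) ν :=
    ((hf.comp_quasiMeasurePreserving h.qmp).enorm.pow_const 2)
  rw [lintegral_withDensity_eq_lintegral_mul₀ hm.aemeasurable hfφ]
  simp [mul_pow]

lemma IsWeightedComp.of_ne_zero (hφ : Measurable φ) (hw : Measurable w) (hc : c ≠ ∞)
    (h0 : ∀ᵐ y ∂ν, w y ≠ 0)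
    (h : Measure.map φ (ν.withDensity fun y => ‖w y‖ₑ ^ 2) = c • μ) :
    IsWeightedComp μ ν φ w c where
  qmp := by
    refine ⟨hφ, Measure.AbsolutelyContinuous.trans (Measure.AbsolutelyContinuous.map
      (withDensity_absolutelyContinuous' (hw.enorm.pow_const 2).aemeasurable ?_) hφ)
      (h.absolutelyContinuous.trans Measure.smul_absolutelyContinuous)⟩
    filter_upwards [h0] with y hy
    simpa using hy
  meas := hw
  ne_top := hc
  map_eq := h

lemma memLp_two_iff {f : X → ℂ} (hf : AEStronglyMeasurable f μ) :
    MemLp f 2 μ ↔ ∫⁻ x, ‖f x‖ₑ ^ 2 ∂μ < ∞ := by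
  rw [MemLp, and_iff_right hf, eLpNorm_lt_top_iff_lintegral_rpow_enorm_lt_top (by simp) (by simp)]
  simp

lemma IsWeightedComp.memLp (h : IsWeightedComp μ ν φ w c) {f : X → ℂ} (hf : MemLp f 2 μ) :
    MemLp (fun y => w y * f (φ y)) 2 ν := by
  have hm : AEStronglyMeasurable (fun y => w y * f (φ y)) ν :=
    h.meas.aestronglyMeasurable.mul (hf.1.comp_quasiMeasurePreserving h.qmp)
  rw [memLp_two_iff hm, h.lintegral_eq hf.1]
  exact ENNReal.mul_lt_top h.ne_top.lt_top ((memLp_two_iff hf.1).1 hf)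

/-- The operator `f ↦ w · (f ∘ φ)` from `L²(μ)` to `L²(ν)`. -/
def weightedComp (h : IsWeightedComp μ ν φ w c) : Lp ℂ 2 μ →ₗ[ℂ] Lp ℂ 2 ν where
  toFun f := (h.memLp (Lp.memLp f)).toLp (fun y => w y * f (φ y))
  map_add' f g := by
    rw [← MemLp.toLp_add]
    refine MemLp.toLp_congr _ _ ?_
    filter_upwards [h.qmp.ae (Lp.coeFn_add f g)] with y hy
    rw [hy]
    exact mul_add _ _ _
  map_smul' a f := by
    rw [RingHom.id_apply, ← MemLp.toLp_const_smul]
    refine MemLp.toLp_congr _ _ ?_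
    filter_upwards [h.qmp.ae (Lp.coeFn_smul a f)] with y hy
    rw [hy]
    exact mul_left_comm _ _ _

lemma eLpNorm_two_eq {f : X → ℂ} :
    eLpNorm f 2 μ = (∫⁻ x, ‖f x‖ₑ ^ 2 ∂μ) ^ (1 / 2 : ℝ) := by
  rw [eLpNorm_eq_lintegral_rpow_enorm_toReal (by simp) (by simp)]
  simp

lemma norm_weightedComp (h : IsWeightedComp μ ν φ w c) (f : Lp ℂ 2 μ) :
    ‖weightedComp h f‖ = Real.sqrt c.toReal * ‖f‖ := by
  change ‖(h.memLp (Lp.memLp f)).toLp (fun y => w y * f (φ y))‖ = _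
  rw [Lp.norm_toLp, Lp.norm_def, eLpNorm_two_eq, eLpNorm_two_eq, h.lintegral_eq (Lp.memLp f).1,
    ENNReal.mul_rpow_of_nonneg _ _ (by norm_num), ENNReal.toReal_mul, ← ENNReal.toReal_rpow,
    Real.sqrt_eq_rpow]

lemma isClosed_range_weightedComp (h : IsWeightedComp μ ν φ w c) :
    IsClosed (LinearMap.range (weightedComp h) : Set (Lp ℂ 2 ν)) := by
  rcases eq_or_ne (Real.sqrt c.toReal) 0 with h0 | h0
  · have : weightedComp h = 0 := by
      ext1 f
      rw [LinearMap.zero_apply, ← norm_eq_zero, norm_weightedComp, h0, zero_mul]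
    rw [this, LinearMap.range_zero]
    exact isClosed_singleton
  · let L : Lp ℂ 2 μ →ₗᵢ[ℂ] Lp ℂ 2 ν :=
      { toLinearMap := ((Real.sqrt c.toReal : ℂ)⁻¹) • weightedComp h
        norm_map' := fun f => by
          rw [LinearMap.smul_apply, norm_smul, norm_weightedComp, norm_inv, Complex.norm_real,
            Real.norm_eq_abs, abs_of_nonneg (Real.sqrt_nonneg _), inv_mul_cancel_left₀ h0] }
    have hr : LinearMap.range (weightedComp h) = LinearMap.range L.toLinearMap :=
      (LinearMap.range_smul _ _ (inv_ne_zero (by exact_mod_cast h0))).symm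
    rw [hr]
    have := L.isometry.isClosedEmbedding.isClosed_range
    exact this

end WeightedComp


/-! ### Weighted Bergman spaces and the holomorphic discrete series -/

/-- The measure `y ^ (lam - 2) dx dy` on the upper half-plane. -/
def bergmanMeasure (lam : ℝ) : Measure ℍ :=
  (Measure.comap UpperHalfPlane.coe (volume : Measure ℂ)).withDensity
    fun z => ENNReal.ofReal (z.im ^ (lam - 2))

/-- The weighted Bergman space of holomorphic functions on the upper half-plane that are square
integrable for `y ^ (lam - 2) dx dy`. -/
def bergman (lam : ℝ) : Submodule ℂ (ℍ → ℂ) where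
  carrier := {f | DifferentiableOn ℂ (fun z : ℂ => f (UpperHalfPlane.ofComplex z)) {z | 0 < z.im} ∧
    MemLp f 2 (bergmanMeasure lam)}
  add_mem' hf hg := ⟨hf.1.add hg.1, hf.2.add hg.2⟩
  zero_mem' := ⟨differentiableOn_const 0, MemLp.zero⟩
  smul_mem' a _ hf := ⟨hf.1.const_smul a, hf.2.const_smul a⟩

/-- The weighted Bergman space of holomorphic functions on the product of two upper half-planes,
the completed tensor product of two weighted Bergman spaces. -/
def bergman₂ (lam₁ lam₂ : ℝ) : Submodule ℂ (ℍ × ℍ → ℂ) where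
  carrier := {f | DifferentiableOn ℂ
      (fun z : ℂ × ℂ => f (UpperHalfPlane.ofComplex z.1, UpperHalfPlane.ofComplex z.2))
      {z | 0 < z.1.im ∧ 0 < z.2.im} ∧
    MemLp f 2 ((bergmanMeasure lam₁).prod (bergmanMeasure lam₂))}
  add_mem' hf hg := ⟨hf.1.add hg.1, hf.2.add hg.2⟩
  zero_mem' := ⟨differentiableOn_const 0, MemLp.zero⟩
  smul_mem' a _ hf := ⟨hf.1.const_smul a, hf.2.const_smul a⟩

/-- The factor `(c z + d) ^ (-lam)`, for the branch of the power given by `g`. -/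
def cocycle (lam : ℝ) (g : USL2) (z : ℍ) : ℂ :=
  Complex.exp (-(lam : ℂ) * g.log z)

lemma measurable_im_rpow (a : ℝ) : Measurable fun z : ℍ => ENNReal.ofReal (z.im ^ a) :=
  (UpperHalfPlane.continuous_im.measurable.pow_const a).ennreal_ofReal

lemma bergmanMeasure_eq (lam : ℝ) :
    bergmanMeasure lam = (volume : Measure ℍ).withDensity
      fun z => ENNReal.ofReal (z.im ^ lam) := by
  rw [UpperHalfPlane.volume_def, bergmanMeasure, ← withDensity_mul]
  · congr 1
    ext z
    have hz := z.im_pos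
    have h1 : (((1 / NNReal.mk z.im z.im_pos.le : NNReal) ^ 2 : NNReal) : ℝ≥0∞) =
        ENNReal.ofReal (z.im ^ (-2 : ℝ)) := by
      rw [ENNReal.ofReal, ENNReal.coe_inj]
      ext
      rw [Real.coe_toNNReal _ (by positivity), Real.rpow_neg hz.le]
      simp
    simp only [Pi.mul_apply]
    rw [h1, ← ENNReal.ofReal_mul (by positivity), ← Real.rpow_add hz]
    congr 2
    ring
  · refine Measurable.coe_nnreal_ennreal (Continuous.measurable ?_)
    refine .pow (.div₀ continuous_const ?_ ?_) _
    · exact UpperHalfPlane.continuous_im.subtype_mk _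
    · exact fun x ↦ NNReal.ne_iff.mp x.im_ne_zero
  · exact measurable_im_rpow lam

instance (lam : ℝ) : SigmaFinite (bergmanMeasure lam) := by
  unfold bergmanMeasure
  exact SigmaFinite.withDensity_ofReal _

lemma im_smul_mat (g : USL2) (z : ℍ) :
    (g.mat • z).im = z.im / ‖Complex.exp (g.log z)‖ ^ 2 := by
  have := UpperHalfPlane.im_smul_eq_div_normSq (g.mat : GL (Fin 2) ℝ) z
  rw [g.exp_log, ← Complex.normSq_eq_norm_sq]
  simp [UpperHalfPlane.denom] at this
  exact this

lemma norm_cocycle_sq (lam : ℝ) (g : USL2) (z : ℍ) :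
    ‖cocycle lam g z‖ ^ 2 * z.im ^ lam = (g.mat • z).im ^ lam := by
  rw [im_smul_mat, cocycle, Real.div_rpow z.im_pos.le (by positivity), Complex.norm_exp,
    Complex.norm_exp, ← Real.exp_nat_mul, ← Real.exp_nat_mul, ← Real.exp_mul, div_eq_mul_inv,
    ← Real.exp_neg, mul_comm]
  congr 2
  simp
  ring

lemma continuous_cocycle (lam : ℝ) (g : USL2) : Continuous (cocycle lam g) :=
  Complex.continuous_exp.comp (continuous_const.mul g.continuous_log)

lemma measurePreserving_smul_mat (g : SL(2, ℝ)) :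
    MeasurePreserving (fun z : ℍ => g • z) volume volume :=
  measurePreserving_smul (g : GL (Fin 2) ℝ) (volume : Measure ℍ)

lemma map_cocycle (lam : ℝ) (g : USL2) :
    Measure.map (fun z : ℍ => g.mat • z)
      ((bergmanMeasure lam).withDensity fun z => ‖cocycle lam g z‖ₑ ^ 2) = bergmanMeasure lam := by
  have hmp := measurePreserving_smul_mat g.mat
  have hc : Measurable fun z => ‖cocycle lam g z‖ₑ ^ 2 :=
    (continuous_cocycle lam g).measurable.enorm.pow_const 2
  rw [bergmanMeasure_eq, ← withDensity_mul _ (measurable_im_rpow lam) hc]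
  have : ((fun z : ℍ => ENNReal.ofReal (z.im ^ lam)) * fun z => ‖cocycle lam g z‖ₑ ^ 2) =
      fun z => ENNReal.ofReal ((g.mat • z).im ^ lam) := by
    ext z
    rw [Pi.mul_apply, ← norm_cocycle_sq, ← ofReal_norm,
      ← ENNReal.ofReal_pow (norm_nonneg _), mul_comm, ENNReal.ofReal_mul (by positivity)]
  rw [this]
  ext s hs
  rw [Measure.map_apply hmp.measurable hs, withDensity_apply _ (hmp.measurable hs),
    withDensity_apply _ hs, ← hmp.setLIntegral_comp_preimage hs (measurable_im_rpow lam)]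

lemma cocycle_isWeightedComp (lam : ℝ) (g : USL2) :
    IsWeightedComp (bergmanMeasure lam) (bergmanMeasure lam) (fun z : ℍ => g.mat • z)
      (cocycle lam g) 1 :=
  .of_ne_zero (USL2.continuous_smul_mat g.mat).measurable (continuous_cocycle lam g).measurable
    (by simp) (Filter.Eventually.of_forall fun _ => Complex.exp_ne_zero _)
    (by rw [map_cocycle, one_smul])

lemma cocycle₂_isWeightedComp (lam₁ lam₂ : ℝ) (g₁ g₂ : USL2) :
    IsWeightedComp ((bergmanMeasure lam₁).prod (bergmanMeasure lam₂))
      ((bergmanMeasure lam₁).prod (bergmanMeasure lam₂))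
      (fun z : ℍ × ℍ => (g₁.mat • z.1, g₂.mat • z.2))
      (fun z => cocycle lam₁ g₁ z.1 * cocycle lam₂ g₂ z.2) 1 := by
  refine .of_ne_zero ?_ ?_ (by simp) ?_ ?_
  · exact ((USL2.continuous_smul_mat g₁.mat).measurable.comp measurable_fst).prodMk
      ((USL2.continuous_smul_mat g₂.mat).measurable.comp measurable_snd)
  · exact ((continuous_cocycle lam₁ g₁).measurable.comp measurable_fst).mul
      ((continuous_cocycle lam₂ g₂).measurable.comp measurable_snd)
  · exact Filter.Eventually.of_forall fun z =>
      mul_ne_zero (Complex.exp_ne_zero _) (Complex.exp_ne_zero _)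
  · have h₁ : Measurable fun z => ‖cocycle lam₁ g₁ z‖ₑ ^ 2 :=
      (continuous_cocycle lam₁ g₁).measurable.enorm.pow_const 2
    have h₂ : Measurable fun z => ‖cocycle lam₂ g₂ z‖ₑ ^ 2 :=
      (continuous_cocycle lam₂ g₂).measurable.enorm.pow_const 2
    have e : (fun z : ℍ × ℍ => ‖cocycle lam₁ g₁ z.1 * cocycle lam₂ g₂ z.2‖ₑ ^ 2) =
        fun z => ‖cocycle lam₁ g₁ z.1‖ₑ ^ 2 * ‖cocycle lam₂ g₂ z.2‖ₑ ^ 2 := by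
      ext z
      rw [enorm_mul, mul_pow]
    rw [e, ← prod_withDensity h₁ h₂]
    have := Measure.map_prod_map
      ((bergmanMeasure lam₁).withDensity fun z => ‖cocycle lam₁ g₁ z‖ₑ ^ 2)
      ((bergmanMeasure lam₂).withDensity fun z => ‖cocycle lam₂ g₂ z‖ₑ ^ 2)
      (USL2.continuous_smul_mat g₁.mat).measurable (USL2.continuous_smul_mat g₂.mat).measurable
    rw [map_cocycle, map_cocycle] at this
    rw [this, one_smul]
    rfl

lemma differentiableOn_smul_mat (g : SL(2, ℝ)) :
    DifferentiableOn ℂ (fun z : ℂ => ((g • UpperHalfPlane.ofComplex z : ℍ) : ℂ)) {z | 0 < z.im} := by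
  have h : DifferentiableOn ℂ (fun z : ℂ => ((g 0 0 : ℂ) * z + (g 0 1 : ℂ)) /
      ((g 1 0 : ℂ) * z + (g 1 1 : ℂ))) {z | 0 < z.im} := by
    intro z hz
    have hd := UpperHalfPlane.denom_ne_zero (g : GL (Fin 2) ℝ) ⟨z, hz⟩
    simp only [UpperHalfPlane.denom] at hd
    refine DifferentiableAt.differentiableWithinAt ?_
    refine DifferentiableAt.div (by fun_prop) (by fun_prop) ?_
    simpa using hd
  refine h.congr fun z hz => ?_
  rw [UpperHalfPlane.coe_specialLinearGroup_apply, UpperHalfPlane.ofComplex_apply_of_im_pos hz]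
  simp

lemma differentiableOn_log (g : USL2) :
    DifferentiableOn ℂ (fun z : ℂ => g.log (UpperHalfPlane.ofComplex z)) {z | 0 < z.im} := by
  intro z hz
  have hz' : {z : ℂ | 0 < z.im} ∈ nhds z :=
    (isOpen_lt continuous_const Complex.continuous_im).mem_nhds hz
  refine DifferentiableAt.differentiableWithinAt ?_
  have hc : ContinuousAt (fun z : ℂ => g.log (UpperHalfPlane.ofComplex z)) z :=
    g.continuous_log.continuousAt.comp
      (UpperHalfPlane.mdifferentiableAt_ofComplex hz).continuousAt
  have he : HasDerivAt (fun z : ℂ => Complex.exp (g.log (UpperHalfPlane.ofComplex z)))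
      (g.mat 1 0 : ℂ) z := by
    have h1 : HasDerivAt (fun z : ℂ => (g.mat 1 0 : ℂ) * z + (g.mat 1 1 : ℂ))
        (g.mat 1 0 : ℂ) z := by
      simpa using ((hasDerivAt_id z).const_mul (g.mat 1 0 : ℂ)).add_const (g.mat 1 1 : ℂ)
    refine h1.congr_of_eventuallyEq ?_
    filter_upwards [hz'] with y hy
    rw [g.exp_log, UpperHalfPlane.ofComplex_apply_of_im_pos hy]
  have := HasDerivAt.of_comp_left (f := Complex.exp) hc
    (Complex.hasDerivAt_exp _) he (Complex.exp_ne_zero _) (Filter.EventuallyEq.refl _ _)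
  exact this.differentiableAt


lemma cocycle_mem_bergman (lam : ℝ) (g : USL2) {f : ℍ → ℂ} (hf : f ∈ bergman lam) :
    (fun z => cocycle lam g z * f (g.mat • z)) ∈ bergman lam := by
  refine ⟨?_, (cocycle_isWeightedComp lam g).memLp hf.2⟩
  refine DifferentiableOn.mul ?_ ?_
  · exact ((differentiableOn_log g).const_mul (-(lam : ℂ))).cexp
  · have h := hf.1.comp (differentiableOn_smul_mat g.mat) fun z _ =>
      (g.mat • UpperHalfPlane.ofComplex z).im_pos
    refine h.congr fun z _ => ?_
    simp [UpperHalfPlane.ofComplex_apply]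

lemma cocycle_mem_bergman₂ (lam₁ lam₂ : ℝ) (g₁ g₂ : USL2) {f : ℍ × ℍ → ℂ}
    (hf : f ∈ bergman₂ lam₁ lam₂) :
    (fun z : ℍ × ℍ => cocycle lam₁ g₁ z.1 * cocycle lam₂ g₂ z.2 *
      f (g₁.mat • z.1, g₂.mat • z.2)) ∈ bergman₂ lam₁ lam₂ := by
  refine ⟨?_, (cocycle₂_isWeightedComp lam₁ lam₂ g₁ g₂).memLp hf.2⟩
  have m₁ : MapsTo (fun z : ℂ × ℂ => z.1) {z : ℂ × ℂ | 0 < z.1.im ∧ 0 < z.2.im}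
    {z | 0 < z.im} := fun z hz => hz.1
  have m₂ : MapsTo (fun z : ℂ × ℂ => z.2) {z : ℂ × ℂ | 0 < z.1.im ∧ 0 < z.2.im}
    {z | 0 < z.im} := fun z hz => hz.2
  refine DifferentiableOn.mul (DifferentiableOn.mul ?_ ?_) ?_
  · exact (((differentiableOn_log g₁).const_mul (-(lam₁ : ℂ))).cexp).comp
      differentiableOn_fst m₁
  · exact (((differentiableOn_log g₂).const_mul (-(lam₂ : ℂ))).cexp).comp
      differentiableOn_snd m₂
  · have h := hf.1.comp
      (((differentiableOn_smul_mat g₁.mat).comp differentiableOn_fst m₁).prodMk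
        ((differentiableOn_smul_mat g₂.mat).comp differentiableOn_snd m₂)) fun z _ =>
      ⟨(g₁.mat • UpperHalfPlane.ofComplex z.1).im_pos,
        (g₂.mat • UpperHalfPlane.ofComplex z.2).im_pos⟩
    refine h.congr fun z _ => ?_
    simp [UpperHalfPlane.ofComplex_apply]

/-- The holomorphic discrete series representation on the weighted Bergman space:
`(π g f) z = (c z + d) ^ (-lam) f ((a z + b) / (c z + d))`, where `a, b, c, d` are the entries of
the inverse of `g`. -/
def discreteSeries (lam : ℝ) (g : USL2) (f : bergman lam) : bergman lam :=
  ⟨fun z => cocycle lam g⁻¹ z * (f : ℍ → ℂ) (g⁻¹.mat • z), cocycle_mem_bergman lam g⁻¹ f.2⟩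

/-- The outer tensor product of two holomorphic discrete series representations, a representation
of the product of two copies of the covering group. -/
def outerProduct (lam₁ lam₂ : ℝ) (g : USL2 × USL2) (f : bergman₂ lam₁ lam₂) :
    bergman₂ lam₁ lam₂ :=
  ⟨fun z => cocycle lam₁ g.1⁻¹ z.1 * cocycle lam₂ g.2⁻¹ z.2 *
      (f : ℍ × ℍ → ℂ) (g.1⁻¹.mat • z.1, g.2⁻¹.mat • z.2),
    cocycle_mem_bergman₂ lam₁ lam₂ g.1⁻¹ g.2⁻¹ f.2⟩

/-! ### Plancherel's identity for integrable and square integrable functions -/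

open scoped SchwartzMap in
lemma plancherel_lintegral {u : ℝ → ℂ} (h1 : Integrable u) (h2 : MemLp u 2) :
    ∫⁻ x, ‖𝓕 u x‖ₑ ^ 2 = ∫⁻ x, ‖u x‖ₑ ^ 2 := by
  set U : Lp ℂ 2 (volume : Measure ℝ) := h2.toLp u with hU
  have hae : ∀ᵐ x, (𝓕 U : Lp ℂ 2 (volume : Measure ℝ)) x = 𝓕 u x := by
    have hcont : Continuous (𝓕 u) :=
      VectorFourier.fourierIntegral_continuous Real.continuous_fourierChar
        (by exact continuous_inner) h1
    refine ae_eq_of_integral_contDiff_smul_eq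
      ((Lp.memLp _).locallyIntegrable (by norm_num)) hcont.locallyIntegrable ?_
    intro g hg hgc
    have hcs : HasCompactSupport (fun x => (g x : ℂ)) := hgc.comp_left (g := Complex.ofReal) rfl
    let φ : 𝓢(ℝ, ℂ) := hcs.toSchwartzMap (Complex.ofRealCLM.contDiff.comp hg)
    have hφ : ∀ x, φ x = (g x : ℂ) := fun x => rfl
    have e1 := congrArg (fun T => T φ) (Lp.fourier_toTemperedDistribution_eq U)
    simp only [TemperedDistribution.fourier_apply, Lp.toTemperedDistribution_apply] at e1
    have e2 : ∫ x, (𝓕 φ) x • (U x) = ∫ x, (𝓕 φ) x • u x := by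
      refine integral_congr_ae ?_
      filter_upwards [h2.coeFn_toLp] with x hx
      rw [hx]
    have e3 : ∫ x, (𝓕 (φ : ℝ → ℂ)) x • u x = ∫ x, φ x • 𝓕 u x := by
      have := VectorFourier.integral_fourierIntegral_smul_eq_flip (L := innerₗ ℝ)
        Real.continuous_fourierChar (by exact continuous_inner) (φ.integrable (μ := volume)) h1
      simpa using! this
    have e4 : ∫ x, (𝓕 φ) x • u x = ∫ x, (𝓕 (φ : ℝ → ℂ)) x • u x := rfl
    rw [e2, e4, e3] at e1
    simpa [hφ] using e1.symm
  have hn : ‖(𝓕 U : Lp ℂ 2 (volume : Measure ℝ))‖ = ‖U‖ := Lp.norm_fourier_eq U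
  have hn' : eLpNorm (𝓕 u) 2 volume = eLpNorm u 2 volume := by
    rw [Lp.norm_def, Lp.norm_def, ENNReal.toReal_eq_toReal_iff' (Lp.eLpNorm_ne_top _)
      (Lp.eLpNorm_ne_top _), eLpNorm_congr_ae hae, eLpNorm_congr_ae h2.coeFn_toLp] at hn
    exact hn
  have hs : ∀ v : ℝ → ℂ, ∫⁻ x, ‖v x‖ₑ ^ 2 = eLpNorm v 2 volume ^ 2 := by
    intro v
    rw [eLpNorm_two_eq, ← ENNReal.rpow_natCast, ← ENNReal.rpow_mul]
    simp
  rw [hs, hs, hn']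

/-! ### The Laplace transform -/

/-- The measure `t ^ a dt` on the half line of positive real numbers. -/
def halfLine (a : ℝ) : Measure ℝ :=
  (volume.restrict (Ioi 0)).withDensity fun t => ENNReal.ofReal (t ^ a)

instance (a : ℝ) : SigmaFinite (halfLine a) := by
  unfold halfLine
  exact SigmaFinite.withDensity_ofReal _

lemma measurable_ofReal_rpow (a : ℝ) : Measurable fun t : ℝ => ENNReal.ofReal (t ^ a) :=
  (measurable_id.pow_const a).ennreal_ofReal

lemma lintegral_halfLine (a : ℝ) (F : ℝ → ℝ≥0∞) (hF : Measurable F) :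
    ∫⁻ t, F t ∂(halfLine a) = ∫⁻ t in Ioi 0, ENNReal.ofReal (t ^ a) * F t := by
  rw [halfLine, lintegral_withDensity_eq_lintegral_mul _ (measurable_ofReal_rpow a) hF]
  rfl

lemma integrable_mul_of_sq {α : Type*} [MeasurableSpace α] {m : Measure α} {f : α → ℂ}
    {W E : α → ℝ} (hf : AEStronglyMeasurable f m) (hW : AEMeasurable W m)
    (hE : AEStronglyMeasurable E m) (hpos : ∀ᵐ p ∂m, 0 < W p)
    (h1 : ∫⁻ p, ENNReal.ofReal (W p) * ‖f p‖ₑ ^ 2 ∂m < ∞)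
    (h2 : Integrable (fun p => E p ^ 2 / W p) m) : Integrable (fun p => ‖f p‖ * E p) m := by
  have h3 : Integrable (fun p => W p * ‖f p‖ ^ 2) m := by
    refine ⟨hW.aestronglyMeasurable.mul (hf.norm.pow 2), ?_⟩
    rw [hasFiniteIntegral_iff_enorm]
    refine lt_of_le_of_lt (lintegral_mono_ae ?_) h1
    filter_upwards [hpos] with p hp
    rw [enorm_mul, enorm_pow, enorm_norm, Real.enorm_eq_ofReal hp.le]
  refine (h3.add h2).mono' (hf.norm.mul hE) ?_
  filter_upwards [hpos] with p hp
  rw [norm_mul, norm_norm, Real.norm_eq_abs, Pi.add_apply]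
  have : 2 * (‖f p‖ * |E p|) ≤ W p * ‖f p‖ ^ 2 + E p ^ 2 / W p := by
    rw [← sub_nonneg]
    have : W p * ‖f p‖ ^ 2 + E p ^ 2 / W p - 2 * (‖f p‖ * |E p|) =
        (W p * ‖f p‖ - |E p|) ^ 2 / W p := by
      field_simp
      rw [sub_sq, sq_abs]
      ring
    rw [this]
    positivity
  have h0 : 0 ≤ ‖f p‖ * |E p| := by positivity
  linarith

lemma norm_exp_phase (z : ℂ) (t : ℝ) :
    ‖Complex.exp (Complex.I * z * t)‖ = Real.exp (-z.im * t) := by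
  rw [Complex.norm_exp]
  simp

lemma lintegral_slice_le {u : ℝ → ℂ} (hu : Measurable u) {y : ℝ}
    (h1 : IntegrableOn (fun t => u t * Real.exp (-y * t)) (Ioi 0)) :
    ∫⁻ x : ℝ, ‖∫ t in Ioi (0 : ℝ), u t * Complex.exp (Complex.I * (x + y * Complex.I) * t)‖ₑ ^ 2
      ≤ ENNReal.ofReal (2 * Real.pi) *
        ∫⁻ t in Ioi (0 : ℝ), ENNReal.ofReal (Real.exp (-2 * y * t)) * ‖u t‖ₑ ^ 2 := by
  set v : ℝ → ℂ := (Ioi (0 : ℝ)).indicator fun t => u t * Real.exp (-y * t) with hv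
  have hvm : Measurable v := by
    refine Measurable.indicator ?_ measurableSet_Ioi
    fun_prop
  have hvi : Integrable v := (integrable_indicator_iff measurableSet_Ioi).2 h1
  have e1 : ∫⁻ t in Ioi (0 : ℝ), ENNReal.ofReal (Real.exp (-2 * y * t)) * ‖u t‖ₑ ^ 2 =
      ∫⁻ t, ‖v t‖ₑ ^ 2 := by
    rw [← lintegral_indicator measurableSet_Ioi]
    congr 1
    ext t
    by_cases ht : t ∈ Ioi (0 : ℝ)
    · simp only [hv, indicator_of_mem ht]
      rw [enorm_mul, mul_pow, mul_comm, ← ofReal_norm (Real.exp (-y * t) : ℂ),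
        ← ENNReal.ofReal_pow (norm_nonneg _), Complex.norm_real, Real.norm_eq_abs, Real.abs_exp,
        ← Real.exp_nat_mul]
      congr 3
      push_cast
      ring
    · simp [hv, indicator_of_notMem ht]
  rw [e1]
  by_cases hfin : ∫⁻ t, ‖v t‖ₑ ^ 2 = ∞
  · rw [hfin, ENNReal.mul_top]
    · exact le_top
    · simp [Real.pi_pos]
  have hv2 : MemLp v 2 := (memLp_two_iff hvm.aestronglyMeasurable).2 (lt_top_iff_ne_top.2 hfin)
  rw [← plancherel_lintegral hvi hv2]
  have e2 : ∀ x : ℝ, ∫ t in Ioi (0 : ℝ), u t *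
      Complex.exp (Complex.I * (x + y * Complex.I) * t) = 𝓕 v ((-(2 * Real.pi)⁻¹) * x) := by
    intro x
    rw [Real.fourier_real_eq_integral_exp_smul, ← integral_indicator measurableSet_Ioi]
    congr 1
    ext t
    by_cases ht : t ∈ Ioi (0 : ℝ)
    · simp only [hv, indicator_of_mem ht]
      rw [smul_eq_mul, mul_comm, mul_comm (u t), ← mul_assoc, Complex.ofReal_exp,
        ← Complex.exp_add]
      congr 2
      have : (Real.pi : ℂ) ≠ 0 := by exact_mod_cast Real.pi_ne_zero
      push_cast
      field_simp
      ring_nf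
      simp
      ring
    · simp [hv, indicator_of_notMem ht]
  simp_rw [e2]
  have hc : Measurable fun ξ : ℝ => ‖𝓕 v ξ‖ₑ ^ 2 := by
    have hcont : Continuous (𝓕 v) :=
      VectorFourier.fourierIntegral_continuous Real.continuous_fourierChar
        (by exact continuous_inner) hvi
    exact hcont.measurable.enorm.pow_const 2
  have hne : (-(2 * Real.pi)⁻¹ : ℝ) ≠ 0 := by
    have := Real.pi_pos
    exact neg_ne_zero.2 (by positivity)
  rw [← lintegral_map hc (measurable_const_mul _), Real.map_volume_mul_left hne,
    lintegral_smul_measure]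
  refine le_of_eq ?_
  rw [smul_eq_mul]
  congr 2
  rw [inv_neg, inv_inv, abs_neg, abs_of_pos (by have := Real.pi_pos; positivity)]

lemma lintegral_bergman (lam : ℝ) {F : ℂ → ℝ≥0∞} (hF : Measurable F) :
    ∫⁻ z : ℍ, F z ∂(bergmanMeasure lam) =
      ∫⁻ y in Ioi (0 : ℝ), ENNReal.ofReal (y ^ (lam - 2)) * ∫⁻ x : ℝ, F (x + y * Complex.I) := by
  have hm : Measurable fun z : ℂ => ENNReal.ofReal (z.im ^ (lam - 2)) :=
    (Complex.measurable_im.pow_const _).ennreal_ofReal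
  have hG : Measurable fun z : ℂ => ENNReal.ofReal (z.im ^ (lam - 2)) * F z := hm.mul hF
  have hmc : MeasurePreserving UpperHalfPlane.coe (Measure.comap UpperHalfPlane.coe volume)
      ((volume : Measure ℂ).restrict {z | 0 < z.im}) := by
    refine ⟨UpperHalfPlane.measurable_coe, ?_⟩
    rw [UpperHalfPlane.measurableEmbedding_coe.map_comap, UpperHalfPlane.range_coe]
  have hset : MeasurableSet {z : ℂ | 0 < z.im} :=
    measurableSet_lt measurable_const Complex.measurable_im
  rw [bergmanMeasure, lintegral_withDensity_eq_lintegral_mul _ (measurable_im_rpow _)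
    (show Measurable fun z : ℍ => F z from hF.comp UpperHalfPlane.measurable_coe)]
  have e1 : ∫⁻ z : ℍ, ((fun z : ℍ => ENNReal.ofReal (z.im ^ (lam - 2))) *
      fun z : ℍ => F z) z ∂(Measure.comap UpperHalfPlane.coe volume) =
      ∫⁻ z in {z : ℂ | 0 < z.im}, ENNReal.ofReal (z.im ^ (lam - 2)) * F z := by
    exact hmc.lintegral_comp hG
  refine e1.trans ?_
  rw [← lintegral_indicator hset,
    ← (Complex.volume_preserving_equiv_real_prod.symm).lintegral_comp
      (hG.indicator hset), Measure.volume_eq_prod, lintegral_prod_symm,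
    ← lintegral_indicator measurableSet_Ioi]
  · congr 1
    ext y
    have : ∀ x : ℝ, Complex.measurableEquivRealProd.symm (x, y) = x + y * Complex.I := by
      intro x
      apply Complex.ext <;> simp
    simp_rw [this]
    by_cases hy : 0 < y
    · rw [indicator_of_mem (show y ∈ Ioi (0 : ℝ) from hy), ← lintegral_const_mul]
      · refine lintegral_congr fun x => ?_
        rw [indicator_of_mem]
        · simp
        · simpa using hy
      · exact hF.comp (by fun_prop)
    · rw [indicator_of_notMem (show y ∉ Ioi (0 : ℝ) from hy), ← lintegral_zero]
      refine lintegral_congr fun x => ?_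
      rw [indicator_of_notMem]
      simpa using hy
  · exact ((hG.indicator hset).comp
      Complex.measurableEquivRealProd.symm.measurable).aemeasurable

lemma lintegral_gamma {lam t : ℝ} (hlam : 1 < lam) (ht : 0 < t) :
    ∫⁻ y in Ioi (0 : ℝ), ENNReal.ofReal (y ^ (lam - 2)) * ENNReal.ofReal (Real.exp (-2 * y * t)) =
      ENNReal.ofReal (2 ^ (1 - lam) * Real.Gamma (lam - 1)) * ENNReal.ofReal (t ^ (1 - lam)) := by
  have h := Real.integral_rpow_mul_exp_neg_mul_Ioi (a := lam - 1) (r := 2 * t) (by linarith)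
    (by positivity)
  have hG := Real.Gamma_pos_of_pos (show 0 < lam - 1 by linarith)
  have hint : IntegrableOn (fun y : ℝ => y ^ (lam - 2) * Real.exp (-2 * y * t)) (Ioi 0) := by
    have := integrableOn_rpow_mul_exp_neg_mul_rpow (p := 1) (s := lam - 2) (b := 2 * t)
      (by linarith) one_pos (by positivity)
    refine this.congr_fun (fun y _ => ?_) measurableSet_Ioi
    simp only [Real.rpow_one]
    congr 2
    ring
  have e : ∀ y : ℝ, y ∈ Ioi (0 : ℝ) → ENNReal.ofReal (y ^ (lam - 2)) *
      ENNReal.ofReal (Real.exp (-2 * y * t)) =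
      ENNReal.ofReal (y ^ (lam - 2) * Real.exp (-2 * y * t)) := fun y hy =>
    (ENNReal.ofReal_mul (Real.rpow_nonneg (le_of_lt hy) _)).symm
  rw [setLIntegral_congr_fun measurableSet_Ioi e, ← ofReal_integral_eq_lintegral_ofReal hint,
    ← ENNReal.ofReal_mul (by positivity)]
  · congr 1
    have h2 : ∫ y in Ioi (0 : ℝ), y ^ (lam - 2) * Real.exp (-2 * y * t) =
        ∫ y in Ioi (0 : ℝ), y ^ (lam - 1 - 1) * Real.exp (-(2 * t * y)) := by
      congr 1
      ext y
      congr 2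
      · ring
      · ring
    rw [h2, h, one_div, Real.inv_rpow (by positivity), ← Real.rpow_neg (by positivity),
      Real.mul_rpow (by norm_num) ht.le]
    rw [show -(lam - 1) = 1 - lam by ring]
    ring
  · filter_upwards [ae_restrict_mem measurableSet_Ioi] with y hy
    have : 0 ≤ y ^ (lam - 2) := Real.rpow_nonneg (le_of_lt hy) _
    positivity

lemma integrableOn_mul_exp {lam : ℝ} (hlam : 1 < lam) {u : ℝ → ℂ} (hu : Measurable u)
    (h : ∫⁻ t, ‖u t‖ₑ ^ 2 ∂(halfLine (1 - lam)) < ∞) {y : ℝ} (hy : 0 < y) :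
    IntegrableOn (fun t => ‖u t‖ * Real.exp (-y * t)) (Ioi 0) := by
  rw [lintegral_halfLine _ _ (hu.enorm.pow_const 2)] at h
  refine integrable_mul_of_sq (W := fun t => t ^ (1 - lam)) hu.aestronglyMeasurable
    (by fun_prop) (by fun_prop) ?_ h ?_
  · filter_upwards [ae_restrict_mem measurableSet_Ioi] with t ht
    exact Real.rpow_pos_of_pos ht _
  · have := integrableOn_rpow_mul_exp_neg_mul_rpow (p := 1) (s := lam - 1) (b := 2 * y)
      (by linarith) one_pos (by positivity)
    refine this.congr_fun (fun t ht => ?_) measurableSet_Ioi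
    simp only [Real.rpow_one]
    rw [← Real.exp_nat_mul, div_eq_mul_inv, ← Real.rpow_neg (le_of_lt ht), mul_comm]
    congr 2
    · push_cast
      ring
    · ring

lemma measurable_laplace {u : ℝ → ℂ} (hu : Measurable u) :
    Measurable fun z : ℂ => ∫ t in Ioi (0 : ℝ), u t * Complex.exp (Complex.I * z * t) := by
  have h : StronglyMeasurable fun p : ℂ × ℝ =>
      u p.2 * Complex.exp (Complex.I * p.1 * p.2) := by
    refine Measurable.stronglyMeasurable ?_
    fun_prop
  exact (h.integral_prod_right (ν := volume.restrict (Ioi (0 : ℝ)))).measurable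

/-- The constant of the Laplace transform. -/
def laplaceConst (lam : ℝ) : ℝ≥0∞ :=
  ENNReal.ofReal (2 * Real.pi) * ENNReal.ofReal (2 ^ (1 - lam) * Real.Gamma (lam - 1))

lemma laplaceConst_ne_top (lam : ℝ) : laplaceConst lam ≠ ∞ :=
  ENNReal.mul_ne_top ENNReal.ofReal_ne_top ENNReal.ofReal_ne_top

lemma laplaceConst_ne_zero {lam : ℝ} (hlam : 1 < lam) : laplaceConst lam ≠ 0 := by
  have hG := Real.Gamma_pos_of_pos (show 0 < lam - 1 by linarith)
  have := Real.pi_pos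
  refine mul_ne_zero ?_ ?_
  · exact (ENNReal.ofReal_pos.2 (by positivity)).ne'
  · exact (ENNReal.ofReal_pos.2 (by positivity)).ne'

lemma lintegral_laplace_le {lam : ℝ} (hlam : 1 < lam) {u : ℝ → ℂ} (hu : Measurable u) :
    ∫⁻ z : ℍ, ‖∫ t in Ioi (0 : ℝ), u t * Complex.exp (Complex.I * z * t)‖ₑ ^ 2
        ∂(bergmanMeasure lam) ≤
      laplaceConst lam * ∫⁻ t, ‖u t‖ₑ ^ 2 ∂(halfLine (1 - lam)) := by
  by_cases hfin : ∫⁻ t, ‖u t‖ₑ ^ 2 ∂(halfLine (1 - lam)) = ∞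
  · rw [hfin, ENNReal.mul_top (laplaceConst_ne_zero hlam)]
    exact le_top
  have hlt := lt_top_iff_ne_top.2 hfin
  rw [lintegral_bergman lam (F := fun z => ‖∫ t in Ioi (0 : ℝ), u t *
    Complex.exp (Complex.I * z * t)‖ₑ ^ 2) ((measurable_laplace hu).enorm.pow_const 2),
    lintegral_halfLine _ _ (hu.enorm.pow_const 2)]
  have hum : Measurable fun t : ℝ => ‖u t‖ₑ ^ 2 := hu.enorm.pow_const 2
  calc _ ≤ ∫⁻ y in Ioi (0 : ℝ), ENNReal.ofReal (y ^ (lam - 2)) *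
        (ENNReal.ofReal (2 * Real.pi) *
          ∫⁻ t in Ioi (0 : ℝ), ENNReal.ofReal (Real.exp (-2 * y * t)) * ‖u t‖ₑ ^ 2) := by
        refine setLIntegral_mono' measurableSet_Ioi fun y hy => ?_
        gcongr
        refine lintegral_slice_le hu ?_
        refine (integrableOn_mul_exp hlam hu hlt hy).mono' (by fun_prop) ?_
        refine Filter.Eventually.of_forall fun t => ?_
        rw [norm_mul, Complex.norm_real, Real.norm_eq_abs, Real.abs_exp]
    _ = ENNReal.ofReal (2 * Real.pi) * ∫⁻ y in Ioi (0 : ℝ), ∫⁻ t in Ioi (0 : ℝ),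
          ENNReal.ofReal (y ^ (lam - 2)) * ENNReal.ofReal (Real.exp (-2 * y * t)) *
            ‖u t‖ₑ ^ 2 := by
        rw [← lintegral_const_mul']
        · refine lintegral_congr fun y => ?_
          rw [mul_left_comm, ← lintegral_const_mul']
          · simp only [mul_assoc]
          · simp
        · exact ENNReal.ofReal_ne_top
    _ = ENNReal.ofReal (2 * Real.pi) * ∫⁻ t in Ioi (0 : ℝ), ∫⁻ y in Ioi (0 : ℝ),
          ENNReal.ofReal (y ^ (lam - 2)) * ENNReal.ofReal (Real.exp (-2 * y * t)) *
            ‖u t‖ₑ ^ 2 := by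
        rw [lintegral_lintegral_swap]
        refine Measurable.aemeasurable ?_
        have : Measurable fun p : ℝ × ℝ => ENNReal.ofReal (p.1 ^ (lam - 2)) :=
          (measurable_ofReal_rpow _).comp measurable_fst
        have h2 : Measurable fun p : ℝ × ℝ => ‖u p.2‖ₑ ^ 2 := hum.comp measurable_snd
        refine (this.mul ?_).mul h2
        fun_prop
    _ = _ := by
        rw [laplaceConst, mul_assoc]
        congr 1
        rw [← lintegral_const_mul' _ _ ENNReal.ofReal_ne_top]
        refine setLIntegral_congr_fun measurableSet_Ioi fun t ht => ?_
        rw [lintegral_mul_const, lintegral_gamma hlam ht, mul_assoc]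
        exact (measurable_ofReal_rpow _).mul (by fun_prop)


lemma differentiableAt_integral_exp {α E : Type*} [MeasurableSpace α] {m : Measure α}
    [NormedAddCommGroup E] [NormedSpace ℂ E] {f : α → ℂ} {L : α → E →L[ℂ] ℂ} {s : α → ℝ}
    (hf : AEStronglyMeasurable f m) (hL : AEStronglyMeasurable L m)
    (hsL : ∀ᵐ p ∂m, ‖L p‖ ≤ s p)
    (hint : ∀ ε : ℝ, 0 < ε → Integrable (fun p => ‖f p‖ * Real.exp (-ε * s p)) m)
    {z₀ : E} {U : Set E} (hU : U ∈ nhds z₀) {ε : ℝ} (hε : 0 < ε)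
    (hre : ∀ᵐ p ∂m, ∀ z ∈ U, (L p z).re ≤ -ε * s p) :
    DifferentiableAt ℂ (fun z => ∫ p, f p * Complex.exp (L p z) ∂m) z₀ := by
  have hmeas : ∀ z : E, AEStronglyMeasurable (fun p => f p * Complex.exp (L p z)) m := fun z =>
    hf.mul (Complex.continuous_exp.comp_aestronglyMeasurable (hL.apply_continuousLinearMap z))
  have hz₀ := mem_of_mem_nhds hU
  have h := hasFDerivAt_integral_of_dominated_of_fderiv_le (𝕜 := ℂ) (μ := m)
    (F := fun z p => f p * Complex.exp (L p z))
    (F' := fun z p => (f p * Complex.exp (L p z)) • L p) (x₀ := z₀)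
    (bound := fun p => (2 / ε) * (‖f p‖ * Real.exp (-(ε / 2) * s p))) hU
    (Filter.Eventually.of_forall hmeas) ?_ ((hmeas z₀).smul hL) ?_
    ((hint (ε / 2) (by positivity)).const_mul _) ?_
  · exact h.differentiableAt
  · refine (hint ε hε).mono' (hmeas z₀) ?_
    filter_upwards [hre] with p hp
    rw [norm_mul, Complex.norm_exp]
    gcongr
    exact hp z₀ hz₀
  · filter_upwards [hre, hsL] with p hp hs z hz
    rw [norm_smul, norm_mul, Complex.norm_exp]
    have h1 : Real.exp (L p z).re ≤ Real.exp (-ε * s p) := Real.exp_le_exp.2 (hp z hz)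
    have h0 : 0 ≤ s p := (norm_nonneg _).trans hs
    have h2 : s p ≤ (2 / ε) * Real.exp (ε / 2 * s p) := by
      have := Real.add_one_le_exp (ε / 2 * s p)
      have h3 : ε / 2 * s p ≤ Real.exp (ε / 2 * s p) := by linarith
      calc s p = (2 / ε) * (ε / 2 * s p) := by field_simp
        _ ≤ _ := by gcongr
    have h4 : Real.exp (-(ε / 2) * s p) = Real.exp (-ε * s p) * Real.exp (ε / 2 * s p) := by
      rw [← Real.exp_add]
      congr 1
      ring
    calc ‖f p‖ * Real.exp (L p z).re * ‖L p‖
        ≤ ‖f p‖ * Real.exp (-ε * s p) * ((2 / ε) * Real.exp (ε / 2 * s p)) := by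
          gcongr
          exact hs.trans h2
      _ = _ := by rw [h4]; ring
  · refine Filter.Eventually.of_forall fun p z _ => ?_
    have := ((L p).hasFDerivAt (x := z)).cexp.const_mul (f p)
    rwa [smul_smul] at this

/-- `L²` of the half line for the measure `t ^ (1 - lam) dt`, the space of the `L²`-model. -/
abbrev L2Half (lam : ℝ) := Lp ℂ 2 (halfLine (1 - lam))

/-- `L²` of the quadrant for the measure `x ^ (1 - lam₁) y ^ (1 - lam₂) dx dy`. -/
abbrev L2Quadrant (lam₁ lam₂ : ℝ) :=
  Lp ℂ 2 ((halfLine (1 - lam₁)).prod (halfLine (1 - lam₂)))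

lemma laplace_mem_bergman {lam : ℝ} (hlam : 1 < lam) (f : L2Half lam) :
    (fun z : ℍ => ∫ t in Ioi (0 : ℝ), f t * Complex.exp (Complex.I * z * t)) ∈ bergman lam := by
  have hm : Measurable (f : ℝ → ℂ) := (Lp.stronglyMeasurable f).measurable
  have hfin : ∫⁻ t, ‖f t‖ₑ ^ 2 ∂(halfLine (1 - lam)) < ∞ :=
    (memLp_two_iff (Lp.memLp f).1).1 (Lp.memLp f)
  constructor
  · intro z₀ hz₀
    refine DifferentiableAt.differentiableWithinAt ?_
    have hpos : 0 < z₀.im := hz₀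
    have hU : {z : ℂ | z₀.im / 2 < z.im} ∈ nhds z₀ :=
      (isOpen_lt continuous_const Complex.continuous_im).mem_nhds (by simpa using hpos)
    have h := differentiableAt_integral_exp (m := volume.restrict (Ioi (0 : ℝ)))
      (f := f) (L := fun t : ℝ => (Complex.I * t) • ContinuousLinearMap.id ℂ ℂ)
      (s := fun t => t) hm.aestronglyMeasurable
      (Continuous.aestronglyMeasurable (by fun_prop)) ?_
      (fun ε hε => integrableOn_mul_exp hlam hm hfin hε) hU
      (ε := z₀.im / 2) (by positivity) ?_
    · refine h.congr_of_eventuallyEq ?_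
      filter_upwards [hU] with z hz
      have hz' : 0 < z.im := lt_trans (by positivity) hz
      refine integral_congr_ae (Filter.Eventually.of_forall fun t => ?_)
      simp only [UpperHalfPlane.ofComplex_apply_of_im_pos hz']
      simp
      left
      ring_nf
    · filter_upwards [ae_restrict_mem measurableSet_Ioi] with t ht
      refine ContinuousLinearMap.opNorm_le_bound _ (le_of_lt ht) fun z => ?_
      simp [abs_of_pos (show 0 < t from ht)]
    · filter_upwards [ae_restrict_mem measurableSet_Ioi] with t ht z hz
      have ht' : 0 < t := ht
      have hz' : z₀.im / 2 < z.im := hz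
      simp
      nlinarith
  · refine (memLp_two_iff ?_).2 (lt_of_le_of_lt (lintegral_laplace_le hlam hm)
      (ENNReal.mul_lt_top (laplaceConst_ne_top lam).lt_top hfin))
    exact ((measurable_laplace hm).comp UpperHalfPlane.measurable_coe).aestronglyMeasurable

lemma integrableOn_mul_exp₂ {lam₁ lam₂ : ℝ} (h₁ : 1 < lam₁) (h₂ : 1 < lam₂) {f : ℝ × ℝ → ℂ}
    (hf : Measurable f)
    (h : ∫⁻ p, ‖f p‖ₑ ^ 2 ∂((halfLine (1 - lam₁)).prod (halfLine (1 - lam₂))) < ∞)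
    {ε : ℝ} (hε : 0 < ε) :
    IntegrableOn (fun p => ‖f p‖ * Real.exp (-ε * (p.1 + p.2))) (Ioi 0 ×ˢ Ioi 0) := by
  have hpos : ∀ᵐ p : ℝ × ℝ ∂(volume.restrict (Ioi 0 ×ˢ Ioi 0)), 0 < p.1 ∧ 0 < p.2 := by
    filter_upwards [ae_restrict_mem (measurableSet_Ioi.prod measurableSet_Ioi)] with p hp
    exact hp
  have hr : (volume : Measure (ℝ × ℝ)).restrict (Ioi 0 ×ˢ Ioi 0) =
      (volume.restrict (Ioi 0)).prod (volume.restrict (Ioi 0)) := by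
    rw [Measure.volume_eq_prod, Measure.prod_restrict]
  have hw : Measurable fun p : ℝ × ℝ =>
      ENNReal.ofReal (p.1 ^ (1 - lam₁)) * ENNReal.ofReal (p.2 ^ (1 - lam₂)) :=
    ((measurable_ofReal_rpow _).comp measurable_fst).mul
      ((measurable_ofReal_rpow _).comp measurable_snd)
  refine integrable_mul_of_sq (W := fun p => p.1 ^ (1 - lam₁) * p.2 ^ (1 - lam₂))
    hf.aestronglyMeasurable (by fun_prop) (by fun_prop) ?_ ?_ ?_
  · filter_upwards [hpos] with p hp
    exact mul_pos (Real.rpow_pos_of_pos hp.1 _) (Real.rpow_pos_of_pos hp.2 _)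
  · refine lt_of_eq_of_lt ?_ h
    rw [halfLine, halfLine, prod_withDensity (measurable_ofReal_rpow _)
      (measurable_ofReal_rpow _), lintegral_withDensity_eq_lintegral_mul _ hw
      (hf.enorm.pow_const 2), ← hr]
    refine lintegral_congr_ae ?_
    filter_upwards [hpos] with p hp
    rw [ENNReal.ofReal_mul (Real.rpow_nonneg hp.1.le _)]
    rfl
  · have k : ∀ lam : ℝ, 1 < lam →
        Integrable (fun t : ℝ => t ^ (lam - 1) * Real.exp (-(2 * ε) * t ^ (1 : ℝ)))
          (volume.restrict (Ioi 0)) := fun lam hlam =>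
      integrableOn_rpow_mul_exp_neg_mul_rpow (by linarith) one_pos (by positivity)
    rw [hr]
    refine ((k lam₁ h₁).mul_prod (k lam₂ h₂)).congr ?_
    rw [← hr]
    filter_upwards [hpos] with p hp
    simp only [Real.rpow_one]
    rw [← Real.exp_nat_mul, div_eq_mul_inv, mul_inv, ← Real.rpow_neg hp.1.le,
      ← Real.rpow_neg hp.2.le, neg_sub, neg_sub, mul_mul_mul_comm, ← Real.exp_add, mul_comm]
    congr 2
    push_cast
    ring

lemma lintegral_laplace₂_le {lam₁ lam₂ : ℝ} (h₁ : 1 < lam₁) (h₂ : 1 < lam₂) {f : ℝ × ℝ → ℂ}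
    (hf : Measurable f)
    (h : ∫⁻ p, ‖f p‖ₑ ^ 2 ∂((halfLine (1 - lam₁)).prod (halfLine (1 - lam₂))) < ∞) :
    ∫⁻ z : ℍ × ℍ, ‖∫ p in Ioi (0 : ℝ) ×ˢ Ioi (0 : ℝ),
        f p * Complex.exp (Complex.I * (z.1 * p.1 + z.2 * p.2))‖ₑ ^ 2
        ∂((bergmanMeasure lam₁).prod (bergmanMeasure lam₂)) ≤
      laplaceConst lam₂ * (laplaceConst lam₁ *
        ∫⁻ p, ‖f p‖ₑ ^ 2 ∂((halfLine (1 - lam₁)).prod (halfLine (1 - lam₂)))) := by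
  have hr : (volume : Measure (ℝ × ℝ)).restrict (Ioi 0 ×ˢ Ioi 0) =
      (volume.restrict (Ioi 0)).prod (volume.restrict (Ioi 0)) := by
    rw [Measure.volume_eq_prod, Measure.prod_restrict]
  set G : ℂ → ℝ → ℂ := fun z y =>
    ∫ x in Ioi (0 : ℝ), f (x, y) * Complex.exp (Complex.I * z * x) with hG
  have hGm : Measurable fun q : ℂ × ℝ => G q.1 q.2 := by
    have : StronglyMeasurable fun p : (ℂ × ℝ) × ℝ =>
        f (p.2, p.1.2) * Complex.exp (Complex.I * p.1.1 * p.2) := by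
      refine Measurable.stronglyMeasurable ?_
      fun_prop
    exact (this.integral_prod_right (ν := volume.restrict (Ioi (0 : ℝ)))).measurable
  have hexp : ∀ z : ℂ × ℂ, 0 < z.1.im → 0 < z.2.im →
      ∫ p in Ioi (0 : ℝ) ×ˢ Ioi (0 : ℝ),
        f p * Complex.exp (Complex.I * (z.1 * p.1 + z.2 * p.2)) =
      ∫ y in Ioi (0 : ℝ), G z.1 y * Complex.exp (Complex.I * z.2 * y) := by
    intro z hz₁ hz₂
    rw [hr, integral_prod_symm]
    · refine integral_congr_ae (Filter.Eventually.of_forall fun y => ?_)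
      simp only [hG]
      rw [← integral_mul_const]
      refine integral_congr_ae (Filter.Eventually.of_forall fun x => ?_)
      simp only
      rw [mul_assoc, ← Complex.exp_add]
      congr 2
      ring
    · rw [← hr]
      refine (integrableOn_mul_exp₂ h₁ h₂ hf h (lt_min hz₁ hz₂)).mono' (by fun_prop) ?_
      filter_upwards [ae_restrict_mem (measurableSet_Ioi.prod measurableSet_Ioi)] with p hp
      have hp₁ : 0 < p.1 := hp.1
      have hp₂ : 0 < p.2 := hp.2
      rw [norm_mul, Complex.norm_exp]
      gcongr
      simp
      nlinarith [min_le_left z.1.im z.2.im, min_le_right z.1.im z.2.im]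
  have hexp' : ∀ z : ℍ × ℍ, ∫ p in Ioi (0 : ℝ) ×ˢ Ioi (0 : ℝ),
        f p * Complex.exp (Complex.I * (z.1 * p.1 + z.2 * p.2)) =
      ∫ y in Ioi (0 : ℝ), G z.1 y * Complex.exp (Complex.I * z.2 * y) := fun z =>
    hexp (z.1, z.2) z.1.im_pos z.2.im_pos
  simp_rw [hexp']
  have hFm : Measurable fun z : ℍ × ℍ =>
      ‖∫ y in Ioi (0 : ℝ), G z.1 y * Complex.exp (Complex.I * z.2 * y)‖ₑ ^ 2 := by
    have : StronglyMeasurable fun p : (ℍ × ℍ) × ℝ =>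
        G p.1.1 p.2 * Complex.exp (Complex.I * p.1.2 * p.2) := by
      refine Measurable.stronglyMeasurable ?_
      have m1 : Measurable fun p : (ℍ × ℍ) × ℝ => ((p.1.1 : ℂ), p.2) := by
        exact (UpperHalfPlane.measurable_coe.comp (measurable_fst.comp measurable_fst)).prodMk
          measurable_snd
      have m2 : Measurable fun p : (ℍ × ℍ) × ℝ => (p.1.2 : ℂ) :=
        UpperHalfPlane.measurable_coe.comp (measurable_snd.comp measurable_fst)
      have m3 := hGm.comp m1
      exact m3.mul (by fun_prop)
    exact ((this.integral_prod_right (ν := volume.restrict (Ioi (0 : ℝ)))).measurable).enorm.pow_const 2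
  rw [lintegral_prod _ hFm.aemeasurable]
  have hGm' : Measurable fun q : ℍ × ℝ => ‖G q.1 q.2‖ₑ ^ 2 :=
    (hGm.comp ((UpperHalfPlane.measurable_coe.comp measurable_fst).prodMk
      measurable_snd)).enorm.pow_const 2
  calc _ ≤ ∫⁻ z : ℍ, laplaceConst lam₂ * ∫⁻ y, ‖G z y‖ₑ ^ 2 ∂(halfLine (1 - lam₂))
        ∂(bergmanMeasure lam₁) := by
        refine lintegral_mono fun z => ?_
        exact lintegral_laplace_le h₂ (u := G z)
          (hGm.comp (measurable_const.prodMk measurable_id))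
    _ = laplaceConst lam₂ * ∫⁻ y, ∫⁻ z : ℍ, ‖G z y‖ₑ ^ 2 ∂(bergmanMeasure lam₁)
        ∂(halfLine (1 - lam₂)) := by
        rw [lintegral_const_mul' _ _ (laplaceConst_ne_top _), lintegral_lintegral_swap]
        exact hGm'.aemeasurable
    _ ≤ laplaceConst lam₂ * ∫⁻ y, laplaceConst lam₁ *
        ∫⁻ x, ‖f (x, y)‖ₑ ^ 2 ∂(halfLine (1 - lam₁)) ∂(halfLine (1 - lam₂)) := by
        gcongr with y
        exact lintegral_laplace_le h₁ (u := fun x => f (x, y)) (by fun_prop)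
    _ = _ := by
        rw [lintegral_const_mul' _ _ (laplaceConst_ne_top _), lintegral_prod_symm]
        exact (hf.enorm.pow_const 2).aemeasurable

lemma laplace₂_mem_bergman₂ {lam₁ lam₂ : ℝ} (h₁ : 1 < lam₁) (h₂ : 1 < lam₂)
    (f : L2Quadrant lam₁ lam₂) :
    (fun z : ℍ × ℍ => ∫ p in Ioi (0 : ℝ) ×ˢ Ioi (0 : ℝ),
      f p * Complex.exp (Complex.I * (z.1 * p.1 + z.2 * p.2))) ∈ bergman₂ lam₁ lam₂ := by
  have hm : Measurable (f : ℝ × ℝ → ℂ) := (Lp.stronglyMeasurable f).measurable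
  have hfin : ∫⁻ p, ‖f p‖ₑ ^ 2 ∂((halfLine (1 - lam₁)).prod (halfLine (1 - lam₂))) < ∞ :=
    (memLp_two_iff (Lp.memLp f).1).1 (Lp.memLp f)
  constructor
  · intro z₀ hz₀
    refine DifferentiableAt.differentiableWithinAt ?_
    have hpos₁ : 0 < z₀.1.im := hz₀.1
    have hpos₂ : 0 < z₀.2.im := hz₀.2
    set ε := min z₀.1.im z₀.2.im / 2 with hεdef
    have hε : 0 < ε := half_pos (lt_min hpos₁ hpos₂)
    have hU : {z : ℂ × ℂ | ε < z.1.im ∧ ε < z.2.im} ∈ nhds z₀ := by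
      refine IsOpen.mem_nhds ?_ ?_
      · exact (isOpen_lt continuous_const (Complex.continuous_im.comp continuous_fst)).inter
          (isOpen_lt continuous_const (Complex.continuous_im.comp continuous_snd))
      · have := min_le_left z₀.1.im z₀.2.im
        have := min_le_right z₀.1.im z₀.2.im
        constructor <;> linarith
    have hQ : ∀ᵐ p : ℝ × ℝ ∂(volume.restrict (Ioi 0 ×ˢ Ioi 0)), 0 < p.1 ∧ 0 < p.2 := by
      filter_upwards [ae_restrict_mem (measurableSet_Ioi.prod measurableSet_Ioi)] with p hp
      exact hp
    have h := differentiableAt_integral_exp (m := volume.restrict (Ioi (0 : ℝ) ×ˢ Ioi (0 : ℝ)))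
      (f := f) (L := fun p : ℝ × ℝ => (Complex.I * p.1) • ContinuousLinearMap.fst ℂ ℂ ℂ +
        (Complex.I * p.2) • ContinuousLinearMap.snd ℂ ℂ ℂ)
      (s := fun p => p.1 + p.2) hm.aestronglyMeasurable
      (Continuous.aestronglyMeasurable (by fun_prop)) ?_
      (fun ε hε => integrableOn_mul_exp₂ h₁ h₂ hm hfin hε) hU hε ?_
    · refine h.congr_of_eventuallyEq ?_
      filter_upwards [hU] with z hz
      have hz₁ : 0 < z.1.im := lt_trans hε hz.1
      have hz₂ : 0 < z.2.im := lt_trans hε hz.2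
      refine integral_congr_ae (Filter.Eventually.of_forall fun p => ?_)
      simp only [UpperHalfPlane.ofComplex_apply_of_im_pos hz₁,
        UpperHalfPlane.ofComplex_apply_of_im_pos hz₂]
      simp
      left
      ring_nf
    · filter_upwards [hQ] with p hp
      refine ContinuousLinearMap.opNorm_le_bound _ (by linarith [hp.1, hp.2]) fun z => ?_
      simp only [add_apply, smul_apply,
        ContinuousLinearMap.coe_fst', ContinuousLinearMap.coe_snd', smul_eq_mul]
      refine (norm_add_le _ _).trans ?_
      simp only [norm_mul, Complex.norm_I, Complex.norm_real, Real.norm_eq_abs,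
        abs_of_pos hp.1, abs_of_pos hp.2, one_mul]
      have := norm_fst_le z
      have := norm_snd_le z
      nlinarith [hp.1, hp.2]
    · filter_upwards [hQ] with p hp z hz
      obtain ⟨hz₁, hz₂⟩ := hz
      simp
      nlinarith [hp.1, hp.2]
  · refine (memLp_two_iff ?_).2 (lt_of_le_of_lt (lintegral_laplace₂_le h₁ h₂ hm hfin)
      (ENNReal.mul_lt_top (laplaceConst_ne_top _).lt_top
        (ENNReal.mul_lt_top (laplaceConst_ne_top _).lt_top hfin)))
    have : StronglyMeasurable fun q : (ℍ × ℍ) × (ℝ × ℝ) =>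
        f q.2 * Complex.exp (Complex.I * (q.1.1 * q.2.1 + q.1.2 * q.2.2)) := by
      refine Measurable.stronglyMeasurable ?_
      have m1 : Measurable fun q : (ℍ × ℍ) × (ℝ × ℝ) => (q.1.1 : ℂ) :=
        UpperHalfPlane.measurable_coe.comp (measurable_fst.comp measurable_fst)
      have m2 : Measurable fun q : (ℍ × ℍ) × (ℝ × ℝ) => (q.1.2 : ℂ) :=
        UpperHalfPlane.measurable_coe.comp (measurable_snd.comp measurable_fst)
      fun_prop
    exact (this.integral_prod_right
      (ν := volume.restrict (Ioi (0 : ℝ) ×ˢ Ioi (0 : ℝ)))).aestronglyMeasurable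

/-- The Laplace transform `F f z = ∫₀^∞ f(t) exp(i z t) dt`, a bijection of the space of the
`L²`-model onto the weighted Bergman space. -/
def laplace {lam : ℝ} (hlam : 1 < lam) (f : L2Half lam) : bergman lam :=
  ⟨fun z => ∫ t in Ioi (0 : ℝ), f t * Complex.exp (Complex.I * z * t), laplace_mem_bergman hlam f⟩

/-- The Laplace transform in two variables, the tensor product of two Laplace transforms. -/
def laplace₂ {lam₁ lam₂ : ℝ} (h₁ : 1 < lam₁) (h₂ : 1 < lam₂) (f : L2Quadrant lam₁ lam₂) :
    bergman₂ lam₁ lam₂ :=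
  ⟨fun z => ∫ p in Ioi (0 : ℝ) ×ˢ Ioi (0 : ℝ),
      f p * Complex.exp (Complex.I * (z.1 * p.1 + z.2 * p.2)), laplace₂_mem_bergman₂ h₁ h₂ f⟩


/-- The `L²`-model of the holomorphic discrete series: `F⁻¹ ∘ π g ∘ F`, where `Function.invFun` of the
bijection `F` is its inverse. -/
def l2Model {lam : ℝ} (hlam : 1 < lam) (g : USL2) (f : L2Half lam) : L2Half lam :=
  Function.invFun (laplace hlam) (discreteSeries lam g (laplace hlam f))

/-- The `L²`-model of the outer tensor product: `F₂⁻¹ ∘ (π ⊠ π) (g₁, g₂) ∘ F₂`. -/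
def l2Model₂ {lam₁ lam₂ : ℝ} (h₁ : 1 < lam₁) (h₂ : 1 < lam₂) (g : USL2 × USL2)
    (f : L2Quadrant lam₁ lam₂) : L2Quadrant lam₁ lam₂ :=
  Function.invFun (laplace₂ h₁ h₂) (outerProduct lam₁ lam₂ g (laplace₂ h₁ h₂ f))

/-! ### The stratified `L²`-model -/

/-- The measure `(1 - v) ^ (a - 1) (1 + v) ^ (b - 1) dv` on the interval `(-1, 1)`. -/
def jacobiMeasure (a b : ℝ) : Measure ℝ :=
  (volume.restrict (Ioo (-1) 1)).withDensity
    fun v => ENNReal.ofReal ((1 - v) ^ (a - 1) * (1 + v) ^ (b - 1))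

instance (a b : ℝ) : SigmaFinite (jacobiMeasure a b) := by
  unfold jacobiMeasure
  exact SigmaFinite.withDensity_ofReal _

/-- `L²` of `(0, ∞) × (-1, 1)` for
`t ^ (lam₁ + lam₂ - 1) (1 - v) ^ (lam₁ - 1) (1 + v) ^ (lam₂ - 1) dt dv`. -/
abbrev L2Strat (lam₁ lam₂ : ℝ) :=
  Lp ℂ 2 ((halfLine (lam₁ + lam₂ - 1)).prod (jacobiMeasure lam₁ lam₂))

/-- The diffeomorphism of `(0, ∞) × (-1, 1)` onto the quadrant. -/
def stratification (p : ℝ × ℝ) : ℝ × ℝ :=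
  (p.1 / 2 * (1 - p.2), p.1 / 2 * (1 + p.2))

/-- The factor by which the operator `stratify` multiplies. -/
def stratWeight (lam₁ lam₂ : ℝ) (p : ℝ × ℝ) : ℂ :=
  (((p.1 / 2) ^ (2 - lam₁ - lam₂) * (1 - p.2) ^ (1 - lam₁) * (1 + p.2) ^ (1 - lam₂) : ℝ) : ℂ)

lemma measurable_stratification : Measurable stratification := by
  unfold stratification
  fun_prop

lemma measurable_stratWeight (lam₁ lam₂ : ℝ) : Measurable (stratWeight lam₁ lam₂) := by
  unfold stratWeight
  fun_prop

lemma measurable_jacobi_density (a b : ℝ) :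
    Measurable fun v : ℝ => ENNReal.ofReal ((1 - v) ^ (a - 1) * (1 + v) ^ (b - 1)) := by
  fun_prop

lemma image_stratification :
    stratification '' (Ioi (0 : ℝ) ×ˢ Ioo (-1 : ℝ) 1) = Ioi (0 : ℝ) ×ˢ Ioi (0 : ℝ) := by
  ext q
  constructor
  · rintro ⟨p, ⟨h1, h2, h3⟩, rfl⟩
    have h1' : 0 < p.1 := h1
    exact ⟨mul_pos (half_pos h1') (by linarith), mul_pos (half_pos h1') (by linarith)⟩
  · rintro ⟨hx, hy⟩
    have hx' : 0 < q.1 := hx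
    have hy' : 0 < q.2 := hy
    have hs : 0 < q.1 + q.2 := by linarith
    refine ⟨(q.1 + q.2, (q.2 - q.1) / (q.1 + q.2)), ⟨hs, ?_, ?_⟩, ?_⟩
    · simp only
      rw [lt_div_iff₀ hs]
      linarith
    · simp only
      rw [div_lt_iff₀ hs]
      linarith
    · unfold stratification
      ext
      · simp only
        field_simp
        ring
      · simp only
        field_simp
        ring

lemma injOn_stratification : InjOn stratification (Ioi (0 : ℝ) ×ˢ Ioo (-1 : ℝ) 1) := by
  rintro p ⟨hp, -⟩ q ⟨hq, -⟩ h
  have hp' : 0 < p.1 := hp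
  simp only [stratification, Prod.mk.injEq] at h
  have h1 : p.1 = q.1 := by linarith [h.1, h.2]
  have h2 : p.1 * p.2 = p.1 * q.2 := by
    have := h.1
    rw [← h1] at this
    linarith
  exact Prod.ext h1 (mul_left_cancel₀ hp'.ne' h2)

/-- The derivative of `stratification`. -/
def fderivStratification (p : ℝ × ℝ) : ℝ × ℝ →L[ℝ] ℝ × ℝ :=
  (Matrix.toLin (.finTwoProd ℝ) (.finTwoProd ℝ)
    !![(1 - p.2) / 2, -p.1 / 2; (1 + p.2) / 2, p.1 / 2]).toContinuousLinearMap

lemma hasFDerivAt_stratification (p : ℝ × ℝ) :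
    HasFDerivAt stratification (fderivStratification p) p := by
  unfold fderivStratification stratification
  rw [Matrix.toLin_finTwoProd_toContinuousLinearMap]
  have h₁ : HasFDerivAt (fun p : ℝ × ℝ => p.1) (ContinuousLinearMap.fst ℝ ℝ ℝ) p :=
    hasFDerivAt_fst
  have h₂ : HasFDerivAt (fun p : ℝ × ℝ => p.2) (ContinuousLinearMap.snd ℝ ℝ ℝ) p :=
    hasFDerivAt_snd
  convert! HasFDerivAt.prodMk (𝕜 := ℝ)
    ((h₁.mul_const (2⁻¹ : ℝ)).mul (h₂.const_sub (1 : ℝ)))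
    ((h₁.mul_const (2⁻¹ : ℝ)).mul (h₂.const_add (1 : ℝ))) using 2
  · ext <;> simp <;> ring
  · ext <;> simp <;> ring

lemma det_fderivStratification (p : ℝ × ℝ) : (fderivStratification p).det = p.1 / 2 := by
  conv_lhs => rw [fderivStratification, ContinuousLinearMap.det,
    LinearMap.coe_toContinuousLinearMap, LinearMap.det_toLin, Matrix.det_fin_two_of]
  ring

lemma strat_density_eq (lam₁ lam₂ : ℝ) {p : ℝ × ℝ} (hp : p ∈ Ioi (0 : ℝ) ×ˢ Ioo (-1 : ℝ) 1) :
    (ENNReal.ofReal (p.1 ^ (lam₁ + lam₂ - 1)) *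
      ENNReal.ofReal ((1 - p.2) ^ (lam₁ - 1) * (1 + p.2) ^ (lam₂ - 1))) *
        ‖stratWeight lam₁ lam₂ p‖ₑ ^ 2 =
    ENNReal.ofReal |(fderivStratification p).det| *
      (ENNReal.ofReal (2 ^ (lam₁ + lam₂ - 1)) *
        (ENNReal.ofReal ((stratification p).1 ^ (1 - lam₁)) *
          ENNReal.ofReal ((stratification p).2 ^ (1 - lam₂)))) := by
  obtain ⟨t, v⟩ := p
  obtain ⟨ht, hv1, hv2⟩ := hp
  have ht : 0 < t := ht
  have hv1' : -1 < v := hv1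
  have hv2' : v < 1 := hv2
  clear hv1 hv2
  have hv1 : 0 < 1 + v := by linarith
  have hv2 : 0 < 1 - v := by linarith
  obtain ⟨s, rfl⟩ : ∃ s, t = 2 * s := ⟨t / 2, by ring⟩
  have hs : 0 < s := by linarith
  have hdet := det_fderivStratification (2 * s, v)
  simp only at hdet
  rw [hdet]
  simp only [stratWeight, stratification, mul_div_cancel_left₀ s (two_ne_zero' ℝ)]
  rw [← ofReal_norm, Complex.norm_real, Real.norm_eq_abs, abs_of_pos (by positivity),
    ← ENNReal.ofReal_pow (by positivity), ← ENNReal.ofReal_mul (by positivity),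
    ← ENNReal.ofReal_mul (by positivity), ← ENNReal.ofReal_mul (by positivity),
    ← ENNReal.ofReal_mul (by positivity), ← ENNReal.ofReal_mul (by positivity),
    abs_of_pos hs]
  congr 1
  rw [Real.mul_rpow (by norm_num) hs.le, Real.mul_rpow hs.le hv2.le, Real.mul_rpow hs.le hv1.le]
  have key : ∀ x : ℝ, 0 < x → ∀ a : ℝ, x ^ (-a) * (x ^ a) ^ 2 = x ^ a := by
    intro x hx a
    rw [sq, ← mul_assoc, ← Real.rpow_add hx, neg_add_cancel, Real.rpow_zero, one_mul]
  have e1 := key _ hv2 (1 - lam₁)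
  have e2 := key _ hv1 (1 - lam₂)
  have e3 : s ^ (lam₁ + lam₂ - 1) * (s ^ (2 - lam₁ - lam₂)) ^ 2 =
      s * (s ^ (1 - lam₁) * s ^ (1 - lam₂)) := by
    rw [sq, ← Real.rpow_add hs, ← Real.rpow_add hs, ← Real.rpow_add hs]
    calc _ = s ^ (1 + (1 - lam₁ + (1 - lam₂))) := by congr 1; ring
      _ = _ := by rw [Real.rpow_add hs, Real.rpow_one]
  rw [neg_sub] at e1 e2
  calc _ = 2 ^ (lam₁ + lam₂ - 1) * (s ^ (lam₁ + lam₂ - 1) * (s ^ (2 - lam₁ - lam₂)) ^ 2) *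
        ((1 - v) ^ (lam₁ - 1) * ((1 - v) ^ (1 - lam₁)) ^ 2) *
        ((1 + v) ^ (lam₂ - 1) * ((1 + v) ^ (1 - lam₂)) ^ 2) := by ring
    _ = _ := by
      rw [e1, e2, e3]
      ring

lemma ae_strat (lam₁ lam₂ : ℝ) :
    ∀ᵐ p : ℝ × ℝ ∂((halfLine (lam₁ + lam₂ - 1)).prod (jacobiMeasure lam₁ lam₂)),
      p ∈ Ioi (0 : ℝ) ×ˢ Ioo (-1 : ℝ) 1 := by
  have h : (halfLine (lam₁ + lam₂ - 1)).prod (jacobiMeasure lam₁ lam₂) ≪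
      (volume.restrict (Ioi 0)).prod (volume.restrict (Ioo (-1) 1)) :=
    (withDensity_absolutelyContinuous _ _).prod (withDensity_absolutelyContinuous _ _)
  refine h.ae_le ?_
  rw [Measure.prod_restrict]
  exact ae_restrict_mem (measurableSet_Ioi.prod measurableSet_Ioo)

lemma stratify_isWeightedComp (lam₁ lam₂ : ℝ) :
    IsWeightedComp ((halfLine (1 - lam₁)).prod (halfLine (1 - lam₂)))
      ((halfLine (lam₁ + lam₂ - 1)).prod (jacobiMeasure lam₁ lam₂))
      stratification (stratWeight lam₁ lam₂) (ENNReal.ofReal (2 ^ (lam₁ + lam₂ - 1))) := by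
  refine .of_ne_zero measurable_stratification (measurable_stratWeight _ _)
    ENNReal.ofReal_ne_top ?_ ?_
  · filter_upwards [ae_strat lam₁ lam₂] with p hp
    obtain ⟨ht, hv1, hv2⟩ := hp
    have ht : 0 < p.1 := ht
    have hv1 : 0 < 1 + p.2 := by linarith
    have hv2 : 0 < 1 - p.2 := by linarith
    unfold stratWeight
    norm_cast
    positivity
  · have hw : Measurable fun p => ‖stratWeight lam₁ lam₂ p‖ₑ ^ 2 :=
      (measurable_stratWeight _ _).enorm.pow_const 2
    have hD : MeasurableSet (Ioi (0 : ℝ) ×ˢ Ioo (-1 : ℝ) 1) :=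
      measurableSet_Ioi.prod measurableSet_Ioo
    have hd₁ : Measurable fun p : ℝ × ℝ => ENNReal.ofReal (p.1 ^ (lam₁ + lam₂ - 1)) *
        ENNReal.ofReal ((1 - p.2) ^ (lam₁ - 1) * (1 + p.2) ^ (lam₂ - 1)) :=
      ((measurable_ofReal_rpow _).comp measurable_fst).mul
        ((measurable_jacobi_density lam₁ lam₂).comp measurable_snd)
    have hd₂ : Measurable fun p : ℝ × ℝ => ENNReal.ofReal (p.1 ^ (1 - lam₁)) *
        ENNReal.ofReal (p.2 ^ (1 - lam₂)) :=
      ((measurable_ofReal_rpow _).comp measurable_fst).mul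
        ((measurable_ofReal_rpow _).comp measurable_snd)
    refine Measure.ext_of_lintegral _ fun F hF => ?_
    have hFs : Measurable fun p => F (stratification p) := hF.comp measurable_stratification
    rw [lintegral_map hF measurable_stratification,
      lintegral_withDensity_eq_lintegral_mul _ hw hFs,
      lintegral_smul_measure]
    rw [halfLine, jacobiMeasure, halfLine, halfLine,
      prod_withDensity (measurable_ofReal_rpow _) (measurable_jacobi_density _ _),
      prod_withDensity (measurable_ofReal_rpow _) (measurable_ofReal_rpow _),
      Measure.prod_restrict, Measure.prod_restrict, ← Measure.volume_eq_prod,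
      lintegral_withDensity_eq_lintegral_mul _ hd₁ (hw.mul hFs),
      lintegral_withDensity_eq_lintegral_mul _ hd₂ hF, smul_eq_mul,
      ← lintegral_const_mul' _ _ ENNReal.ofReal_ne_top, ← image_stratification,
      lintegral_image_eq_lintegral_abs_det_fderiv_mul volume hD
        (fun p _ => (hasFDerivAt_stratification p).hasFDerivWithinAt) injOn_stratification]
    refine setLIntegral_congr_fun hD fun p hp => ?_
    have := strat_density_eq lam₁ lam₂ hp
    simp only [Pi.mul_apply]
    rw [← mul_assoc, this]
    ring

/-- The operator `f ↦ (t / 2) ^ (2 - lam₁ - lam₂) (1 - v) ^ (1 - lam₁) (1 + v) ^ (1 - lam₂) f(ι(t, v))`,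
where `ι` is `stratification`; it is a bijection and an isometry up to a constant. -/
def stratify (lam₁ lam₂ : ℝ) : L2Quadrant lam₁ lam₂ →ₗ[ℂ] L2Strat lam₁ lam₂ :=
  weightedComp (stratify_isWeightedComp lam₁ lam₂)

/-- The stratified `L²`-model: the restriction of the outer tensor product to the diagonal, carried
over by `stratify`. -/
def stratModel {lam₁ lam₂ : ℝ} (h₁ : 1 < lam₁) (h₂ : 1 < lam₂) (g : USL2)
    (h : L2Strat lam₁ lam₂) : L2Strat lam₁ lam₂ :=
  stratify lam₁ lam₂ (l2Model₂ h₁ h₂ (g, g) (Function.invFun (stratify lam₁ lam₂) h))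

/-! ### Jacobi polynomials and Jacobi components -/

/-- The Jacobi polynomial
`∑ₛ C(l + α, l - s) C(l + β, s) ((v - 1) / 2) ^ s ((v + 1) / 2) ^ (l - s)`, the generalized binomial
coefficients being written with Pochhammer symbols. -/
def jacobiP (l : ℕ) (α β v : ℝ) : ℝ :=
  ∑ s ∈ Finset.range (l + 1),
    ((ascPochhammer ℝ (l - s)).eval (α + s + 1) / ((l - s).factorial : ℝ)) *
      ((ascPochhammer ℝ s).eval (β + (l - s : ℕ) + 1) / (s.factorial : ℝ)) *
        ((v - 1) / 2) ^ s * ((v + 1) / 2) ^ (l - s)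

lemma continuous_jacobiP (l : ℕ) (α β : ℝ) : Continuous (jacobiP l α β) := by
  unfold jacobiP
  fun_prop

/-- The norm of the Jacobi polynomial with parameters `lam₁ - 1`, `lam₂ - 1` in `L²` of the
interval for the measure `(1 - v) ^ (lam₁ - 1) (1 + v) ^ (lam₂ - 1) dv`. -/
def jacobiNorm (lam₁ lam₂ : ℝ) (l : ℕ) : ℝ :=
  Real.sqrt (∫ v, jacobiP l (lam₁ - 1) (lam₂ - 1) v ^ 2 ∂(jacobiMeasure lam₁ lam₂))

lemma lintegral_jacobiP_ne_top {lam₁ lam₂ : ℝ} (h₁ : 1 < lam₁) (h₂ : 1 < lam₂) (l : ℕ) :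
    ∫⁻ v, ‖(jacobiP l (lam₁ - 1) (lam₂ - 1) v : ℂ)‖ₑ ^ 2 ∂(jacobiMeasure lam₁ lam₂) ≠ ∞ := by
  set q : ℝ → ℝ := fun v => ((1 - v) ^ (lam₁ - 1) * (1 + v) ^ (lam₂ - 1)) *
    jacobiP l (lam₁ - 1) (lam₂ - 1) v ^ 2 with hq
  have hcont : Continuous q := by
    have := continuous_jacobiP l (lam₁ - 1) (lam₂ - 1)
    have c1 : Continuous fun v : ℝ => (1 - v) ^ (lam₁ - 1) :=
      (by fun_prop : Continuous fun v : ℝ => 1 - v).rpow_const fun _ => Or.inr (by linarith)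
    have c2 : Continuous fun v : ℝ => (1 + v) ^ (lam₂ - 1) :=
      (by fun_prop : Continuous fun v : ℝ => 1 + v).rpow_const fun _ => Or.inr (by linarith)
    exact (c1.mul c2).mul (this.pow 2)
  have hP : Measurable fun v => ‖(jacobiP l (lam₁ - 1) (lam₂ - 1) v : ℂ)‖ₑ ^ 2 :=
    ((Complex.continuous_ofReal.comp (continuous_jacobiP l _ _)).measurable).enorm.pow_const 2
  rw [jacobiMeasure, lintegral_withDensity_eq_lintegral_mul _ (measurable_jacobi_density _ _) hP]
  have hint : IntegrableOn q (Ioo (-1) 1) :=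
    (hcont.integrableOn_Icc (a := -1) (b := 1)).mono_set Ioo_subset_Icc_self
  refine ne_of_lt (lt_of_le_of_lt (lintegral_mono_ae ?_) hint.2)
  filter_upwards [ae_restrict_mem measurableSet_Ioo] with v hv
  have hv1 : 0 < 1 + v := by linarith [hv.1]
  have hv2 : 0 < 1 - v := by linarith [hv.2]
  simp only [Pi.mul_apply, hq]
  rw [enorm_mul, enorm_pow, Real.enorm_eq_ofReal (by positivity)]
  refine le_of_eq ?_
  congr 2
  rw [← ofReal_norm, ← ofReal_norm, Complex.norm_real]

lemma jacobiTensor_isWeightedComp {lam₁ lam₂ : ℝ} (h₁ : 1 < lam₁) (h₂ : 1 < lam₂) (l : ℕ) :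
    IsWeightedComp (halfLine (lam₁ + lam₂ - 1))
      ((halfLine (lam₁ + lam₂ - 1)).prod (jacobiMeasure lam₁ lam₂)) Prod.fst
      (fun p => (jacobiP l (lam₁ - 1) (lam₂ - 1) p.2 : ℂ))
      (∫⁻ v, ‖(jacobiP l (lam₁ - 1) (lam₂ - 1) v : ℂ)‖ₑ ^ 2 ∂(jacobiMeasure lam₁ lam₂)) where
  qmp := Measure.quasiMeasurePreserving_fst
  meas := (Complex.continuous_ofReal.comp
    ((continuous_jacobiP l _ _).comp continuous_snd)).measurable
  ne_top := lintegral_jacobiP_ne_top h₁ h₂ l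
  map_eq := by
    have hP : Measurable fun v => ‖(jacobiP l (lam₁ - 1) (lam₂ - 1) v : ℂ)‖ₑ ^ 2 :=
      ((Complex.continuous_ofReal.comp (continuous_jacobiP l _ _)).measurable).enorm.pow_const 2
    have := prod_withDensity_right (μ := halfLine (lam₁ + lam₂ - 1))
      (ν := jacobiMeasure lam₁ lam₂) hP
    rw [← this, Measure.map_fst_prod, withDensity_apply _ MeasurableSet.univ,
      Measure.restrict_univ]

/-- The operator `f ↦ ((t, v) ↦ f(t) P(v))`, where `P` is the `l`-th Jacobi polynomial with
parameters `lam₁ - 1`, `lam₂ - 1`. -/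
def jacobiTensor {lam₁ lam₂ : ℝ} (h₁ : 1 < lam₁) (h₂ : 1 < lam₂) (l : ℕ) :
    Lp ℂ 2 (halfLine (lam₁ + lam₂ - 1)) →ₗ[ℂ] L2Strat lam₁ lam₂ :=
  weightedComp (jacobiTensor_isWeightedComp h₁ h₂ l)

/-- The `l`-th Jacobi component: the classes of the functions `(t, v) ↦ f(t) P(v)` with `f` in `L²`
of the half line for `t ^ (lam₁ + lam₂ - 1) dt` and `P` the `l`-th Jacobi polynomial. -/
def jacobiComponent {lam₁ lam₂ : ℝ} (h₁ : 1 < lam₁) (h₂ : 1 < lam₂) (l : ℕ) :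
    Submodule ℂ (L2Strat lam₁ lam₂) :=
  LinearMap.range (jacobiTensor h₁ h₂ l)

instance {lam₁ lam₂ : ℝ} (h₁ : 1 < lam₁) (h₂ : 1 < lam₂) (l : ℕ) :
    CompleteSpace (jacobiComponent h₁ h₂ l) :=
  (isClosed_range_weightedComp (jacobiTensor_isWeightedComp h₁ h₂ l)).completeSpace_coe

/-- The orthogonal projection onto the `l`-th Jacobi component. -/
def jacobiProjection {lam₁ lam₂ : ℝ} (h₁ : 1 < lam₁) (h₂ : 1 < lam₂) (l : ℕ) :
    L2Strat lam₁ lam₂ →L[ℂ] jacobiComponent h₁ h₂ l :=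
  (jacobiComponent h₁ h₂ l).orthogonalProjectionOnto

lemma powWeight_isWeightedComp (lam₁ lam₂ : ℝ) (l : ℕ) :
    IsWeightedComp (halfLine (1 - (lam₁ + lam₂ + 2 * l))) (halfLine (lam₁ + lam₂ - 1)) id
      (fun t : ℝ => ((t ^ (-(lam₁ + lam₂ + l - 1)) : ℝ) : ℂ)) 1 := by
  have hw : Measurable fun t : ℝ => ‖((t ^ (-(lam₁ + lam₂ + l - 1)) : ℝ) : ℂ)‖ₑ ^ 2 := by
    fun_prop
  refine .of_ne_zero measurable_id (by fun_prop) (by simp) ?_ ?_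
  · refine (withDensity_absolutelyContinuous _ _).ae_le ?_
    filter_upwards [ae_restrict_mem measurableSet_Ioi] with t ht
    exact_mod_cast (Real.rpow_pos_of_pos ht _).ne'
  · rw [Measure.map_id, one_smul, halfLine, halfLine,
      ← withDensity_mul _ (measurable_ofReal_rpow _) hw]
    refine withDensity_congr_ae ?_
    filter_upwards [ae_restrict_mem measurableSet_Ioi] with t ht
    have ht : 0 < t := ht
    rw [Pi.mul_apply, ← ofReal_norm, Complex.norm_real, Real.norm_eq_abs,
      abs_of_pos (Real.rpow_pos_of_pos ht _), ← ENNReal.ofReal_pow (by positivity),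
      ← ENNReal.ofReal_mul (by positivity), sq, ← Real.rpow_add ht, ← Real.rpow_add ht]
    congr 2
    ring

/-- The operator `Θ` from the space of the `L²`-model with parameter `lam₁ + lam₂ + 2 l` onto the
`l`-th Jacobi component: `Θ h (t, v) = t ^ (-(lam₁ + lam₂ + l - 1)) (P(v) / ‖P‖) h(t)`. -/
def theta {lam₁ lam₂ : ℝ} (h₁ : 1 < lam₁) (h₂ : 1 < lam₂) (l : ℕ)
    (h : L2Half (lam₁ + lam₂ + 2 * l)) : jacobiComponent h₁ h₂ l :=
  ⟨jacobiTensor h₁ h₂ l (((jacobiNorm lam₁ lam₂ l)⁻¹ : ℂ) •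
      weightedComp (powWeight_isWeightedComp lam₁ lam₂ l) h),
    LinearMap.mem_range_self _ _⟩

lemma one_lt_param {lam₁ lam₂ : ℝ} (h₁ : 1 < lam₁) (h₂ : 1 < lam₂) (l : ℕ) :
    1 < lam₁ + lam₂ + 2 * l := by
  have : (0 : ℝ) ≤ l := Nat.cast_nonneg l
  linarith

/-- The holomorphic discrete series representation with parameter `lam₁ + lam₂ + 2 l`, carried over
to the `l`-th Jacobi component: `Θ ∘ (L²-model of π g) ∘ Θ⁻¹`. -/
def componentModel {lam₁ lam₂ : ℝ} (h₁ : 1 < lam₁) (h₂ : 1 < lam₂) (l : ℕ) (g : USL2)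
    (v : jacobiComponent h₁ h₂ l) : jacobiComponent h₁ h₂ l :=
  theta h₁ h₂ l (l2Model (one_lt_param h₁ h₂ l) g (Function.invFun (theta h₁ h₂ l) v))

/-! ### Symmetry breaking and holographic operators -/

section Representations

variable {G E F : Type*} [Group G] [TopologicalSpace G]
  [NormedAddCommGroup E] [InnerProductSpace ℂ E] [NormedAddCommGroup F] [InnerProductSpace ℂ F]

/-- `π` is a unitary representation: an action by linear isometries, strongly continuous. -/
structure IsUnitaryRep (π : G → E → E) : Prop where
  map_add : ∀ g v w, π g (v + w) = π g v + π g w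
  map_smul : ∀ g (a : ℂ) v, π g (a • v) = a • π g v
  norm_map : ∀ g v, ‖π g v‖ = ‖v‖
  one_apply : ∀ v, π 1 v = v
  mul_apply : ∀ g h v, π (g * h) v = π g (π h v)
  continuous_orbit : ∀ v, Continuous fun g => π g v

/-- `π` is an irreducible unitary representation: it is nonzero and has no closed invariant subspace
other than the two trivial ones. -/
structure IsIrreducibleUnitaryRep (π : G → E → E) : Prop extends IsUnitaryRep π where
  nontrivial : Nontrivial E
  eq_bot_or_eq_top : ∀ W : Submodule ℂ E, IsClosed (W : Set E) →
    (∀ g, ∀ v ∈ W, π g v ∈ W) → W = ⊥ ∨ W = ⊤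

/-- `A` is a symmetry breaking operator: a continuous linear map intertwining the unitary
representation `π` with the irreducible unitary representation `ρ`. -/
structure IsSymmetryBreakingOperator (π : G → E → E) (ρ : G → F → F) (A : E →L[ℂ] F) :
    Prop where
  source : IsUnitaryRep π
  target : IsIrreducibleUnitaryRep ρ
  intertwines : ∀ g v, A (π g v) = ρ g (A v)

/-- `B` is a holographic operator: a continuous linear map intertwining the irreducible unitary
representation `ρ` with the unitary representation `π`. -/
structure IsHolographicOperator (ρ : G → F → F) (π : G → E → E) (B : F →L[ℂ] E) :
    Prop where
  source : IsIrreducibleUnitaryRep ρ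
  target : IsUnitaryRep π
  intertwines : ∀ g w, B (ρ g w) = π g (B w)

end Representations

end JacobiModel

end

/-! Everything is computed on explicit total families of vectors. In the `L²`-model take e_w(t) =
t^(λ-1) exp(-i conj(w) t), the vector `powVec _ 0 w`. Pairing with e_w evaluates the Laplace
transform at w, so the family is total because the Laplace transform is injective, which follows
from Plancherel on a horizontal line. Its Gram matrix is Γ(λ) (-i(z - conj w))^(-λ), and the
discrete series sends e_w to conj((cw+d)^(-λ)) e_{gw}. An action on the lines of a total family that
preserves the Gram matrix extends to a unitary representation (`KernelRep`). The same holds for the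
vectors e_{z₁} ⊗ e_{z₂} on the quadrant. This identifies both models (`l2Model_eq`, `l2Model₂_eq`),
and surjectivity of the Laplace transform onto the Bergman space is never needed.

Irreducibility (`isIrreducible_powVec`): e_i is an eigenvector of the rotations. If P commutes with
the group, the quotient of the Laplace transforms of P e_i and e_i is holomorphic and rotation
invariant, hence constant by the mean value property on the disc. So P e_i is a multiple of e_i, and
P is scalar because the group moves e_i to every line of the family. Apply this to the projection
onto an invariant subspace.

The Jacobi component: let Q be the homogenised Jacobi polynomial and let `jacobiVec` be x^(λ'-1)
y^(λ''-1) Q(x,y) exp(-i conj(w)(x+y)). In its pairing with e_{z₁} ⊗ e_{z₂} the Gamma factors turn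
the Jacobi coefficients into signed binomial coefficients, so the sum collapses to a constant times
A^(-λ'-l) B^(-λ''-l) (A-B)^l with A = -i(z₁ - conj w) and B = -i(z₂ - conj w). Since A - B = -i(z₁ -
z₂), this kernel is covariant of weight λ'+λ''+2l in w (`rep_jacobiVec`). Up to the factor 1/‖P_l‖,
the stratification carries these vectors to Θ e_w (`stratify_jacobiVec`). Hence σ and ρ_l agree on
V_l, so V_l is invariant, its orthogonal projection commutes with the action, and the adjoint of
that projection is the inclusion. -/

noncomputable section

namespace JacobiModel

open scoped ComplexConjugate

/-! ### Total families and extension of isometries -/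

section Total

variable {X H F : Type*} [NormedAddCommGroup H] [InnerProductSpace ℂ H]
  [NormedAddCommGroup F] [InnerProductSpace ℂ F]

/-- A family of vectors is total if only zero is orthogonal to all of them. -/
def Total (e : X → H) : Prop := ∀ f : H, (∀ x, inner ℂ (e x) f = 0) → f = 0

lemma Total.ext {e : X → H} (he : Total e) {f g : H}
    (h : ∀ x, inner ℂ (e x) f = inner ℂ (e x) g) : f = g := by
  refine sub_eq_zero.1 (he _ fun x => ?_)
  rw [inner_sub_right, h, sub_self]

lemma Total.topologicalClosure_span [CompleteSpace H] {e : X → H} (he : Total e) :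
    (Submodule.span ℂ (range e)).topologicalClosure = ⊤ := by
  rw [Submodule.topologicalClosure_eq_top_iff, Submodule.eq_bot_iff]
  intro f hf
  refine he f fun x => ?_
  exact (Submodule.mem_orthogonal _ f).1 hf _ (Submodule.subset_span (mem_range_self x))

lemma Total.mem_of_isClosed [CompleteSpace H] {e : X → H} (he : Total e) {W : Submodule ℂ H}
    (hW : IsClosed (W : Set H)) (h : ∀ x, e x ∈ W) (f : H) : f ∈ W := by
  have h1 : Submodule.span ℂ (range e) ≤ W := Submodule.span_le.2 (by rintro _ ⟨x, rfl⟩; exact h x)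
  have h2 := Submodule.topologicalClosure_minimal _ h1 hW
  rw [he.topologicalClosure_span] at h2
  exact h2 trivial

lemma Total.ext_clm [CompleteSpace H] {e : X → H} (he : Total e) {A B : H →L[ℂ] F}
    (h : ∀ x, A (e x) = B (e x)) : A = B := by
  ext f
  have := he.mem_of_isClosed (W := (A - B).ker) (A - B).isClosed_ker
    (fun x => by simp [h x]) f
  exact sub_eq_zero.1 (by simpa using this)

/-- Both squared norms are the same Hermitian form in the coefficients, given by the common Gram
matrix. -/
lemma norm_linearCombination_eq {e : X → H} {e' : X → F}
    (h : ∀ x y, inner ℂ (e' x) (e' y) = inner ℂ (e x) (e y)) (c : X →₀ ℂ) :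
    ‖Finsupp.linearCombination ℂ e' c‖ = ‖Finsupp.linearCombination ℂ e c‖ := by
  have key : inner ℂ (Finsupp.linearCombination ℂ e' c) (Finsupp.linearCombination ℂ e' c) =
      inner ℂ (Finsupp.linearCombination ℂ e c) (Finsupp.linearCombination ℂ e c) := by
    simp only [Finsupp.linearCombination_apply, Finsupp.sum, sum_inner, inner_sum,
      inner_smul_left, inner_smul_right, h]
  rw [inner_self_eq_norm_sq_to_K, inner_self_eq_norm_sq_to_K] at key
  have h2 : ‖Finsupp.linearCombination ℂ e' c‖ ^ 2 = ‖Finsupp.linearCombination ℂ e c‖ ^ 2 := by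
    exact_mod_cast key
  exact (pow_left_inj₀ (norm_nonneg _) (norm_nonneg _) two_ne_zero).1 h2

/-- Equality of the Gram matrices makes the assignment well defined and isometric on finite linear
combinations. These are dense, so it extends by continuity. -/
lemma Total.exists_isometry [CompleteSpace H] [CompleteSpace F] {e : X → H} (he : Total e)
    {e' : X → F} (h : ∀ x y, inner ℂ (e' x) (e' y) = inner ℂ (e x) (e y)) :
    ∃ V : H →ₗᵢ[ℂ] F, ∀ x, V (e x) = e' x := by
  have hd : DenseRange (Finsupp.linearCombination ℂ e) := by
    have h1 := he.topologicalClosure_span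
    rw [← Finsupp.range_linearCombination, ← Submodule.dense_iff_topologicalClosure_eq_top] at h1
    exact h1
  have hn := norm_linearCombination_eq h
  let V : H →L[ℂ] F :=
    (Finsupp.linearCombination ℂ e').extendOfNorm (Finsupp.linearCombination ℂ e)
  have hV : ∀ c, V (Finsupp.linearCombination ℂ e c) = Finsupp.linearCombination ℂ e' c :=
    LinearMap.extendOfNorm_eq hd ⟨1, fun c => by rw [one_mul, hn]⟩
  refine ⟨⟨V.toLinearMap, fun f => ?_⟩, fun x => ?_⟩
  · refine hd.induction_on (p := fun f => ‖V f‖ = ‖f‖) f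
      (isClosed_eq V.continuous.norm continuous_norm) fun c => ?_
    rw [hV, hn]
  · simpa using hV (Finsupp.single x 1)

end Total

/-! ### Unitary representations defined on a total family -/

section KernelRep

variable {G X H : Type*} [Group G] [TopologicalSpace G] [NormedAddCommGroup H]
  [InnerProductSpace ℂ H] [CompleteSpace H]

/-- An action of `G` on the lines spanned by the vectors of a total family, preserving inner
products. -/
structure KernelRep (e : X → H) (a : G → X → X) (m : G → X → ℂ) : Prop where
  total : Total e
  inner_eq : ∀ g x y, inner ℂ (m g x • e (a g x)) (m g y • e (a g y)) = inner ℂ (e x) (e y)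
  one_smul : ∀ x, m 1 x • e (a 1 x) = e x
  mul_smul : ∀ g h x, m (g * h) x • e (a (g * h) x) = (m h x * m g (a h x)) • e (a g (a h x))
  continuous_smul : ∀ x, Continuous fun g => m g x • e (a g x)

namespace KernelRep

variable {e : X → H} {a : G → X → X} {m : G → X → ℂ}

/-- The isometries of the unitary representation given by an action on a total family. -/
def rep (h : KernelRep e a m) (g : G) : H →ₗᵢ[ℂ] H :=
  (h.total.exists_isometry (h.inner_eq g)).choose

lemma rep_apply (h : KernelRep e a m) (g : G) (x : X) :
    h.rep g (e x) = m g x • e (a g x) :=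
  (h.total.exists_isometry (h.inner_eq g)).choose_spec x

lemma isUnitaryRep (h : KernelRep e a m) : IsUnitaryRep fun g f => h.rep g f where
  map_add g := (h.rep g).map_add
  map_smul g := (h.rep g).map_smul
  norm_map g := (h.rep g).norm_map
  one_apply v := by
    have := h.total.ext_clm (A := (h.rep 1).toContinuousLinearMap)
      (B := ContinuousLinearMap.id ℂ H) fun x => by
        simp only [LinearIsometry.coe_toContinuousLinearMap, ContinuousLinearMap.id_apply]
        rw [h.rep_apply, h.one_smul]
    exact DFunLike.congr_fun this v
  mul_apply g k v := by
    have := h.total.ext_clm (A := (h.rep (g * k)).toContinuousLinearMap)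
      (B := (h.rep g).toContinuousLinearMap.comp (h.rep k).toContinuousLinearMap) fun x => by
        simp only [LinearIsometry.coe_toContinuousLinearMap, ContinuousLinearMap.comp_apply]
        rw [h.rep_apply, h.rep_apply, h.mul_smul, LinearIsometry.map_smul, h.rep_apply, smul_smul]
    exact DFunLike.congr_fun this v
  continuous_orbit v := by
    -- Strong continuity: the vectors with a continuous orbit map form a subspace, and it is closed
    -- because isometries turn an approximation of the vector into an approximation of the orbit map
    -- that is uniform in `g`. It contains the total family.
    let W : Submodule ℂ H :=
      { carrier := {f | Continuous fun g => h.rep g f}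
        add_mem' := fun {f₁ f₂} h₁ h₂ => by
          simp only [mem_ofPred_eq, map_add] at *
          exact Continuous.add h₁ h₂
        zero_mem' := by simpa using continuous_const
        smul_mem' := fun c f h₁ => by
          simp only [mem_ofPred_eq, map_smul] at *
          exact Continuous.const_smul h₁ c }
    have hW : IsClosed (W : Set H) := by
      refine isClosed_of_closure_subset fun f hf => ?_
      refine continuous_of_uniform_approx_of_continuous fun u hu => ?_
      obtain ⟨ε, hε, hu⟩ := Metric.mem_uniformity_dist.1 hu
      obtain ⟨f', hf', hd⟩ := Metric.mem_closure_iff.1 hf ε hε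
      refine ⟨fun g => h.rep g f', hf', fun g => hu ?_⟩
      rwa [(h.rep g).isometry.dist_eq]
    refine h.total.mem_of_isClosed hW (fun x => ?_) v
    change Continuous fun g => h.rep g (e x)
    simp only [h.rep_apply]
    exact h.continuous_smul x

end KernelRep

/-! ### Invariant subspaces and transport of unitary representations. -/

namespace IsUnitaryRep

variable {E F : Type*} [NormedAddCommGroup E] [InnerProductSpace ℂ E]
  [NormedAddCommGroup F] [InnerProductSpace ℂ F] {π : G → E → E}

lemma inner_map (h : IsUnitaryRep π) (g : G) (v w : E) :
    inner ℂ (π g v) (π g w) = inner ℂ v w :=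
  LinearIsometry.inner_map_map
    (⟨⟨⟨π g, h.map_add g⟩, h.map_smul g⟩, h.norm_map g⟩ : E →ₗᵢ[ℂ] E) v w

lemma inv_apply (h : IsUnitaryRep π) (g : G) (v : E) : π g⁻¹ (π g v) = v := by
  rw [← h.mul_apply, inv_mul_cancel, h.one_apply]

lemma inner_left (h : IsUnitaryRep π) (g : G) (v w : E) :
    inner ℂ v (π g w) = inner ℂ (π g⁻¹ v) w := by
  rw [← h.inner_map g⁻¹, h.inv_apply]

lemma mem_orthogonal (h : IsUnitaryRep π) {W : Submodule ℂ E} (hW : ∀ g, ∀ v ∈ W, π g v ∈ W)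
    (g : G) {v : E} (hv : v ∈ Wᗮ) : π g v ∈ Wᗮ := by
  rw [Submodule.mem_orthogonal] at hv ⊢
  intro u hu
  rw [h.inner_left]
  exact hv _ (hW _ _ hu)

/-- The orthogonal complement of an invariant subspace is invariant, so the action respects the
decomposition of a vector into its two components. -/
lemma starProjection_apply (h : IsUnitaryRep π) {W : Submodule ℂ E} [W.HasOrthogonalProjection]
    (hW : ∀ g, ∀ v ∈ W, π g v ∈ W) (g : G) (v : E) :
    W.starProjection (π g v) = π g (W.starProjection v) := by
  refine Submodule.eq_starProjection_of_mem_orthogonal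
    (hW g _ (Submodule.starProjection_apply_mem _ _)) ?_
  have h1 : π g v - π g (W.starProjection v) = π g (v - W.starProjection v) := by
    have := h.map_add g (v - W.starProjection v) (W.starProjection v)
    rw [sub_add_cancel] at this
    rw [this, add_sub_cancel_right]
  rw [h1]
  exact h.mem_orthogonal hW g (Submodule.sub_starProjection_mem_orthogonal v)

/-- A unitary representation carried over by a bijective similitude is unitary. -/
lemma of_similitude (h : IsUnitaryRep π) {T : E →ₗ[ℂ] F} (hT : Function.Surjective T) {κ : ℝ}
    (hκ : ∀ v, ‖T v‖ = κ * ‖v‖) {ρ : G → F → F} (hρ : ∀ g v, ρ g (T v) = T (π g v)) :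
    IsUnitaryRep ρ where
  map_add g v w := by
    obtain ⟨v, rfl⟩ := hT v
    obtain ⟨w, rfl⟩ := hT w
    rw [hρ, hρ, ← T.map_add, ← T.map_add, hρ, h.map_add]
  map_smul g c v := by
    obtain ⟨v, rfl⟩ := hT v
    rw [hρ, ← T.map_smul, ← T.map_smul, hρ, h.map_smul]
  norm_map g v := by
    obtain ⟨v, rfl⟩ := hT v
    rw [hρ, hκ, h.norm_map, hκ]
  one_apply v := by
    obtain ⟨v, rfl⟩ := hT v
    rw [hρ, h.one_apply]
  mul_apply g k v := by
    obtain ⟨v, rfl⟩ := hT v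
    rw [hρ, h.mul_apply, hρ, hρ]
  continuous_orbit v := by
    obtain ⟨v, rfl⟩ := hT v
    simp only [hρ]
    have hc : Continuous T := (T.mkContinuous κ fun v => (hκ v).le).continuous
    exact hc.comp (h.continuous_orbit v)

end IsUnitaryRep

/-- A similitude is continuous, so a closed invariant subspace pulls back to a closed invariant
subspace, and surjectivity recovers the subspace from its preimage. -/
lemma IsIrreducibleUnitaryRep.of_similitude {E F : Type*} [NormedAddCommGroup E]
    [InnerProductSpace ℂ E] [NormedAddCommGroup F] [InnerProductSpace ℂ F] {π : G → E → E}
    (h : IsIrreducibleUnitaryRep π) {T : E →ₗ[ℂ] F} (hT : Function.Bijective T) {κ : ℝ}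
    (hκ : ∀ v, ‖T v‖ = κ * ‖v‖) {ρ : G → F → F} (hρ : ∀ g v, ρ g (T v) = T (π g v)) :
    IsIrreducibleUnitaryRep ρ where
  toIsUnitaryRep := h.toIsUnitaryRep.of_similitude hT.2 hκ hρ
  nontrivial := by
    have := h.nontrivial
    exact hT.1.nontrivial
  eq_bot_or_eq_top W hW hinv := by
    have hc : Continuous T := (T.mkContinuous κ fun v => (hκ v).le).continuous
    have hmap : (W.comap T).map T = W := Submodule.map_comap_eq_of_surjective hT.2 W
    rcases h.eq_bot_or_eq_top (W.comap T) (hW.preimage hc) (fun g v hv => by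
      rw [Submodule.mem_comap, ← hρ]
      exact hinv g _ hv) with h0 | h0
    · left
      rw [← hmap, h0, Submodule.map_bot]
    · right
      rw [← hmap, h0, Submodule.map_top, LinearMap.range_eq_top.2 hT.2]

/-- A kernel representation is irreducible if `G` permutes the lines of the family transitively and
a vector of the family is an eigenvector of every equivariant projection. -/
lemma KernelRep.isIrreducible {e : X → H} {a : G → X → X} {m : G → X → ℂ}
    (h : KernelRep e a m) (x₀ : X) (hx₀ : e x₀ ≠ 0)
    (htrans : ∀ x, ∃ g, ∃ c : ℂ, c • h.rep g (e x₀) = e x)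
    (heig : ∀ P : H →L[ℂ] H, (∀ g v, P (h.rep g v) = h.rep g (P v)) →
      ∃ c : ℂ, P (e x₀) = c • e x₀) :
    IsIrreducibleUnitaryRep fun g f => h.rep g f where
  toIsUnitaryRep := h.isUnitaryRep
  nontrivial := ⟨e x₀, 0, hx₀⟩
  eq_bot_or_eq_top W hW hinv := by
    have : CompleteSpace W := hW.completeSpace_coe
    have hP := h.isUnitaryRep.starProjection_apply hinv
    obtain ⟨c, hc⟩ := heig W.starProjection hP
    -- The projection acts by the scalar `c` on `e x₀`, hence by equivariance on its whole orbit,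
    -- which meets every line of the total family.
    have hall : ∀ v, W.starProjection v = c • v := by
      intro v
      have := h.total.ext_clm (A := W.starProjection) (B := c • ContinuousLinearMap.id ℂ H)
        fun x => by
          obtain ⟨g, b, hb⟩ := htrans x
          rw [← hb, map_smul, hP, hc]
          simp [smul_comm b c]
      rw [this]
      simp
    rcases eq_or_ne c 0 with rfl | hc0
    · left
      rw [Submodule.eq_bot_iff]
      intro v hv
      rw [← Submodule.starProjection_eq_self_iff.2 hv, hall, zero_smul]
    · right
      rw [Submodule.eq_top_iff']
      intro v
      have := Submodule.starProjection_apply_mem W (c⁻¹ • v)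
      rwa [hall, smul_inv_smul₀ hc0] at this

end KernelRep

/-! ### Branches of powers on the upper half-plane -/

/-- The function `-i (z - conj w)`, with values in the right half-plane. -/
def halfKernel (z w : ℍ) : ℂ := -Complex.I * (z - conj (w : ℂ))

lemma halfKernel_re (z w : ℍ) : (halfKernel z w).re = z.im + w.im := by
  simp [halfKernel]

lemma halfKernel_re_pos (z w : ℍ) : 0 < (halfKernel z w).re := by
  rw [halfKernel_re]
  exact add_pos z.im_pos w.im_pos

lemma halfKernel_mem_slitPlane (z w : ℍ) : halfKernel z w ∈ Complex.slitPlane :=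
  Or.inl (halfKernel_re_pos z w)

lemma halfKernel_ne_zero (z w : ℍ) : halfKernel z w ≠ 0 :=
  Complex.slitPlane_ne_zero (halfKernel_mem_slitPlane z w)

lemma continuous_halfKernel : Continuous fun p : ℍ × ℍ => halfKernel p.1 p.2 := by
  unfold halfKernel
  have h1 : Continuous fun p : ℍ × ℍ => (p.1 : ℂ) := UpperHalfPlane.continuous_coe.comp continuous_fst
  have h2 : Continuous fun p : ℍ × ℍ => conj (p.2 : ℂ) :=
    Complex.continuous_conj.comp (UpperHalfPlane.continuous_coe.comp continuous_snd)
  exact continuous_const.mul (h1.sub h2)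

lemma continuous_log_halfKernel : Continuous fun p : ℍ × ℍ => Complex.log (halfKernel p.1 p.2) :=
  continuous_halfKernel.clog fun p => halfKernel_mem_slitPlane p.1 p.2

lemma moebius_sub {a b c d p q : ℂ} (h : a * d - b * c = 1) (hp : c * p + d ≠ 0)
    (hq : c * q + d ≠ 0) :
    (a * p + b) / (c * p + d) - (a * q + b) / (c * q + d) =
      (p - q) / ((c * p + d) * (c * q + d)) := by
  rw [div_sub_div _ _ hp hq]
  congr 1
  linear_combination (p - q) * h

lemma det_entries (g : SL(2, ℝ)) :
    (g 0 0 : ℂ) * (g 1 1 : ℂ) - (g 0 1 : ℂ) * (g 1 0 : ℂ) = 1 := by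
  have := g.det_coe
  rw [Matrix.det_fin_two] at this
  exact_mod_cast this

/-! ### The transformation law of the kernel -i(z - conj w) under the covering group. -/

namespace USL2

lemma coe_smul (g : USL2) (z : ℍ) : ((g.mat • z : ℍ) : ℂ) =
    ((g.mat 0 0 : ℂ) * z + (g.mat 0 1 : ℂ)) / ((g.mat 1 0 : ℂ) * z + (g.mat 1 1 : ℂ)) := by
  rw [UpperHalfPlane.coe_specialLinearGroup_apply]
  rfl

lemma denom_ne_zero (g : USL2) (z : ℍ) : (g.mat 1 0 : ℂ) * z + (g.mat 1 1 : ℂ) ≠ 0 := by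
  rw [← g.exp_log]
  exact Complex.exp_ne_zero _

lemma coe_smul_sub (g : USL2) (z w : ℍ) : ((g.mat • z : ℍ) : ℂ) - (g.mat • w : ℍ) =
    (z - w) * Complex.exp (-(g.log z + g.log w)) := by
  rw [coe_smul, coe_smul, moebius_sub (det_entries g.mat) (g.denom_ne_zero z) (g.denom_ne_zero w),
    Complex.exp_neg, Complex.exp_add, g.exp_log, g.exp_log, div_eq_mul_inv]

/-- The matrix is real, so conjugation commutes with the Möbius map; the rest is the formula for a
difference of two Möbius images. -/
lemma halfKernel_smul (g : USL2) (z w : ℍ) : halfKernel (g.mat • z) (g.mat • w) =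
    halfKernel z w * Complex.exp (-(g.log z + conj (g.log w))) := by
  have hw : conj ((g.mat • w : ℍ) : ℂ) =
      ((g.mat 0 0 : ℂ) * conj (w : ℂ) + (g.mat 0 1 : ℂ)) /
        ((g.mat 1 0 : ℂ) * conj (w : ℂ) + (g.mat 1 1 : ℂ)) := by
    rw [coe_smul]
    simp
  have hd : (g.mat 1 0 : ℂ) * conj (w : ℂ) + (g.mat 1 1 : ℂ) = Complex.exp (conj (g.log w)) := by
    rw [Complex.exp_conj, g.exp_log]
    simp
  have hne : (g.mat 1 0 : ℂ) * conj (w : ℂ) + (g.mat 1 1 : ℂ) ≠ 0 := by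
    rw [hd]
    exact Complex.exp_ne_zero _
  rw [halfKernel, hw, coe_smul, moebius_sub (det_entries g.mat) (g.denom_ne_zero z) hne,
    Complex.exp_neg, Complex.exp_add, g.exp_log z, ← hd, halfKernel, div_eq_mul_inv, mul_assoc]

/-- Both sides are continuous logarithms of the same function on the connected space `ℍ × ℍ`, so
equality at one point suffices. This removes any ambiguity by multiples of 2πi: real powers of the
kernel, taken with the principal logarithm, transform exactly by the branch stored in `g`. -/
lemma log_halfKernel_smul (g : USL2) (z w : ℍ) :
    Complex.log (halfKernel (g.mat • z) (g.mat • w)) =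
      Complex.log (halfKernel z w) - (g.log z + conj (g.log w)) := by
  have hc₁ : Continuous fun p : ℍ × ℍ =>
      Complex.log (halfKernel (g.mat • p.1) (g.mat • p.2)) := by
    have hm : Continuous fun p : ℍ × ℍ => (g.mat • p.1, g.mat • p.2) :=
      ((continuous_smul_mat g.mat).comp continuous_fst).prodMk
        ((continuous_smul_mat g.mat).comp continuous_snd)
    have h := continuous_log_halfKernel.comp hm
    exact h
  have hc₂ : Continuous fun p : ℍ × ℍ =>
      Complex.log (halfKernel p.1 p.2) - (g.log p.1 + conj (g.log p.2)) :=
    continuous_log_halfKernel.sub ((g.continuous_log.comp continuous_fst).add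
      (Complex.continuous_conj.comp (g.continuous_log.comp continuous_snd)))
  refine congr_fun (Complex.isCoveringMap_exp.eq_of_comp_eq hc₁ hc₂ ?_ (z, z) ?_) (z, w)
  · ext p
    simp only [Function.comp_apply]
    rw [Complex.exp_log (halfKernel_ne_zero _ _), sub_eq_add_neg, Complex.exp_add,
      Complex.exp_log (halfKernel_ne_zero _ _), halfKernel_smul]
  -- The point of comparison lies on the diagonal, where the kernel is the positive number 2 Im x
  -- and the principal logarithm is real.
  · have hdiag : ∀ x : ℍ, Complex.log (halfKernel x x) = (Real.log (2 * x.im) : ℝ) := by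
      intro x
      rw [Complex.ofReal_log (by have := x.im_pos; positivity)]
      congr 1
      apply Complex.ext
      · rw [halfKernel_re]
        simp [two_mul]
      · simp [halfKernel]
    simp only
    rw [hdiag, hdiag, im_smul_mat, Complex.norm_exp, Complex.add_conj, ← Complex.ofReal_sub]
    congr 1
    have := z.im_pos
    rw [← mul_div_assoc, Real.log_div (by positivity) (by positivity), Real.log_pow, Real.log_exp]
    push_cast
    ring

lemma continuous_mat : Continuous (mat : USL2 → SL(2, ℝ)) :=
  continuous_fst.comp (continuous_induced_dom (f := fun g : USL2 => (g.mat, g.log UpperHalfPlane.I)))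

lemma continuous_log_I : Continuous fun g : USL2 => g.log UpperHalfPlane.I :=
  continuous_snd.comp (continuous_induced_dom (f := fun g : USL2 => (g.mat, g.log UpperHalfPlane.I)))

lemma continuous_smul (z : ℍ) : Continuous fun g : USL2 => g.mat • z :=
  continuous_mat.smul continuous_const

/-- The topology of the group only records the branch at `i`. The transformation law with second
argument `i` expresses the branch at any other point through that value and the matrix. -/
lemma continuous_log_apply (z : ℍ) : Continuous fun g : USL2 => g.log z := by
  have h : ∀ g : USL2, g.log z = Complex.log (halfKernel z UpperHalfPlane.I) -
      Complex.log (halfKernel (g.mat • z) (g.mat • UpperHalfPlane.I)) -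
        conj (g.log UpperHalfPlane.I) := by
    intro g
    rw [log_halfKernel_smul]
    ring
  simp_rw [h]
  exact (continuous_const.sub (continuous_log_halfKernel.comp
    ((continuous_smul z).prodMk (continuous_smul _)))).sub
      (Complex.continuous_conj.comp continuous_log_I)

/-- A lift of a matrix to the universal covering group. -/
def lift (g : SL(2, ℝ)) : USL2 where
  mat := g
  log z := Complex.log ((g 1 0 : ℂ) * z + (g 1 1 : ℂ))
  continuous_log := by
    -- If c = 0 then cz + d is a constant, possibly a negative one; otherwise it is never real, so
    -- it avoids the cut of the principal logarithm.
    rcases eq_or_ne (g 1 0) 0 with h | h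
    · simp only [h, Complex.ofReal_zero, zero_mul, zero_add]
      exact continuous_const
    · have hc : Continuous fun z : ℍ => (g 1 0 : ℂ) * z + (g 1 1 : ℂ) :=
        (continuous_const.mul UpperHalfPlane.continuous_coe).add continuous_const
      refine hc.clog fun z => Or.inr ?_
      simpa using ⟨h, z.im_ne_zero⟩
  exp_log z := by
    refine Complex.exp_log ?_
    have hd := UpperHalfPlane.denom_ne_zero (g : GL (Fin 2) ℝ) z
    simpa [UpperHalfPlane.denom] using hd

@[simp] lemma lift_mat (g : SL(2, ℝ)) : (lift g).mat = g := rfl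

lemma exists_smul_I (z : ℍ) : ∃ g : USL2, g.mat • UpperHalfPlane.I = z := by
  obtain ⟨g, hg⟩ := MulAction.exists_smul_eq SL(2, ℝ) UpperHalfPlane.I z
  exact ⟨lift g, hg⟩

end USL2

/-! ### The Gamma integral with complex parameter -/

/-- Both sides are holomorphic in `A` on the right half-plane and agree for positive real `A` by the
classical Gamma integral; the identity theorem does the rest. -/
lemma integral_rpow_mul_cexp {μ : ℝ} (hμ : 0 < μ) {A : ℂ} (hA : 0 < A.re) :
    ∫ t in Ioi (0 : ℝ), ((t ^ (μ - 1) : ℝ) : ℂ) * Complex.exp (-A * t) =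
      Real.Gamma μ * Complex.exp (-(μ : ℂ) * Complex.log A) := by
  have hpre : IsPreconnected {A : ℂ | 0 < A.re} := (convex_halfSpace_re_gt 0).isPreconnected
  have hopen : IsOpen {A : ℂ | 0 < A.re} := isOpen_lt continuous_const Complex.continuous_re
  have hd₁ : DifferentiableOn ℂ (fun A : ℂ => ∫ t in Ioi (0 : ℝ), ((t ^ (μ - 1) : ℝ) : ℂ) *
      Complex.exp (-A * t)) {A : ℂ | 0 < A.re} := by
    intro A₀ hA₀
    refine DifferentiableAt.differentiableWithinAt ?_
    have hpos : 0 < A₀.re := hA₀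
    have hU : {A : ℂ | A₀.re / 2 < A.re} ∈ nhds A₀ :=
      (isOpen_lt continuous_const Complex.continuous_re).mem_nhds (by simpa using hpos)
    have h := differentiableAt_integral_exp (m := volume.restrict (Ioi (0 : ℝ)))
      (f := fun t => ((t ^ (μ - 1) : ℝ) : ℂ))
      (L := fun t : ℝ => (-(t : ℂ)) • ContinuousLinearMap.id ℂ ℂ)
      (s := fun t => t) (Measurable.aestronglyMeasurable (by fun_prop))
      (Continuous.aestronglyMeasurable (by fun_prop)) ?_
      (fun ε hε => ?_) hU
      (ε := A₀.re / 2) (by positivity) ?_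
    · refine h.congr_of_eventuallyEq (Filter.Eventually.of_forall fun A => ?_)
      refine integral_congr_ae (Filter.Eventually.of_forall fun t => ?_)
      simp only [smul_apply, ContinuousLinearMap.id_apply, smul_eq_mul]
      ring_nf
    · filter_upwards [ae_restrict_mem measurableSet_Ioi] with t ht
      refine ContinuousLinearMap.opNorm_le_bound _ (le_of_lt ht) fun z => ?_
      simp [abs_of_pos (show 0 < t from ht)]
    · have := integrableOn_rpow_mul_exp_neg_mul_rpow (p := 1) (s := μ - 1) (b := ε)
        (by linarith) one_pos hε
      refine IntegrableOn.congr_fun this (fun t ht => ?_) measurableSet_Ioi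
      simp only [Real.rpow_one]
      rw [Complex.norm_real, Real.norm_eq_abs, abs_of_pos (Real.rpow_pos_of_pos ht _)]
    · filter_upwards [ae_restrict_mem measurableSet_Ioi] with t ht z hz
      have ht' : 0 < t := ht
      have hz' : A₀.re / 2 < z.re := hz
      simp
      nlinarith
  have hd₂ : DifferentiableOn ℂ (fun A : ℂ =>
      (Real.Gamma μ : ℂ) * Complex.exp (-(μ : ℂ) * Complex.log A)) {A : ℂ | 0 < A.re} := by
    intro A hA
    refine DifferentiableAt.differentiableWithinAt ?_
    exact (((Complex.differentiableAt_log (Or.inl hA)).const_mul _).cexp).const_mul _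
  refine (hd₁.analyticOnNhd hopen).eqOn_of_preconnected_of_frequently_eq
    (hd₂.analyticOnNhd hopen) hpre (z₀ := 1) (by simp) ?_ hA
  have hreal : ∀ r : ℝ, 0 < r → ∫ t in Ioi (0 : ℝ), ((t ^ (μ - 1) : ℝ) : ℂ) *
      Complex.exp (-(r : ℂ) * t) = Real.Gamma μ * Complex.exp (-(μ : ℂ) * Complex.log r) := by
    intro r hr
    have h := Real.integral_rpow_mul_exp_neg_mul_Ioi hμ hr
    have h2 : (1 / r) ^ μ = Real.exp (-μ * Real.log r) := by
      rw [Real.rpow_def_of_pos (by positivity), one_div, Real.log_inv]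
      congr 1
      ring
    rw [h2] at h
    rw [← Complex.ofReal_log hr.le, mul_comm]
    norm_cast
    rw [← h]
    refine integral_congr_ae (Filter.Eventually.of_forall fun t => ?_)
    simp
  -- The identity theorem needs points of agreement different from 1 that accumulate at 1; the real
  -- points 1 + 1/(n+1) serve.
  have ht : Filter.Tendsto (fun n : ℕ => ((1 + 1 / ((n : ℝ) + 1) : ℝ) : ℂ)) Filter.atTop
      (nhdsWithin 1 {1}ᶜ) := by
    refine tendsto_nhdsWithin_iff.2 ⟨?_, Filter.Eventually.of_forall fun n => ?_⟩
    · have := (tendsto_one_div_add_atTop_nhds_zero_nat (𝕜 := ℝ)).const_add 1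
      rw [add_zero] at this
      exact_mod_cast (Complex.continuous_ofReal.tendsto 1).comp this
    · have : (0 : ℝ) < 1 / ((n : ℝ) + 1) := by positivity
      simp only [mem_compl_iff, mem_singleton_iff]
      rw [← Complex.ofReal_one, Complex.ofReal_inj]
      linarith
  exact ht.frequently (Filter.Frequently.of_forall fun n => hreal _ (by positivity))

/-! ### Integrals over the half line and tensor products -/

lemma integral_halfLine (a : ℝ) (F : ℝ → ℂ) :
    ∫ t, F t ∂(halfLine a) = ∫ t in Ioi (0 : ℝ), ((t ^ a : ℝ) : ℂ) * F t := by
  rw [halfLine, integral_withDensity_eq_integral_toReal_smul (measurable_ofReal_rpow a)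
    (Filter.Eventually.of_forall fun _ => ENNReal.ofReal_lt_top)]
  refine setIntegral_congr_fun measurableSet_Ioi fun t ht => ?_
  rw [ENNReal.toReal_ofReal (Real.rpow_nonneg (le_of_lt ht) _), Complex.real_smul]

lemma integral_halfLine_prod (a b : ℝ) (F : ℝ × ℝ → ℂ) :
    ∫ p, F p ∂((halfLine a).prod (halfLine b)) =
      ∫ p in Ioi (0 : ℝ) ×ˢ Ioi (0 : ℝ), ((p.1 ^ a * p.2 ^ b : ℝ) : ℂ) * F p := by
  have hw : Measurable fun p : ℝ × ℝ => ENNReal.ofReal (p.1 ^ a) * ENNReal.ofReal (p.2 ^ b) :=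
    ((measurable_ofReal_rpow _).comp measurable_fst).mul
      ((measurable_ofReal_rpow _).comp measurable_snd)
  rw [halfLine, halfLine, prod_withDensity (measurable_ofReal_rpow _) (measurable_ofReal_rpow _),
    integral_withDensity_eq_integral_toReal_smul hw
    (Filter.Eventually.of_forall fun _ => ENNReal.mul_lt_top ENNReal.ofReal_lt_top
      ENNReal.ofReal_lt_top), Measure.prod_restrict, ← Measure.volume_eq_prod]
  refine setIntegral_congr_fun (measurableSet_Ioi.prod measurableSet_Ioi) fun p hp => ?_
  rw [ENNReal.toReal_mul, ENNReal.toReal_ofReal (Real.rpow_nonneg (le_of_lt hp.1) _),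
    ENNReal.toReal_ofReal (Real.rpow_nonneg (le_of_lt hp.2) _), Complex.real_smul]

lemma ae_halfLine (a : ℝ) : ∀ᵐ t ∂(halfLine a), 0 < t :=
  (withDensity_absolutelyContinuous _ _).ae_le (ae_restrict_mem measurableSet_Ioi)

section Tensor

variable {X Y : Type*} [MeasurableSpace X] [MeasurableSpace Y] {μ : Measure X} {ν : Measure Y}
  [SFinite ν]

lemma memLp_mul_prod {f : X → ℂ} {g : Y → ℂ} (hf : MemLp f 2 μ) (hg : MemLp g 2 ν) :
    MemLp (fun p : X × Y => f p.1 * g p.2) 2 (μ.prod ν) := by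
  have hm : AEStronglyMeasurable (fun p : X × Y => f p.1 * g p.2) (μ.prod ν) :=
    hf.1.comp_fst.mul hg.1.comp_snd
  rw [memLp_two_iff hm]
  have h := lintegral_prod_mul (hf.1.enorm.pow_const 2) (hg.1.enorm.pow_const 2)
  simp only [enorm_mul, mul_pow]
  rw [h]
  exact ENNReal.mul_lt_top ((memLp_two_iff hf.1).1 hf) ((memLp_two_iff hg.1).1 hg)

/-- The tensor product of two square integrable functions. -/
def tensor (f : Lp ℂ 2 μ) (g : Lp ℂ 2 ν) : Lp ℂ 2 (μ.prod ν) :=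
  (memLp_mul_prod (Lp.memLp f) (Lp.memLp g)).toLp _

lemma coeFn_tensor (f : Lp ℂ 2 μ) (g : Lp ℂ 2 ν) :
    tensor f g =ᵐ[μ.prod ν] fun p => f p.1 * g p.2 :=
  MemLp.coeFn_toLp _

lemma inner_tensor [SFinite μ] (f f' : Lp ℂ 2 μ) (g g' : Lp ℂ 2 ν) :
    inner ℂ (tensor f g) (tensor f' g') = inner ℂ f f' * inner ℂ g g' := by
  rw [L2.inner_def, L2.inner_def, L2.inner_def, ← integral_prod_mul]
  refine integral_congr_ae ?_
  filter_upwards [coeFn_tensor f g, coeFn_tensor f' g'] with p h h'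
  rw [h, h']
  simp only [RCLike.inner_apply, map_mul]
  ring

end Tensor

/-! ### Powers times exponentials -/

/-- The function `t ^ a * exp (-i conj(w) t)`. -/
def powExp (a : ℝ) (w : ℍ) (t : ℝ) : ℂ :=
  ((t ^ a : ℝ) : ℂ) * Complex.exp (-Complex.I * conj (w : ℂ) * t)

lemma measurable_powExp (a : ℝ) (w : ℍ) : Measurable (powExp a w) := by
  unfold powExp
  fun_prop

lemma norm_powExp (a : ℝ) (w : ℍ) {t : ℝ} (ht : 0 < t) :
    ‖powExp a w t‖ = t ^ a * Real.exp (-w.im * t) := by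
  rw [powExp, norm_mul, Complex.norm_real, Real.norm_eq_abs,
    abs_of_pos (Real.rpow_pos_of_pos ht _), Complex.norm_exp]
  simp

/-- The condition on the exponents is integrability of t^(2a+b) at 0; at infinity the decay comes
from Im w > 0. -/
lemma memLp_powExp {a b : ℝ} (h : -1 < 2 * a + b) (w : ℍ) :
    MemLp (powExp a w) 2 (halfLine b) := by
  have hm := measurable_powExp a w
  rw [memLp_two_iff hm.aestronglyMeasurable, lintegral_halfLine _ _ (hm.enorm.pow_const 2)]
  have hi := integrableOn_rpow_mul_exp_neg_mul_rpow (p := 1) (s := 2 * a + b) (b := 2 * w.im)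
    h one_pos (by have := w.im_pos; positivity)
  refine lt_of_le_of_lt (setLIntegral_mono' measurableSet_Ioi fun t ht => ?_) hi.2
  have ht : 0 < t := ht
  rw [Real.enorm_eq_ofReal (by positivity), ← ofReal_norm, norm_powExp _ _ ht,
    ← ENNReal.ofReal_pow (by positivity), ← ENNReal.ofReal_mul (by positivity), mul_pow,
    ← Real.exp_nat_mul, ← Real.rpow_natCast, ← Real.rpow_mul ht.le, ← mul_assoc,
    ← Real.rpow_add ht]
  refine le_of_eq ?_
  simp only [Real.rpow_one]
  congr 3
  · push_cast
    ring
  · push_cast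
    ring

/-- The class of `t ^ (lam - 1 + s) * exp (-i conj(w) t)` in the space of the `L²`-model. -/
def powVec {lam : ℝ} (hlam : 1 < lam) (s : ℕ) (w : ℍ) : L2Half lam :=
  (memLp_powExp (a := lam - 1 + s) (b := 1 - lam)
    (by have : (0 : ℝ) ≤ s := Nat.cast_nonneg s
        linarith) w).toLp _

lemma coeFn_powVec {lam : ℝ} (hlam : 1 < lam) (s : ℕ) (w : ℍ) :
    powVec hlam s w =ᵐ[halfLine (1 - lam)] powExp (lam - 1 + s) w :=
  MemLp.coeFn_toLp _

lemma conj_powExp (a : ℝ) (w : ℍ) (t : ℝ) :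
    conj (powExp a w t) = ((t ^ a : ℝ) : ℂ) * Complex.exp (Complex.I * w * t) := by
  rw [powExp, map_mul, Complex.conj_ofReal, ← Complex.exp_conj]
  congr 2
  simp

/-- The power t^(lam-1) cancels the density t^(1-lam), leaving the Laplace integral. Thus these
vectors play the role of reproducing kernels. -/
lemma inner_powVec_zero {lam : ℝ} (hlam : 1 < lam) (z : ℍ) (f : L2Half lam) :
    inner ℂ (powVec hlam 0 z) f = (laplace hlam f : ℍ → ℂ) z := by
  have h : ∀ᵐ t ∂(halfLine (1 - lam)), inner ℂ (powVec hlam 0 z t) (f t) =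
      f t * conj (powExp (lam - 1) z t) := by
    filter_upwards [coeFn_powVec hlam 0 z] with t ht
    rw [ht, RCLike.inner_apply]
    simp
  rw [L2.inner_def, integral_congr_ae h, integral_halfLine]
  refine setIntegral_congr_fun measurableSet_Ioi fun t ht => ?_
  rw [conj_powExp, mul_left_comm (f t), ← mul_assoc, ← Complex.ofReal_mul, ← Real.rpow_add ht]
  simp

/-- The two phases multiply to exp(-A t) with A = `halfKernel z w`, and the powers and the density
multiply to t^(lam+s-1), so this is a Gamma integral of parameter lam + s. -/
lemma inner_powVec {lam : ℝ} (hlam : 1 < lam) (s : ℕ) (z w : ℍ) :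
    inner ℂ (powVec hlam 0 z) (powVec hlam s w) = Real.Gamma (lam + s) *
      Complex.exp (-((lam + s : ℝ) : ℂ) * Complex.log (halfKernel z w)) := by
  have hs : (0 : ℝ) ≤ s := Nat.cast_nonneg s
  have h : ∀ᵐ t ∂(halfLine (1 - lam)), inner ℂ (powVec hlam 0 z t) (powVec hlam s w t) =
      powExp (lam - 1 + s) w t * conj (powExp (lam - 1) z t) := by
    filter_upwards [coeFn_powVec hlam 0 z, coeFn_powVec hlam s w] with t ht ht'
    rw [ht, ht', RCLike.inner_apply]
    simp
  rw [L2.inner_def, integral_congr_ae h, integral_halfLine,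
    ← integral_rpow_mul_cexp (by linarith) (halfKernel_re_pos z w)]
  refine setIntegral_congr_fun measurableSet_Ioi fun t ht => ?_
  have e1 : (t : ℝ) ^ (lam + s - 1) = t ^ (1 - lam) * t ^ (lam - 1 + s) * t ^ (lam - 1) := by
    rw [← Real.rpow_add ht, ← Real.rpow_add ht]
    congr 1
    ring
  have e2 : Complex.exp (-halfKernel z w * t) = Complex.exp (-Complex.I * conj (w : ℂ) * t) *
      Complex.exp (Complex.I * z * t) := by
    rw [← Complex.exp_add]
    congr 1
    rw [halfKernel]
    ring
  rw [conj_powExp, powExp, e1, e2]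
  push_cast
  ring

lemma inner_tensor_powVec_zero {lam₁ lam₂ : ℝ} (h₁ : 1 < lam₁) (h₂ : 1 < lam₂) (z : ℍ × ℍ)
    (f : L2Quadrant lam₁ lam₂) :
    inner ℂ (tensor (powVec h₁ 0 z.1) (powVec h₂ 0 z.2)) f =
      (laplace₂ h₁ h₂ f : ℍ × ℍ → ℂ) z := by
  have h : ∀ᵐ p ∂((halfLine (1 - lam₁)).prod (halfLine (1 - lam₂))),
      inner ℂ (tensor (powVec h₁ 0 z.1) (powVec h₂ 0 z.2) p) (f p) =
      f p * (conj (powExp (lam₁ - 1) z.1 p.1) * conj (powExp (lam₂ - 1) z.2 p.2)) := by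
    filter_upwards [coeFn_tensor (powVec h₁ 0 z.1) (powVec h₂ 0 z.2),
      Measure.quasiMeasurePreserving_fst.ae (coeFn_powVec h₁ 0 z.1),
      Measure.quasiMeasurePreserving_snd.ae (coeFn_powVec h₂ 0 z.2)] with p hp hp₁ hp₂
    rw [hp, hp₁, hp₂, RCLike.inner_apply]
    simp
  rw [L2.inner_def, integral_congr_ae h, integral_halfLine_prod]
  refine setIntegral_congr_fun (measurableSet_Ioi.prod measurableSet_Ioi) fun p hp => ?_
  have hp₁ : 0 < p.1 := hp.1
  have hp₂ : 0 < p.2 := hp.2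
  have e : ∀ t lam : ℝ, 0 < t → ((t ^ (1 - lam) : ℝ) : ℂ) * ((t ^ (lam - 1) : ℝ) : ℂ) = 1 := by
    intro t lam ht
    rw [← Complex.ofReal_mul, ← Real.rpow_add ht]
    simp
  rw [conj_powExp, conj_powExp, mul_add, ← mul_assoc Complex.I, ← mul_assoc Complex.I,
    Complex.exp_add, Complex.ofReal_mul]
  linear_combination (f p * Complex.exp (Complex.I * z.1 * p.1) *
    Complex.exp (Complex.I * z.2 * p.2)) * (((p.1 ^ (1 - lam₁) : ℝ) : ℂ) *
      ((p.1 ^ (lam₁ - 1) : ℝ) : ℂ) * e p.2 lam₂ hp₂ + e p.1 lam₁ hp₁)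

/-! ### Injectivity of the Laplace transform -/

/-- Plancherel on the horizontal line of height `y`. The equality version of `lintegral_slice_le` is
what yields injectivity. -/
lemma lintegral_slice_eq {u : ℝ → ℂ} (hu : Measurable u) {y : ℝ}
    (h1 : IntegrableOn (fun t => u t * Real.exp (-y * t)) (Ioi 0))
    (h2 : ∫⁻ t in Ioi (0 : ℝ), ENNReal.ofReal (Real.exp (-2 * y * t)) * ‖u t‖ₑ ^ 2 < ∞) :
    ∫⁻ x : ℝ, ‖∫ t in Ioi (0 : ℝ), u t * Complex.exp (Complex.I * (x + y * Complex.I) * t)‖ₑ ^ 2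
      = ENNReal.ofReal (2 * Real.pi) *
        ∫⁻ t in Ioi (0 : ℝ), ENNReal.ofReal (Real.exp (-2 * y * t)) * ‖u t‖ₑ ^ 2 := by
  set v : ℝ → ℂ := (Ioi (0 : ℝ)).indicator fun t => u t * Real.exp (-y * t) with hv
  have hvm : Measurable v := by
    refine Measurable.indicator ?_ measurableSet_Ioi
    fun_prop
  have hvi : Integrable v := (integrable_indicator_iff measurableSet_Ioi).2 h1
  have e1 : ∫⁻ t in Ioi (0 : ℝ), ENNReal.ofReal (Real.exp (-2 * y * t)) * ‖u t‖ₑ ^ 2 =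
      ∫⁻ t, ‖v t‖ₑ ^ 2 := by
    rw [← lintegral_indicator measurableSet_Ioi]
    congr 1
    ext t
    by_cases ht : t ∈ Ioi (0 : ℝ)
    · simp only [hv, indicator_of_mem ht]
      rw [enorm_mul, mul_pow, mul_comm, ← ofReal_norm (Real.exp (-y * t) : ℂ),
        ← ENNReal.ofReal_pow (norm_nonneg _), Complex.norm_real, Real.norm_eq_abs, Real.abs_exp,
        ← Real.exp_nat_mul]
      congr 3
      push_cast
      ring
    · simp [hv, indicator_of_notMem ht]
  rw [e1] at h2 ⊢
  have hv2 : MemLp v 2 := (memLp_two_iff hvm.aestronglyMeasurable).2 h2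
  rw [← plancherel_lintegral hvi hv2]
  -- The Laplace integral at x + iy is the Fourier transform of the truncated damped function at
  -- -x/(2π); rescaling the variable produces the factor 2π.
  have e2 : ∀ x : ℝ, ∫ t in Ioi (0 : ℝ), u t *
      Complex.exp (Complex.I * (x + y * Complex.I) * t) = 𝓕 v ((-(2 * Real.pi)⁻¹) * x) := by
    intro x
    rw [Real.fourier_real_eq_integral_exp_smul, ← integral_indicator measurableSet_Ioi]
    congr 1
    ext t
    by_cases ht : t ∈ Ioi (0 : ℝ)
    · simp only [hv, indicator_of_mem ht]
      rw [smul_eq_mul, mul_comm, mul_comm (u t), ← mul_assoc, Complex.ofReal_exp,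
        ← Complex.exp_add]
      congr 2
      have : (Real.pi : ℂ) ≠ 0 := by exact_mod_cast Real.pi_ne_zero
      push_cast
      field_simp
      ring_nf
      simp
      ring
    · simp [hv, indicator_of_notMem ht]
  simp_rw [e2]
  have hc : Measurable fun ξ : ℝ => ‖𝓕 v ξ‖ₑ ^ 2 := by
    have hcont : Continuous (𝓕 v) :=
      VectorFourier.fourierIntegral_continuous Real.continuous_fourierChar
        (by exact continuous_inner) hvi
    exact hcont.measurable.enorm.pow_const 2
  have hne : (-(2 * Real.pi)⁻¹ : ℝ) ≠ 0 := by
    have := Real.pi_pos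
    exact neg_ne_zero.2 (by positivity)
  rw [← lintegral_map hc (measurable_const_mul _), Real.map_volume_mul_left hne,
    lintegral_smul_measure, smul_eq_mul]
  congr 2
  rw [inv_neg, inv_inv, abs_neg, abs_of_pos (by have := Real.pi_pos; positivity)]

lemma lintegral_exp_mul_lt_top {lam : ℝ} (hlam : 1 < lam) {u : ℝ → ℂ} (hu : Measurable u)
    (h : ∫⁻ t, ‖u t‖ₑ ^ 2 ∂(halfLine (1 - lam)) < ∞) {y : ℝ} (hy : 0 < y) :
    ∫⁻ t in Ioi (0 : ℝ), ENNReal.ofReal (Real.exp (-2 * y * t)) * ‖u t‖ₑ ^ 2 < ∞ := by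
  rw [lintegral_halfLine _ _ (hu.enorm.pow_const 2)] at h
  -- With this choice exp(-2yt) = exp(bt)^(1-lam). Since bt ≤ exp(bt) and the exponent is negative,
  -- the exponential is dominated by a multiple of the density t^(1-lam).
  set b := 2 * y / (lam - 1) with hb
  have hl : 0 < lam - 1 := by linarith
  have hbpos : 0 < b := by positivity
  refine lt_of_le_of_lt (setLIntegral_mono' (g := fun t => ENNReal.ofReal (b ^ (1 - lam)) *
    (ENNReal.ofReal (t ^ (1 - lam)) * ‖u t‖ₑ ^ 2)) measurableSet_Ioi fun t ht => ?_) ?_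
  · have ht : 0 < t := ht
    rw [← mul_assoc, ← ENNReal.ofReal_mul (by positivity), ← Real.mul_rpow hbpos.le ht.le]
    gcongr
    have h1 : b * t ≤ Real.exp (b * t) := by linarith [Real.add_one_le_exp (b * t)]
    have h2 : Real.exp (-2 * y * t) = Real.exp (b * t) ^ (1 - lam) := by
      rw [← Real.exp_mul]
      congr 1
      rw [hb]
      field_simp
      ring
    rw [h2]
    exact Real.rpow_le_rpow_of_nonpos (by positivity) h1 (by linarith)
  · rw [lintegral_const_mul' _ _ ENNReal.ofReal_ne_top]
    exact ENNReal.mul_lt_top ENNReal.ofReal_lt_top h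

/-- A single horizontal line on which the transform vanishes almost everywhere is enough: Plancherel
there kills u(t) exp(-yt). Vanishing is assumed only almost everywhere because the two-variable case
supplies no more. -/
lemma ae_eq_zero_of_laplace_eq_zero {lam : ℝ} (hlam : 1 < lam) {u : ℝ → ℂ} (hu : Measurable u)
    (h : ∫⁻ t, ‖u t‖ₑ ^ 2 ∂(halfLine (1 - lam)) < ∞)
    (h0 : ∀ᵐ z : ℍ ∂(bergmanMeasure lam),
      ∫ t in Ioi (0 : ℝ), u t * Complex.exp (Complex.I * z * t) = 0) :
    ∀ᵐ t ∂(halfLine (1 - lam)), u t = 0 := by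
  have hm := (measurable_laplace hu).enorm.pow_const 2
  have e1 : ∫⁻ z : ℍ, ‖∫ t in Ioi (0 : ℝ), u t * Complex.exp (Complex.I * z * t)‖ₑ ^ 2
      ∂(bergmanMeasure lam) = 0 := by
    rw [← lintegral_zero (μ := bergmanMeasure lam)]
    refine lintegral_congr_ae ?_
    filter_upwards [h0] with z hz
    simp [hz]
  rw [lintegral_bergman lam (F := fun z => ‖∫ t in Ioi (0 : ℝ), u t *
    Complex.exp (Complex.I * z * t)‖ₑ ^ 2) hm] at e1
  have hm2 : Measurable fun y : ℝ => ENNReal.ofReal (y ^ (lam - 2)) * ∫⁻ x : ℝ,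
      ‖∫ t in Ioi (0 : ℝ), u t * Complex.exp (Complex.I * (x + y * Complex.I) * t)‖ₑ ^ 2 := by
    refine (measurable_ofReal_rpow _).mul ?_
    have : Measurable fun p : ℝ × ℝ => ‖∫ t in Ioi (0 : ℝ), u t *
        Complex.exp (Complex.I * (p.2 + p.1 * Complex.I) * t)‖ₑ ^ 2 :=
      hm.comp (g := fun z : ℂ => ‖∫ t in Ioi (0 : ℝ), u t *
        Complex.exp (Complex.I * z * t)‖ₑ ^ 2) (f := fun p : ℝ × ℝ => (p.2 + p.1 * Complex.I : ℂ))
        (by fun_prop)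
    exact this.lintegral_prod_right'
  rw [lintegral_eq_zero_iff hm2] at e1
  have hne : (volume.restrict (Ioi (0 : ℝ))) ≠ 0 := by
    rw [Ne, Measure.restrict_eq_zero]
    simp
  have : (ae (volume.restrict (Ioi (0 : ℝ)))).NeBot := ae_neBot.2 hne
  -- Almost every height qualifies, and the half line has positive measure, so a suitable height
  -- exists.
  obtain ⟨y, hy1, hy⟩ := (e1.and (ae_restrict_mem measurableSet_Ioi)).exists
  have hy : 0 < y := hy
  have hfin := lintegral_exp_mul_lt_top hlam hu h hy
  have hs := lintegral_slice_eq hu (y := y) (by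
    refine (integrableOn_mul_exp hlam hu h hy).mono' (by fun_prop) ?_
    refine Filter.Eventually.of_forall fun t => ?_
    rw [norm_mul, Complex.norm_real, Real.norm_eq_abs, Real.abs_exp]) hfin
  have hz : ∫⁻ x : ℝ, ‖∫ t in Ioi (0 : ℝ), u t *
      Complex.exp (Complex.I * (x + y * Complex.I) * t)‖ₑ ^ 2 = 0 := by
    refine (mul_eq_zero.1 hy1).resolve_left ?_
    exact (ENNReal.ofReal_pos.2 (Real.rpow_pos_of_pos hy _)).ne'
  rw [hz] at hs
  have h3 : ∫⁻ t in Ioi (0 : ℝ), ENNReal.ofReal (Real.exp (-2 * y * t)) * ‖u t‖ₑ ^ 2 = 0 := by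
    refine (mul_eq_zero.1 hs.symm).resolve_left ?_
    exact (ENNReal.ofReal_pos.2 (by have := Real.pi_pos; positivity)).ne'
  rw [lintegral_eq_zero_iff (by
    have := hu.enorm.pow_const 2
    fun_prop)] at h3
  refine (withDensity_absolutelyContinuous _ _).ae_le ?_
  filter_upwards [h3] with t ht
  have := (mul_eq_zero.1 ht).resolve_left (ENNReal.ofReal_pos.2 (Real.exp_pos _)).ne'
  simpa using this

lemma total_powVec {lam : ℝ} (hlam : 1 < lam) : Total (powVec hlam 0) := by
  intro f hf
  have hm : Measurable (f : ℝ → ℂ) := (Lp.stronglyMeasurable f).measurable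
  have hfin : ∫⁻ t, ‖f t‖ₑ ^ 2 ∂(halfLine (1 - lam)) < ∞ :=
    (memLp_two_iff (Lp.memLp f).1).1 (Lp.memLp f)
  refine (Lp.eq_zero_iff_ae_eq_zero).2
    (ae_eq_zero_of_laplace_eq_zero hlam hm hfin (Filter.Eventually.of_forall fun z => ?_))
  have := hf z
  rwa [inner_powVec_zero] at this

/-- One-variable injectivity is applied twice: first in `y` to the partial transform `G z`, then in
`x` to the slices of `f`. -/
lemma ae_eq_zero_of_laplace₂_eq_zero {lam₁ lam₂ : ℝ} (h₁ : 1 < lam₁) (h₂ : 1 < lam₂)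
    {f : ℝ × ℝ → ℂ} (hf : Measurable f)
    (h : ∫⁻ p, ‖f p‖ₑ ^ 2 ∂((halfLine (1 - lam₁)).prod (halfLine (1 - lam₂))) < ∞)
    (h0 : ∀ z : ℍ × ℍ, ∫ p in Ioi (0 : ℝ) ×ˢ Ioi (0 : ℝ),
        f p * Complex.exp (Complex.I * (z.1 * p.1 + z.2 * p.2)) = 0) :
    ∀ᵐ p ∂((halfLine (1 - lam₁)).prod (halfLine (1 - lam₂))), f p = 0 := by
  have hr : (volume : Measure (ℝ × ℝ)).restrict (Ioi 0 ×ˢ Ioi 0) =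
      (volume.restrict (Ioi 0)).prod (volume.restrict (Ioi 0)) := by
    rw [Measure.volume_eq_prod, Measure.prod_restrict]
  set G : ℂ → ℝ → ℂ := fun z y =>
    ∫ x in Ioi (0 : ℝ), f (x, y) * Complex.exp (Complex.I * z * x) with hG
  have hGm : Measurable fun q : ℂ × ℝ => G q.1 q.2 := by
    have : StronglyMeasurable fun p : (ℂ × ℝ) × ℝ =>
        f (p.2, p.1.2) * Complex.exp (Complex.I * p.1.1 * p.2) := by
      refine Measurable.stronglyMeasurable ?_
      fun_prop
    exact (this.integral_prod_right (ν := volume.restrict (Ioi (0 : ℝ)))).measurable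
  have hexp : ∀ z : ℍ × ℍ,
      ∫ y in Ioi (0 : ℝ), G z.1 y * Complex.exp (Complex.I * z.2 * y) = 0 := by
    intro z
    rw [← h0 z, hr, integral_prod_symm]
    · refine integral_congr_ae (Filter.Eventually.of_forall fun y => ?_)
      simp only [hG]
      rw [← integral_mul_const]
      refine integral_congr_ae (Filter.Eventually.of_forall fun x => ?_)
      simp only
      rw [mul_assoc, ← Complex.exp_add]
      congr 2
      ring
    · rw [← hr]
      refine (integrableOn_mul_exp₂ h₁ h₂ hf h (lt_min z.1.im_pos z.2.im_pos)).mono'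
        (by fun_prop) ?_
      filter_upwards [ae_restrict_mem (measurableSet_Ioi.prod measurableSet_Ioi)] with p hp
      have hp₁ : 0 < p.1 := hp.1
      have hp₂ : 0 < p.2 := hp.2
      rw [norm_mul, Complex.norm_exp]
      gcongr
      simp
      nlinarith [min_le_left z.1.im z.2.im, min_le_right z.1.im z.2.im]
  have hGc : Measurable fun q : ℍ × ℝ => G q.1 q.2 :=
    hGm.comp (f := fun q : ℍ × ℝ => ((q.1 : ℂ), q.2))
      ((UpperHalfPlane.measurable_coe.comp measurable_fst).prodMk measurable_snd)
  have hslice : ∀ᵐ y ∂(halfLine (1 - lam₂)),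
      ∫⁻ x, ‖f (x, y)‖ₑ ^ 2 ∂(halfLine (1 - lam₁)) < ∞ := by
    have h' := h
    rw [lintegral_prod_symm _ (hf.enorm.pow_const 2).aemeasurable] at h'
    exact ae_lt_top (hf.enorm.pow_const 2).lintegral_prod_left' h'.ne
  -- The norm bound for the transform in `x`, integrated over `y`, shows by Tonelli that `G z` is
  -- square integrable for almost every `z`.
  have hGfin : ∀ᵐ z : ℍ ∂(bergmanMeasure lam₁), ∫⁻ y, ‖G z y‖ₑ ^ 2 ∂(halfLine (1 - lam₂)) < ∞ := by
    refine ae_lt_top (hGc.enorm.pow_const 2).lintegral_prod_right' (ne_of_lt ?_)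
    rw [lintegral_lintegral_swap (hGc.enorm.pow_const 2).aemeasurable]
    calc _ ≤ ∫⁻ y, laplaceConst lam₁ *
        ∫⁻ x, ‖f (x, y)‖ₑ ^ 2 ∂(halfLine (1 - lam₁)) ∂(halfLine (1 - lam₂)) := by
          refine lintegral_mono fun y => ?_
          exact lintegral_laplace_le h₁ (u := fun x => f (x, y)) (by fun_prop)
      _ = laplaceConst lam₁ *
          ∫⁻ p, ‖f p‖ₑ ^ 2 ∂((halfLine (1 - lam₁)).prod (halfLine (1 - lam₂))) := by
          rw [lintegral_const_mul' _ _ (laplaceConst_ne_top _), lintegral_prod_symm]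
          exact (hf.enorm.pow_const 2).aemeasurable
      _ < ∞ := ENNReal.mul_lt_top (laplaceConst_ne_top _).lt_top h
  have hG0 : ∀ᵐ z : ℍ ∂(bergmanMeasure lam₁), ∀ᵐ y ∂(halfLine (1 - lam₂)), G z y = 0 := by
    filter_upwards [hGfin] with z hz
    exact ae_eq_zero_of_laplace_eq_zero h₂ (u := G z)
      (hGm.comp (measurable_const.prodMk measurable_id)) hz
      (Filter.Eventually.of_forall fun w => hexp (z, w))
  -- After the swap, for almost every `y` the transform of the slice vanishes for almost every `z`;
  -- the exceptional set may depend on `y`.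
  rw [Measure.ae_ae_comm (p := fun (z : ℍ) (y : ℝ) => G z y = 0)
    (measurableSet_eq_fun hGc measurable_const)] at hG0
  rw [Measure.ae_prod_iff_ae_ae (measurableSet_eq_fun hf measurable_const),
    Measure.ae_ae_comm (p := fun x y => f (x, y) = 0) (measurableSet_eq_fun hf measurable_const)]
  filter_upwards [hG0, hslice] with y hy hy'
  exact ae_eq_zero_of_laplace_eq_zero h₁ (u := fun x => f (x, y)) (by fun_prop) hy' hy

lemma total_tensor_powVec {lam₁ lam₂ : ℝ} (h₁ : 1 < lam₁) (h₂ : 1 < lam₂) :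
    Total fun z : ℍ × ℍ => tensor (powVec h₁ 0 z.1) (powVec h₂ 0 z.2) := by
  intro f hf
  have hm : Measurable (f : ℝ × ℝ → ℂ) := (Lp.stronglyMeasurable f).measurable
  have hfin : ∫⁻ p, ‖f p‖ₑ ^ 2 ∂((halfLine (1 - lam₁)).prod (halfLine (1 - lam₂))) < ∞ :=
    (memLp_two_iff (Lp.memLp f).1).1 (Lp.memLp f)
  refine (Lp.eq_zero_iff_ae_eq_zero).2
    (ae_eq_zero_of_laplace₂_eq_zero h₁ h₂ hm hfin fun z => ?_)
  have := hf z
  rwa [inner_tensor_powVec_zero] at this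

/-! ### The `L²`-models as kernel representations -/

/-- Expanding ‖e y - e x‖² expresses it through the Gram matrix alone, so norm continuity can be
read off from the kernel. -/
lemma continuous_of_continuous_inner {X H : Type*} [TopologicalSpace X] [NormedAddCommGroup H]
    [InnerProductSpace ℂ H] {e : X → H}
    (h : Continuous fun p : X × X => (inner ℂ (e p.1) (e p.2) : ℂ)) : Continuous e := by
  refine continuous_iff_continuousAt.2 fun x => ?_
  rw [ContinuousAt, tendsto_iff_norm_sub_tendsto_zero]
  have hsq : ∀ y, ‖e y - e x‖ = Real.sqrt ((inner ℂ (e y) (e y) : ℂ).re -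
      2 * (inner ℂ (e y) (e x) : ℂ).re + (inner ℂ (e x) (e x) : ℂ).re) := by
    intro y
    rw [← Real.sqrt_sq (norm_nonneg (e y - e x)), norm_sub_sq (𝕜 := ℂ),
      ← inner_self_eq_norm_sq (𝕜 := ℂ), ← inner_self_eq_norm_sq (𝕜 := ℂ)]
    rfl
  have h1 : Continuous fun y => (inner ℂ (e y) (e y) : ℂ) :=
    h.comp (continuous_id.prodMk continuous_id)
  have h2 : Continuous fun y => (inner ℂ (e y) (e x) : ℂ) :=
    h.comp (continuous_id.prodMk continuous_const)
  have hc : Continuous fun y => Real.sqrt ((inner ℂ (e y) (e y) : ℂ).re -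
      2 * (inner ℂ (e y) (e x) : ℂ).re + (inner ℂ (e x) (e x) : ℂ).re) := by
    fun_prop
  have := hc.tendsto x
  simp only [← hsq] at this
  simpa using this

lemma cocycle_one (lam : ℝ) (z : ℍ) : cocycle lam 1 z = 1 := by
  simp [cocycle]

lemma cocycle_mul (lam : ℝ) (g h : USL2) (z : ℍ) :
    cocycle lam (g * h) z = cocycle lam h z * cocycle lam g (h.mat • z) := by
  rw [cocycle, cocycle, cocycle, USL2.mul_log, ← Complex.exp_add]
  congr 1
  ring

lemma continuous_cocycle_left (lam : ℝ) (z : ℍ) : Continuous fun g => cocycle lam g z :=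
  Complex.continuous_exp.comp (continuous_const.mul (USL2.continuous_log_apply z))

/-- The Gram entry is the power of exponent -(lam+s) of the half-plane kernel, so its covariance is
`log_halfKernel_smul` multiplied by that exponent and exponentiated. -/
lemma inner_powVec_smul {lam : ℝ} (hlam : 1 < lam) (s : ℕ) (g : USL2) (z w : ℍ) :
    cocycle (lam + s) g z * conj (cocycle (lam + s) g w) *
      inner ℂ (powVec hlam 0 (g.mat • z)) (powVec hlam s (g.mat • w)) =
    inner ℂ (powVec hlam 0 z) (powVec hlam s w) := by
  rw [inner_powVec, inner_powVec, USL2.log_halfKernel_smul, cocycle, cocycle, ← Complex.exp_conj,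
    ← Complex.exp_add, mul_left_comm, ← Complex.exp_add]
  congr 2
  simp
  ring

lemma continuous_powVec {lam : ℝ} (hlam : 1 < lam) : Continuous (powVec hlam 0) := by
  refine continuous_of_continuous_inner ?_
  simp only [inner_powVec]
  exact continuous_const.mul
    (Complex.continuous_exp.comp (continuous_const.mul continuous_log_halfKernel))

/-- The cocycle is conjugated because evaluation at a point is a pairing in whose conjugate linear
slot the vector stands. -/
lemma kernelRep_powVec {lam : ℝ} (hlam : 1 < lam) :
    KernelRep (powVec hlam 0) (fun (g : USL2) z => g.mat • z)
      (fun g z => conj (cocycle lam g z)) where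
  total := total_powVec hlam
  inner_eq g x y := by
    have h := inner_powVec_smul hlam 0 g x y
    rw [Nat.cast_zero, add_zero] at h
    rw [inner_smul_left, inner_smul_right, Complex.conj_conj, ← mul_assoc, h]
  one_smul x := by simp [cocycle_one]
  mul_smul g h x := by
    rw [cocycle_mul, map_mul, USL2.mul_mat, mul_smul g.mat h.mat x]
  continuous_smul x := by
    exact (Complex.continuous_conj.comp (continuous_cocycle_left lam x)).smul
      ((continuous_powVec hlam).comp (USL2.continuous_smul x))

lemma continuous_tensor_powVec {lam₁ lam₂ : ℝ} (h₁ : 1 < lam₁) (h₂ : 1 < lam₂) :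
    Continuous fun z : ℍ × ℍ => tensor (powVec h₁ 0 z.1) (powVec h₂ 0 z.2) := by
  refine continuous_of_continuous_inner ?_
  simp only [inner_tensor]
  have c₁ := continuous_powVec h₁
  have c₂ := continuous_powVec h₂
  fun_prop

lemma kernelRep_tensor {lam₁ lam₂ : ℝ} (h₁ : 1 < lam₁) (h₂ : 1 < lam₂) :
    KernelRep (fun z : ℍ × ℍ => tensor (powVec h₁ 0 z.1) (powVec h₂ 0 z.2))
      (fun (g : USL2) z => (g.mat • z.1, g.mat • z.2))
      (fun g z => conj (cocycle lam₁ g z.1 * cocycle lam₂ g z.2)) where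
  total := total_tensor_powVec h₁ h₂
  inner_eq g x y := by
    have k₁ := (kernelRep_powVec h₁).inner_eq g x.1 y.1
    have k₂ := (kernelRep_powVec h₂).inner_eq g x.2 y.2
    rw [inner_smul_left, inner_smul_right] at k₁ k₂ ⊢
    rw [inner_tensor, inner_tensor, ← k₁, ← k₂]
    simp only [map_mul]
    ring
  one_smul x := by simp [cocycle_one]
  mul_smul g h x := by
    simp only [cocycle_mul, map_mul, USL2.mul_mat, mul_smul g.mat h.mat]
    congr 1
    ring
  continuous_smul x := by
    have hm : Continuous fun g : USL2 => (g.mat • x.1, g.mat • x.2) :=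
      (USL2.continuous_smul x.1).prodMk (USL2.continuous_smul x.2)
    exact (Complex.continuous_conj.comp ((continuous_cocycle_left lam₁ x.1).mul
      (continuous_cocycle_left lam₂ x.2))).smul ((continuous_tensor_powVec h₁ h₂).comp hm)

/-- Unitarity moves the group element onto the known vector. For the kernels above, this reads the
action of `g` on transforms as translation by the inverse with the cocycle. -/
lemma KernelRep.inner_rep {G X H : Type*} [Group G] [TopologicalSpace G] [NormedAddCommGroup H]
    [InnerProductSpace ℂ H] [CompleteSpace H] {e : X → H} {a : G → X → X} {m : G → X → ℂ}
    (h : KernelRep e a m) (g : G) (x : X) (f : H) :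
    inner ℂ (e x) (h.rep g f) = conj (m g⁻¹ x) * inner ℂ (e (a g⁻¹ x)) f := by
  rw [h.isUnitaryRep.inner_left (π := fun g f => h.rep g f), h.rep_apply, inner_smul_left]

/-- The translate of a Laplace transform is itself exhibited as a Laplace transform, so
`Function.invFun` returns the right vector as soon as the transform is injective. Surjectivity plays
no role. -/
lemma l2Model_eq {lam : ℝ} (hlam : 1 < lam) (g : USL2) (f : L2Half lam) :
    l2Model hlam g f = (kernelRep_powVec hlam).rep g f := by
  have hinj : Function.Injective (laplace hlam) := fun f f' h =>
    (total_powVec hlam).ext fun z => by rw [inner_powVec_zero, inner_powVec_zero, h]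
  have h : discreteSeries lam g (laplace hlam f) =
      laplace hlam ((kernelRep_powVec hlam).rep g f) := by
    ext z
    rw [← inner_powVec_zero, KernelRep.inner_rep, inner_powVec_zero, Complex.conj_conj]
    rfl
  rw [l2Model, h, Function.leftInverse_invFun hinj]

lemma l2Model₂_eq {lam₁ lam₂ : ℝ} (h₁ : 1 < lam₁) (h₂ : 1 < lam₂) (g : USL2)
    (f : L2Quadrant lam₁ lam₂) :
    l2Model₂ h₁ h₂ (g, g) f = (kernelRep_tensor h₁ h₂).rep g f := by
  have hinj : Function.Injective (laplace₂ h₁ h₂) := fun f f' h =>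
    (total_tensor_powVec h₁ h₂).ext fun z => by
      rw [inner_tensor_powVec_zero, inner_tensor_powVec_zero, h]
  have h : outerProduct lam₁ lam₂ (g, g) (laplace₂ h₁ h₂ f) =
      laplace₂ h₁ h₂ ((kernelRep_tensor h₁ h₂).rep g f) := by
    ext z
    have k := (kernelRep_tensor h₁ h₂).inner_rep g z f
    beta_reduce at k
    rw [← inner_tensor_powVec_zero, k, inner_tensor_powVec_zero, Complex.conj_conj]
    rfl
  rw [l2Model₂, h, Function.leftInverse_invFun hinj]

/-! ### Rotation invariant functions on the upper half-plane -/

/-- The rotation by the angle `θ`. -/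
def rotation (θ : ℝ) : SL(2, ℝ) :=
  ⟨!![Real.cos θ, Real.sin θ; -Real.sin θ, Real.cos θ], by
    rw [Matrix.det_fin_two_of]
    linear_combination Real.sin_sq_add_cos_sq θ⟩

/-- The inverse of the Cayley transform. -/
def invCayley (ζ : ℂ) : ℂ := Complex.I * (1 + ζ) / (1 - ζ)

lemma one_sub_ne_zero {ζ : ℂ} (hζ : ‖ζ‖ < 1) : 1 - ζ ≠ 0 := by
  intro h
  rw [← sub_eq_zero.1 h] at hζ
  simp at hζ

lemma invCayley_im_pos {ζ : ℂ} (hζ : ‖ζ‖ < 1) : 0 < (invCayley ζ).im := by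
  have h1 := Complex.normSq_pos.2 (one_sub_ne_zero hζ)
  have h2 : Complex.normSq ζ < 1 := by
    rw [Complex.normSq_eq_norm_sq]
    nlinarith [norm_nonneg ζ]
  have h3 : (invCayley ζ).im = (1 - Complex.normSq ζ) / Complex.normSq (1 - ζ) := by
    rw [invCayley, Complex.div_im, ← sub_div]
    congr 1
    simp [Complex.normSq_apply]
    ring
  rw [h3]
  exact div_pos (by linarith) h1

lemma ofComplex_invCayley {ζ : ℂ} (hζ : ‖ζ‖ < 1) :
    ((UpperHalfPlane.ofComplex (invCayley ζ) : ℍ) : ℂ) = invCayley ζ := by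
  rw [UpperHalfPlane.ofComplex_apply_of_im_pos (invCayley_im_pos hζ)]

/-- In the disc model the rotations of the half-plane about `i` become multiplications by exp(2iθ).
-/
lemma rotation_smul_invCayley (θ : ℝ) {ζ : ℂ} (hζ : ‖ζ‖ < 1) :
    rotation θ • UpperHalfPlane.ofComplex (invCayley ζ) =
      UpperHalfPlane.ofComplex (invCayley (Complex.exp (2 * θ * Complex.I) * ζ)) := by
  have hζ' : ‖Complex.exp (2 * θ * Complex.I) * ζ‖ < 1 := by
    have : (2 * θ * Complex.I : ℂ) = ((2 * θ : ℝ) : ℂ) * Complex.I := by push_cast; ring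
    rwa [norm_mul, this, Complex.norm_exp_ofReal_mul_I, one_mul]
  apply UpperHalfPlane.ext
  have hd := (USL2.lift (rotation θ)).denom_ne_zero (UpperHalfPlane.ofComplex (invCayley ζ))
  have hs := (USL2.lift (rotation θ)).coe_smul (UpperHalfPlane.ofComplex (invCayley ζ))
  rw [USL2.lift_mat, ofComplex_invCayley hζ] at hd hs
  rw [hs, ofComplex_invCayley hζ', div_eq_iff hd]
  have e1 : ((rotation θ) 0 0 : ℂ) = Complex.cos θ := Complex.ofReal_cos θ
  have e2 : ((rotation θ) 0 1 : ℂ) = Complex.sin θ := Complex.ofReal_sin θ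
  have e3 : ((rotation θ) 1 0 : ℂ) = -Complex.sin θ := by
    rw [← Complex.ofReal_sin, ← Complex.ofReal_neg]
    rfl
  have e4 : ((rotation θ) 1 1 : ℂ) = Complex.cos θ := Complex.ofReal_cos θ
  rw [e1, e2, e3, e4]
  have hZ : invCayley ζ * (1 - ζ) = Complex.I * (1 + ζ) := by
    rw [invCayley, div_mul_cancel₀ _ (one_sub_ne_zero hζ)]
  have h0 := one_sub_ne_zero hζ
  have h0' := one_sub_ne_zero hζ'
  have he : Complex.exp (2 * θ * Complex.I) =
      Complex.exp (θ * Complex.I) * Complex.exp (θ * Complex.I) := by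
    rw [← Complex.exp_add]
    congr 1
    ring
  have hee : Complex.exp (θ * Complex.I) * Complex.exp (-θ * Complex.I) = 1 := by
    rw [← Complex.exp_add]
    simp
  rw [he] at h0' ⊢
  rw [Complex.cos, Complex.sin, invCayley.eq_def (_ * _ * ζ), div_mul_eq_mul_div (Complex.I * _),
    eq_div_iff h0']
  refine mul_right_cancel₀ h0 ?_
  set e := Complex.exp (θ * Complex.I)
  set e' := Complex.exp (-θ * Complex.I)
  have hI := Complex.I_sq
  -- `hA` and `hB` are the numerator and the denominator of the Möbius image, cleared of 1 - ζ;
  -- since e e' = 1, their quotient is i(1 + e²ζ)/(1 - e²ζ).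
  have hA : ((e + e') / 2 * invCayley ζ + (e' - e) * Complex.I / 2) * (1 - ζ) =
      Complex.I * (e' + e * ζ) := by
    linear_combination ((e + e') / 2) * hZ
  have hB : (-((e' - e) * Complex.I / 2) * invCayley ζ + (e + e') / 2) * (1 - ζ) =
      e' - e * ζ := by
    linear_combination (-((e' - e) * Complex.I / 2)) * hZ -
      ((e' - e) / 2 * (1 + ζ)) * hI
  linear_combination (1 - e * e * ζ) * hA - Complex.I * (1 + e * e * ζ) * hB -
    2 * Complex.I * ζ * e * hee

lemma exists_invCayley (z : ℍ) :
    ∃ ζ : ℂ, ‖ζ‖ < 1 ∧ UpperHalfPlane.ofComplex (invCayley ζ) = z := by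
  have hne : (z : ℂ) + Complex.I ≠ 0 := by
    intro h
    have := congrArg Complex.im h
    simp at this
    have := z.im_pos
    linarith
  have hlt : ‖((z : ℂ) - Complex.I) / (z + Complex.I)‖ < 1 := by
    rw [norm_div, div_lt_one (norm_pos_iff.2 hne)]
    refine lt_of_pow_lt_pow_left₀ 2 (norm_nonneg _) ?_
    rw [← Complex.normSq_eq_norm_sq, ← Complex.normSq_eq_norm_sq, Complex.normSq_apply,
      Complex.normSq_apply]
    have := z.im_pos
    simp
    nlinarith
  refine ⟨((z : ℂ) - Complex.I) / (z + Complex.I), hlt, ?_⟩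
  apply UpperHalfPlane.ext
  rw [ofComplex_invCayley hlt, invCayley, div_eq_iff (one_sub_ne_zero hlt)]
  field_simp
  ring

lemma rotation_smul_I (θ : ℝ) : rotation θ • UpperHalfPlane.I = UpperHalfPlane.I := by
  have h : UpperHalfPlane.ofComplex (invCayley 0) = UpperHalfPlane.I := by
    apply UpperHalfPlane.ext
    rw [ofComplex_invCayley (by simp)]
    simp [invCayley]
  have := rotation_smul_invCayley θ (ζ := 0) (by simp)
  rwa [mul_zero, h] at this

/-- On the disc the function is constant on every circle about 0, so its value there is its circle
average, which by the mean value property is its value at the centre. -/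
lemma eq_of_rotation_invariant {R : ℍ → ℂ}
    (hR : DifferentiableOn ℂ (fun z : ℂ => R (UpperHalfPlane.ofComplex z)) {z | 0 < z.im})
    (hinv : ∀ θ z, R (rotation θ • z) = R z) (z : ℍ) : R z = R UpperHalfPlane.I := by
  set S : ℂ → ℂ := fun ζ => R (UpperHalfPlane.ofComplex (invCayley ζ)) with hS
  have hSd : DifferentiableOn ℂ S (Metric.ball 0 1) := by
    refine hR.comp (t := {z | 0 < z.im}) (f := invCayley) (fun ζ hζ => ?_) fun ζ hζ =>
      invCayley_im_pos (by simpa using hζ)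
    have h := one_sub_ne_zero (ζ := ζ) (by simpa using hζ)
    unfold invCayley
    exact DifferentiableAt.differentiableWithinAt
      (DifferentiableAt.div (by fun_prop) (by fun_prop) h)
  have hrot : ∀ (φ : ℝ) (ζ : ℂ), ‖ζ‖ < 1 → S (Complex.exp (φ * Complex.I) * ζ) = S ζ := by
    intro φ ζ hζ
    have h := rotation_smul_invCayley (φ / 2) hζ
    have e : (2 * ((φ / 2 : ℝ) : ℂ) * Complex.I) = φ * Complex.I := by
      push_cast
      ring
    rw [e] at h
    simp only [hS]
    rw [← h, hinv]
  have hrad : ∀ r : ℝ, 0 ≤ r → r < 1 → S r = S 0 := by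
    intro r hr0 hr1
    have hd : DiffContOnCl ℂ S (Metric.ball 0 |r|) := by
      refine hSd.diffContOnCl_ball (Metric.closedBall_subset_ball ?_)
      rwa [abs_of_nonneg hr0]
    rw [← hd.circleAverage]
    refine (Real.circleAverage_const_on_circle fun ζ hζ => ?_).symm
    have hn : ‖ζ‖ = r := by simpa [abs_of_nonneg hr0] using hζ
    rw [← Complex.norm_mul_exp_arg_mul_I ζ, hn, mul_comm]
    exact hrot _ _ (by rw [Complex.norm_real, Real.norm_eq_abs, abs_of_nonneg hr0]; exact hr1)
  have hall : ∀ z : ℍ, R z = S 0 := by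
    intro z
    obtain ⟨ζ, hζ, rfl⟩ := exists_invCayley z
    rw [← hrad ‖ζ‖ (norm_nonneg _) hζ]
    have h := hrot ζ.arg ‖ζ‖ (by simpa using hζ)
    rw [mul_comm, Complex.norm_mul_exp_arg_mul_I] at h
    exact h
  rw [hall, hall]

/-! ### Irreducibility of the `L²`-model -/

/-- Γ is positive and an exponential never vanishes. This allows division by a kernel function
within holomorphic functions. -/
lemma inner_powVec_ne_zero {lam : ℝ} (hlam : 1 < lam) (z w : ℍ) :
    (inner ℂ (powVec hlam 0 z) (powVec hlam 0 w) : ℂ) ≠ 0 := by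
  rw [inner_powVec]
  refine mul_ne_zero ?_ (Complex.exp_ne_zero _)
  have := Real.Gamma_pos_of_pos (show 0 < lam + (0 : ℕ) by simp; linarith)
  exact_mod_cast this.ne'

/-- The rotations fix `i`, so they multiply the vector at `i` by a scalar. An operator commuting
with the group preserves this scalar, and the quotient of the two Laplace transforms becomes
rotation invariant, hence constant. -/
lemma isIrreducible_powVec {lam : ℝ} (hlam : 1 < lam) :
    IsIrreducibleUnitaryRep fun g f => (kernelRep_powVec hlam).rep g f := by
  refine (kernelRep_powVec hlam).isIrreducible UpperHalfPlane.I ?_ ?_ ?_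
  · intro h
    refine inner_powVec_ne_zero hlam UpperHalfPlane.I UpperHalfPlane.I ?_
    rw [h, inner_zero_left]
  · intro z
    obtain ⟨g, rfl⟩ := USL2.exists_smul_I z
    have hne : conj (cocycle lam g UpperHalfPlane.I) ≠ 0 :=
      (map_ne_zero _).2 (Complex.exp_ne_zero _)
    refine ⟨g, (conj (cocycle lam g UpperHalfPlane.I))⁻¹, ?_⟩
    rw [KernelRep.rep_apply, smul_smul, inv_mul_cancel₀ hne, one_smul]
  · intro P hP
    have hU := (kernelRep_powVec hlam).isUnitaryRep
    set e := powVec hlam 0 with he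
    set R : ℍ → ℂ := fun z => inner ℂ (e z) (P (e UpperHalfPlane.I)) /
      inner ℂ (e z) (e UpperHalfPlane.I) with hR
    have hne : ∀ z, inner ℂ (e z) (e UpperHalfPlane.I) ≠ (0 : ℂ) := fun z =>
      inner_powVec_ne_zero hlam z _
    have hconst := eq_of_rotation_invariant (R := R) ?_ ?_
    · refine ⟨R UpperHalfPlane.I, (total_powVec hlam).ext fun z => ?_⟩
      rw [inner_smul_right, ← hconst z, hR]
      exact (div_mul_cancel₀ _ (hne z)).symm
    · refine DifferentiableOn.div ?_ ?_ fun z _ => hne _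
      · exact (laplace hlam (P (e UpperHalfPlane.I))).2.1.congr fun z _ =>
          inner_powVec_zero hlam _ _
      · exact (laplace hlam (e UpperHalfPlane.I)).2.1.congr fun z _ =>
          inner_powVec_zero hlam _ _
    · intro θ z
      set g := USL2.lift (rotation θ) with hg
      have k₁ := hU.inner_map g (e z) (P (e UpperHalfPlane.I))
      have k₂ := hU.inner_map g (e z) (e UpperHalfPlane.I)
      -- The scalar at `i` and the factor at `z` occur in both numerator and denominator of `R`, so
      -- they cancel in the quotient.
      have hgI : (kernelRep_powVec hlam).rep g (e UpperHalfPlane.I) =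
          conj (cocycle lam g UpperHalfPlane.I) • e UpperHalfPlane.I := by
        rw [KernelRep.rep_apply, hg, USL2.lift_mat, rotation_smul_I]
      have hgz : (kernelRep_powVec hlam).rep g (e z) =
          conj (cocycle lam g z) • e (rotation θ • z) := KernelRep.rep_apply _ _ _
      rw [← hP, hgI, hgz, map_smul, inner_smul_left, inner_smul_right] at k₁
      rw [hgI, hgz, inner_smul_left, inner_smul_right] at k₂
      have hz := hne z
      simp only [hR]
      rw [div_eq_div_iff (hne _) (hne _), ← k₁, ← k₂]
      ring

/-! ### Bijectivity of weighted composition operators -/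

section WeightedComp

variable {X Y : Type*} [MeasurableSpace X] [MeasurableSpace Y]
  {μ : Measure X} {ν : Measure Y} {φ : Y → X} {w : Y → ℂ} {c : ℝ≥0∞}

lemma coeFn_weightedComp (h : IsWeightedComp μ ν φ w c) (f : Lp ℂ 2 μ) :
    weightedComp h f =ᵐ[ν] fun y => w y * f (φ y) :=
  MemLp.coeFn_toLp (h.memLp (Lp.memLp f))

lemma weightedComp_injective (h : IsWeightedComp μ ν φ w c) (hc : c ≠ 0) :
    Function.Injective (weightedComp h) := by
  refine (injective_iff_map_eq_zero _).2 fun f hf => ?_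
  have h0 : Real.sqrt c.toReal ≠ 0 :=
    (Real.sqrt_pos.2 (ENNReal.toReal_pos hc h.ne_top)).ne'
  have := norm_weightedComp h f
  rw [hf, norm_zero] at this
  exact norm_eq_zero.1 ((mul_eq_zero.1 this.symm).resolve_left h0)

/-- The preimage of `k` is (k/w) ∘ ψ; its square integrability is the norm identity read backwards,
which requires `c ≠ 0`. -/
lemma weightedComp_surjective (h : IsWeightedComp μ ν φ w c) (hc : c ≠ 0)
    (hw : ∀ᵐ y ∂ν, w y ≠ 0) {ψ : X → Y} (hψ : Measurable ψ) (hψφ : ∀ᵐ y ∂ν, ψ (φ y) = y) :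
    Function.Surjective (weightedComp h) := by
  intro k
  have hkm : Measurable (k : Y → ℂ) := (Lp.stronglyMeasurable k).measurable
  set f : X → ℂ := fun x => k (ψ x) / w (ψ x) with hf
  have hfm : Measurable f := (hkm.comp hψ).div (h.meas.comp hψ)
  have hae : ∀ᵐ y ∂ν, w y * f (φ y) = k y := by
    filter_upwards [hw, hψφ] with y h1 h2
    simp only [hf]
    rw [h2, mul_div_cancel₀ _ h1]
  have hmem : MemLp f 2 μ := by
    rw [memLp_two_iff hfm.aestronglyMeasurable]
    have h1 := h.lintegral_eq (f := f) hfm.aestronglyMeasurable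
    have h2 : ∫⁻ y, ‖w y * f (φ y)‖ₑ ^ 2 ∂ν = ∫⁻ y, ‖k y‖ₑ ^ 2 ∂ν := by
      refine lintegral_congr_ae ?_
      filter_upwards [hae] with y hy
      rw [hy]
    rw [h2] at h1
    have h3 := (memLp_two_iff (Lp.memLp k).1).1 (Lp.memLp k)
    rw [h1] at h3
    exact ENNReal.lt_top_of_mul_ne_top_right h3.ne hc
  refine ⟨hmem.toLp f, Lp.ext ?_⟩
  filter_upwards [coeFn_weightedComp h (hmem.toLp f), h.qmp.ae hmem.coeFn_toLp, hae]
    with y h1 h2 h3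
  rw [h1, h2, h3]

end WeightedComp

lemma stratify_bijective (lam₁ lam₂ : ℝ) : Function.Bijective (stratify lam₁ lam₂) := by
  have hc : ENNReal.ofReal (2 ^ (lam₁ + lam₂ - 1)) ≠ 0 := by
    rw [Ne, ENNReal.ofReal_eq_zero, not_le]
    positivity
  -- The inverse of the stratification is t = x + y, v = (y - x)/(x + y).
  refine ⟨weightedComp_injective _ hc, weightedComp_surjective _ hc ?_
    (ψ := fun q => (q.1 + q.2, (q.2 - q.1) / (q.1 + q.2))) ?_ ?_⟩
  · filter_upwards [ae_strat lam₁ lam₂] with p hp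
    obtain ⟨ht, hv1, hv2⟩ := hp
    have ht : 0 < p.1 := ht
    have hv1 : 0 < 1 + p.2 := by linarith
    have hv2 : 0 < 1 - p.2 := by linarith
    unfold stratWeight
    norm_cast
    positivity
  · fun_prop
  · filter_upwards [ae_strat lam₁ lam₂] with p hp
    have ht : p.1 ≠ 0 := ne_of_gt hp.1
    unfold stratification
    ext
    · simp only
      ring
    · simp only
      rw [div_eq_iff (by ring_nf; exact ht)]
      ring

lemma norm_stratify (lam₁ lam₂ : ℝ) (f : L2Quadrant lam₁ lam₂) :
    ‖stratify lam₁ lam₂ f‖ = Real.sqrt (ENNReal.ofReal (2 ^ (lam₁ + lam₂ - 1))).toReal * ‖f‖ :=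
  norm_weightedComp _ f

/-! ### The norm of the Jacobi polynomial and the operator `theta` -/

/-- At v = 1 only the term s = 0 survives, and it equals (α+1)_l / l!. This is how the Jacobi
polynomial is seen not to vanish. -/
lemma jacobiP_one_pos {l : ℕ} {α β : ℝ} (hα : -1 < α) : 0 < jacobiP l α β 1 := by
  have hs : ∀ s ∈ Finset.range (l + 1), s ≠ 0 →
      ((ascPochhammer ℝ (l - s)).eval (α + s + 1) / ((l - s).factorial : ℝ)) *
      ((ascPochhammer ℝ s).eval (β + (l - s : ℕ) + 1) / (s.factorial : ℝ)) *
        (((1 : ℝ) - 1) / 2) ^ s * (((1 : ℝ) + 1) / 2) ^ (l - s) = 0 := by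
    intro s _ hs
    simp [hs]
  have h := ascPochhammer_pos l (α + 1) (by linarith)
  rw [jacobiP, Finset.sum_eq_single 0 hs (by simp)]
  simp
  positivity

/-- The density is positive inside the interval, so zero norm would force a continuous function to
vanish on all of [-1, 1], contradicting its positive value at 1. -/
lemma lintegral_jacobiP_ne_zero {lam₁ : ℝ} (h₁ : 1 < lam₁) (lam₂ : ℝ) (l : ℕ) :
    ∫⁻ v, ‖(jacobiP l (lam₁ - 1) (lam₂ - 1) v : ℂ)‖ₑ ^ 2 ∂(jacobiMeasure lam₁ lam₂) ≠ 0 := by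
  intro h0
  have hcont := continuous_jacobiP l (lam₁ - 1) (lam₂ - 1)
  have hP : Measurable fun v => ‖(jacobiP l (lam₁ - 1) (lam₂ - 1) v : ℂ)‖ₑ ^ 2 :=
    ((Complex.continuous_ofReal.comp hcont).measurable).enorm.pow_const 2
  rw [jacobiMeasure, lintegral_withDensity_eq_lintegral_mul _ (measurable_jacobi_density _ _) hP,
    lintegral_eq_zero_iff ((measurable_jacobi_density _ _).mul hP)] at h0
  have h1 : jacobiP l (lam₁ - 1) (lam₂ - 1) =ᵐ[volume.restrict (Icc (-1) 1)] fun _ => 0 := by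
    rw [← Measure.restrict_congr_set Ioo_ae_eq_Icc]
    filter_upwards [h0, ae_restrict_mem measurableSet_Ioo] with v hv hv'
    have hv1 : 0 < 1 + v := by linarith [hv'.1]
    have hv2 : 0 < 1 - v := by linarith [hv'.2]
    have := (mul_eq_zero.1 hv).resolve_left (ENNReal.ofReal_pos.2 (by positivity)).ne'
    simpa using this
  have h2 := Measure.eqOn_Icc_of_ae_eq volume (by norm_num) h1 hcont.continuousOn
    continuousOn_const (show (1 : ℝ) ∈ Icc (-1 : ℝ) 1 by norm_num)
  exact (jacobiP_one_pos (by linarith)).ne' h2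

lemma jacobiNorm_ne_zero {lam₁ lam₂ : ℝ} (h₁ : 1 < lam₁) (h₂ : 1 < lam₂) (l : ℕ) :
    jacobiNorm lam₁ lam₂ l ≠ 0 := by
  have hcont := continuous_jacobiP l (lam₁ - 1) (lam₂ - 1)
  have e : ∫ v, jacobiP l (lam₁ - 1) (lam₂ - 1) v ^ 2 ∂(jacobiMeasure lam₁ lam₂) =
      (∫⁻ v, ‖(jacobiP l (lam₁ - 1) (lam₂ - 1) v : ℂ)‖ₑ ^ 2
        ∂(jacobiMeasure lam₁ lam₂)).toReal := by
    rw [integral_eq_lintegral_of_nonneg_ae (Filter.Eventually.of_forall fun v => sq_nonneg _)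
      (hcont.pow 2).aestronglyMeasurable]
    congr 1
    refine lintegral_congr fun v => ?_
    rw [← ofReal_norm, Complex.norm_real, Real.norm_eq_abs, ← ENNReal.ofReal_pow (abs_nonneg _),
      sq_abs]
  rw [jacobiNorm, e]
  exact (Real.sqrt_pos.2 (ENNReal.toReal_pos (lintegral_jacobiP_ne_zero h₁ lam₂ l)
    (lintegral_jacobiP_ne_top h₁ h₂ l))).ne'

/-- The operator `theta` as a linear map. -/
def thetaLinear {lam₁ lam₂ : ℝ} (h₁ : 1 < lam₁) (h₂ : 1 < lam₂) (l : ℕ) :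
    L2Half (lam₁ + lam₂ + 2 * l) →ₗ[ℂ] jacobiComponent h₁ h₂ l where
  toFun := theta h₁ h₂ l
  map_add' f g := Subtype.ext (by
    simp only [theta, map_add, smul_add, Submodule.coe_add])
  map_smul' a f := Subtype.ext (by
    simp only [theta, map_smul, RingHom.id_apply, Submodule.coe_smul]
    rw [smul_comm])

lemma thetaLinear_apply {lam₁ lam₂ : ℝ} (h₁ : 1 < lam₁) (h₂ : 1 < lam₂) (l : ℕ)
    (f : L2Half (lam₁ + lam₂ + 2 * l)) : thetaLinear h₁ h₂ l f = theta h₁ h₂ l f := rfl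

lemma coe_thetaLinear {lam₁ lam₂ : ℝ} (h₁ : 1 < lam₁) (h₂ : 1 < lam₂) (l : ℕ)
    (f : L2Half (lam₁ + lam₂ + 2 * l)) : (thetaLinear h₁ h₂ l f : L2Strat lam₁ lam₂) =
      jacobiTensor h₁ h₂ l (((jacobiNorm lam₁ lam₂ l)⁻¹ : ℂ) •
        weightedComp (powWeight_isWeightedComp lam₁ lam₂ l) f) := rfl

/-- Transport of unitarity and irreducibility only requires a similitude, so the factor is left
unevaluated. -/
lemma exists_norm_thetaLinear {lam₁ lam₂ : ℝ} (h₁ : 1 < lam₁) (h₂ : 1 < lam₂) (l : ℕ) :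
    ∃ κ : ℝ, ∀ f, ‖thetaLinear h₁ h₂ l f‖ = κ * ‖f‖ := by
  refine ⟨√(∫⁻ v, ‖(jacobiP l (lam₁ - 1) (lam₂ - 1) v : ℂ)‖ₑ ^ 2
    ∂(jacobiMeasure lam₁ lam₂)).toReal * ‖((jacobiNorm lam₁ lam₂ l)⁻¹ : ℂ)‖ *
      √(1 : ℝ≥0∞).toReal, fun f => ?_⟩
  rw [Submodule.coe_norm, coe_thetaLinear, jacobiTensor, norm_weightedComp, norm_smul,
    norm_weightedComp, ← mul_assoc, ← mul_assoc]

lemma thetaLinear_bijective {lam₁ lam₂ : ℝ} (h₁ : 1 < lam₁) (h₂ : 1 < lam₂) (l : ℕ) :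
    Function.Bijective (thetaLinear h₁ h₂ l) := by
  have hj : ((jacobiNorm lam₁ lam₂ l)⁻¹ : ℂ) ≠ 0 :=
    inv_ne_zero (by exact_mod_cast jacobiNorm_ne_zero h₁ h₂ l)
  constructor
  · intro f g h
    have h1 := congrArg Subtype.val h
    have h2 := weightedComp_injective (jacobiTensor_isWeightedComp h₁ h₂ l)
      (lintegral_jacobiP_ne_zero h₁ lam₂ l) h1
    exact weightedComp_injective _ one_ne_zero (smul_right_injective _ hj h2)
  · rintro ⟨_, f, rfl⟩
    obtain ⟨k, hk⟩ := weightedComp_surjective (powWeight_isWeightedComp lam₁ lam₂ l) one_ne_zero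
      (by
        filter_upwards [ae_halfLine (lam₁ + lam₂ - 1)] with t ht
        exact_mod_cast (Real.rpow_pos_of_pos ht _).ne')
      measurable_id (Filter.Eventually.of_forall fun _ => rfl)
      (((jacobiNorm lam₁ lam₂ l)⁻¹ : ℂ)⁻¹ • f)
    refine ⟨k, Subtype.ext ?_⟩
    rw [coe_thetaLinear, hk, smul_inv_smul₀ hj]

/-! ### The Jacobi component in the quadrant -/

lemma Gamma_mul_ascPochhammer {x : ℝ} (hx : 0 < x) (n : ℕ) :
    Real.Gamma x * (ascPochhammer ℝ n).eval x = Real.Gamma (x + n) := by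
  induction n with
  | zero => simp
  | succ n ih =>
    have h : x + n ≠ 0 := by positivity
    rw [ascPochhammer_succ_eval, ← mul_assoc, ih, mul_comm, ← Real.Gamma_add_one h]
    congr 1
    push_cast
    ring

/-- The coefficients of the homogeneous polynomial attached to a Jacobi polynomial. -/
def jacobiCoeff (lam₁ lam₂ : ℝ) (l s : ℕ) : ℝ :=
  (-1) ^ s * (((ascPochhammer ℝ (l - s)).eval (lam₁ + s) / ((l - s).factorial : ℝ)) *
    ((ascPochhammer ℝ s).eval (lam₂ + (l - s : ℕ)) / (s.factorial : ℝ)))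

/-- The Gamma factors produced by the kernel integrals complete the Pochhammer symbols to Γ(lam₁+l)
and Γ(lam₂+l), independent of `s`. What depends on `s` is a signed binomial coefficient. -/
lemma Gamma_mul_jacobiCoeff {lam₁ lam₂ : ℝ} (h₁ : 1 < lam₁) (h₂ : 1 < lam₂) {l s : ℕ}
    (hs : s ≤ l) :
    jacobiCoeff lam₁ lam₂ l s * (Real.Gamma (lam₁ + s) * Real.Gamma (lam₂ + (l - s : ℕ))) =
      Real.Gamma (lam₁ + l) * Real.Gamma (lam₂ + l) / l.factorial *
        ((-1) ^ s * (l.choose s : ℝ)) := by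
  have e₁ := Gamma_mul_ascPochhammer (x := lam₁ + s) (by positivity) (l - s)
  have e₂ := Gamma_mul_ascPochhammer (x := lam₂ + (l - s : ℕ)) (by positivity) s
  have c₁ : lam₁ + s + (l - s : ℕ) = lam₁ + l := by
    push_cast [hs]
    ring
  have c₂ : lam₂ + (l - s : ℕ) + s = lam₂ + l := by
    push_cast [hs]
    ring
  rw [c₁] at e₁
  rw [c₂] at e₂
  rw [← e₁, ← e₂, Nat.cast_choose ℝ hs, jacobiCoeff]
  have := l.factorial_ne_zero
  have := s.factorial_ne_zero
  have := (l - s).factorial_ne_zero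
  field_simp

/-- The vector `x ^ (lam₁ - 1) y ^ (lam₂ - 1) Q(x, y) exp (-i conj(w) (x + y))`, where `Q` is the
homogeneous polynomial attached to the `l`-th Jacobi polynomial. -/
def jacobiVec {lam₁ lam₂ : ℝ} (h₁ : 1 < lam₁) (h₂ : 1 < lam₂) (l : ℕ) (w : ℍ) :
    L2Quadrant lam₁ lam₂ :=
  ∑ s ∈ Finset.range (l + 1), (jacobiCoeff lam₁ lam₂ l s : ℂ) •
    tensor (powVec h₁ s w) (powVec h₂ (l - s) w)

/-- Each term of the sum is a product of two Gamma integrals. Once A^(-lam₁-l) B^(-lam₂-l) is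
factored out, with A and B the kernels at `z.1` and `z.2`, the terms are C(l,s) A^(l-s) (-B)^s and
the binomial theorem applies. -/
lemma inner_tensor_jacobiVec {lam₁ lam₂ : ℝ} (h₁ : 1 < lam₁) (h₂ : 1 < lam₂) (l : ℕ)
    (z : ℍ × ℍ) (w : ℍ) :
    inner ℂ (tensor (powVec h₁ 0 z.1) (powVec h₂ 0 z.2)) (jacobiVec h₁ h₂ l w) =
      ((Real.Gamma (lam₁ + l) * Real.Gamma (lam₂ + l) / l.factorial : ℝ) : ℂ) *
        Complex.exp (-((lam₁ + l : ℝ) : ℂ) * Complex.log (halfKernel z.1 w) -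
          ((lam₂ + l : ℝ) : ℂ) * Complex.log (halfKernel z.2 w)) *
        (halfKernel z.1 w - halfKernel z.2 w) ^ l := by
  -- The difference is written as -B + A so that the binomial expansion puts the exponent `s` on -B,
  -- matching the summation index of `jacobiVec`.
  rw [jacobiVec, inner_sum, sub_eq_neg_add (halfKernel z.1 w), add_pow, Finset.mul_sum]
  refine Finset.sum_congr rfl fun s hs => ?_
  have hs : s ≤ l := Nat.lt_succ_iff.1 (Finset.mem_range.1 hs)
  rw [inner_smul_right, inner_tensor, inner_powVec, inner_powVec]
  have hG : (jacobiCoeff lam₁ lam₂ l s : ℂ) *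
      ((Real.Gamma (lam₁ + s) : ℂ) * (Real.Gamma (lam₂ + (l - s : ℕ)) : ℂ)) =
      ((Real.Gamma (lam₁ + l) * Real.Gamma (lam₂ + l) / l.factorial : ℝ) : ℂ) *
        ((-1) ^ s * (l.choose s : ℂ)) := by
    exact_mod_cast Gamma_mul_jacobiCoeff h₁ h₂ hs
  have hpow : ∀ (A : ℂ) (n : ℕ), A ≠ 0 → A ^ n = Complex.exp (n * Complex.log A) := by
    intro A n hA
    rw [Complex.exp_nat_mul, Complex.exp_log hA]
  have hE : Complex.exp (-((lam₁ + s : ℝ) : ℂ) * Complex.log (halfKernel z.1 w)) *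
      Complex.exp (-((lam₂ + (l - s : ℕ) : ℝ) : ℂ) * Complex.log (halfKernel z.2 w)) =
      Complex.exp (-((lam₁ + l : ℝ) : ℂ) * Complex.log (halfKernel z.1 w) -
          ((lam₂ + l : ℝ) : ℂ) * Complex.log (halfKernel z.2 w)) *
        (halfKernel z.1 w ^ (l - s) * halfKernel z.2 w ^ s) := by
    rw [hpow _ _ (halfKernel_ne_zero _ _), hpow _ _ (halfKernel_ne_zero _ _), ← Complex.exp_add,
      ← Complex.exp_add, ← Complex.exp_add]
    congr 1
    push_cast [hs]
    ring
  have hneg : (-halfKernel z.2 w) ^ s = (-1) ^ s * halfKernel z.2 w ^ s := neg_pow _ _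
  rw [hneg]
  linear_combination (Complex.exp (-((lam₁ + s : ℝ) : ℂ) * Complex.log (halfKernel z.1 w)) *
      Complex.exp (-((lam₂ + (l - s : ℕ) : ℝ) : ℂ) * Complex.log (halfKernel z.2 w))) * hG +
    ((Real.Gamma (lam₁ + l) * Real.Gamma (lam₂ + l) / l.factorial : ℝ) : ℂ) *
        ((-1) ^ s * (l.choose s : ℂ)) * hE

/-- The powers of A and B contribute weights lam₁ + l and lam₂ + l at the two points and their sum
at `w`, while (A - B)^l takes back weight `l` at each of the two points and none at `w`. The
remaining weight at `w` is lam₁ + lam₂ + 2l. -/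
lemma inner_tensor_jacobiVec_smul {lam₁ lam₂ : ℝ} (h₁ : 1 < lam₁) (h₂ : 1 < lam₂) (l : ℕ)
    (g : USL2) (z : ℍ × ℍ) (w : ℍ) :
    cocycle lam₁ g z.1 * cocycle lam₂ g z.2 * conj (cocycle (lam₁ + lam₂ + 2 * l) g w) *
      inner ℂ (tensor (powVec h₁ 0 (g.mat • z.1)) (powVec h₂ 0 (g.mat • z.2)))
        (jacobiVec h₁ h₂ l (g.mat • w)) =
    inner ℂ (tensor (powVec h₁ 0 z.1) (powVec h₂ 0 z.2)) (jacobiVec h₁ h₂ l w) := by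
  have h := inner_tensor_jacobiVec h₁ h₂ l (g.mat • z.1, g.mat • z.2) (g.mat • w)
  -- The point `w` drops out of the difference of the two kernels, which is -i(z.1 - z.2).
  have hsub : halfKernel (g.mat • z.1) (g.mat • w) - halfKernel (g.mat • z.2) (g.mat • w) =
      (halfKernel z.1 w - halfKernel z.2 w) * Complex.exp (-(g.log z.1 + g.log z.2)) := by
    have := g.coe_smul_sub z.1 z.2
    simp only [halfKernel]
    linear_combination (-Complex.I) * this
  dsimp only at h
  rw [h, inner_tensor_jacobiVec, hsub, mul_pow, ← Complex.exp_nat_mul, USL2.log_halfKernel_smul,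
    USL2.log_halfKernel_smul, cocycle, cocycle, cocycle, ← Complex.exp_conj]
  have hE : Complex.exp (-(lam₁ : ℂ) * g.log z.1) * Complex.exp (-(lam₂ : ℂ) * g.log z.2) *
      Complex.exp (conj (-((lam₁ + lam₂ + 2 * l : ℝ) : ℂ) * g.log w)) *
      Complex.exp (-((lam₁ + l : ℝ) : ℂ) * (Complex.log (halfKernel z.1 w) -
          (g.log z.1 + conj (g.log w))) - ((lam₂ + l : ℝ) : ℂ) *
          (Complex.log (halfKernel z.2 w) - (g.log z.2 + conj (g.log w)))) *
      Complex.exp (l * -(g.log z.1 + g.log z.2)) =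
      Complex.exp (-((lam₁ + l : ℝ) : ℂ) * Complex.log (halfKernel z.1 w) -
          ((lam₂ + l : ℝ) : ℂ) * Complex.log (halfKernel z.2 w)) := by
    rw [← Complex.exp_add, ← Complex.exp_add, ← Complex.exp_add, ← Complex.exp_add]
    congr 1
    rw [map_mul, map_neg, Complex.conj_ofReal]
    push_cast
    ring
  rw [← hE]
  ring

/-- Tested against the total family at the points translated by g⁻¹, this is the covariance of the
pairing. Under the diagonal action these vectors thus move by the rule of the kernel vectors of
parameter lam₁ + lam₂ + 2l. -/
lemma rep_jacobiVec {lam₁ lam₂ : ℝ} (h₁ : 1 < lam₁) (h₂ : 1 < lam₂) (l : ℕ) (g : USL2) (w : ℍ) :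
    (kernelRep_tensor h₁ h₂).rep g (jacobiVec h₁ h₂ l w) =
      conj (cocycle (lam₁ + lam₂ + 2 * l) g w) • jacobiVec h₁ h₂ l (g.mat • w) := by
  refine (total_tensor_powVec h₁ h₂).ext fun z => ?_
  have k := (kernelRep_tensor h₁ h₂).inner_rep g z (jacobiVec h₁ h₂ l w)
  have k2 := inner_tensor_jacobiVec_smul h₁ h₂ l g (g⁻¹.mat • z.1, g⁻¹.mat • z.2) w
  beta_reduce at k
  rw [k, inner_smul_right, ← k2, Complex.conj_conj]
  have hc : ∀ (lam : ℝ) (x : ℍ), cocycle lam g⁻¹ x * cocycle lam g (g⁻¹.mat • x) = 1 := by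
    intro lam x
    rw [← cocycle_mul, mul_inv_cancel, cocycle_one]
  have hm : ∀ x : ℍ, g.mat • g⁻¹.mat • x = x := fun x => by
    rw [USL2.inv_mat, smul_inv_smul]
  simp only [hm]
  linear_combination (conj (cocycle (lam₁ + lam₂ + 2 * l) g w) *
    inner ℂ (tensor (powVec h₁ 0 z.1) (powVec h₂ 0 z.2)) (jacobiVec h₁ h₂ l (g.mat • w))) *
    (cocycle lam₁ g⁻¹ z.1 * cocycle lam₁ g (g⁻¹.mat • z.1) * hc lam₂ z.2 + hc lam₁ z.1)

/-- Homogenisation in x = t(1-v)/2 and y = t(1+v)/2; the sign (-1)^s in `jacobiCoeff` comes from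
t(v-1)/2 = -x. -/
lemma jacobiP_eq_sum {lam₁ lam₂ t v : ℝ} (l : ℕ) :
    t ^ l * jacobiP l (lam₁ - 1) (lam₂ - 1) v = ∑ s ∈ Finset.range (l + 1),
      jacobiCoeff lam₁ lam₂ l s * ((t / 2 * (1 - v)) ^ s * (t / 2 * (1 + v)) ^ (l - s)) := by
  rw [jacobiP, Finset.mul_sum]
  refine Finset.sum_congr rfl fun s hs => ?_
  have hs : s ≤ l := Nat.lt_succ_iff.1 (Finset.mem_range.1 hs)
  have e₁ : lam₁ - 1 + s + 1 = lam₁ + s := by ring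
  have e₂ : lam₂ - 1 + (l - s : ℕ) + 1 = lam₂ + (l - s : ℕ) := by ring
  have e₃ : t / 2 * (1 - v) = -1 * (t * ((v - 1) / 2)) := by ring
  have e₄ : t / 2 * (1 + v) = t * ((v + 1) / 2) := by ring
  have e₅ : t ^ l = t ^ s * t ^ (l - s) := by rw [← pow_add, Nat.add_sub_cancel' hs]
  have e₆ : (-1 : ℝ) ^ s * (-1) ^ s = 1 := by rw [← mul_pow]; simp
  rw [e₁, e₂, e₃, e₄, e₅, jacobiCoeff, mul_pow, mul_pow, mul_pow]
  linear_combination (-(t ^ s * t ^ (l - s) * ((ascPochhammer ℝ (l - s)).eval (lam₁ + s) /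
    ((l - s).factorial : ℝ)) * ((ascPochhammer ℝ s).eval (lam₂ + (l - s : ℕ)) /
    (s.factorial : ℝ)) * ((v - 1) / 2) ^ s * ((v + 1) / 2) ^ (l - s))) * e₆

lemma coeFn_finset_sum {X ι : Type*} [MeasurableSpace X] {μ : Measure X} (s : Finset ι)
    (f : ι → Lp ℂ 2 μ) : ⇑(∑ i ∈ s, f i) =ᵐ[μ] fun x => ∑ i ∈ s, f i x := by
  classical
  induction s using Finset.induction_on with
  | empty =>
    simp only [Finset.sum_empty]
    exact Lp.coeFn_zero _ _ _
  | insert i s hi ih =>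
    rw [Finset.sum_insert hi]
    filter_upwards [Lp.coeFn_add (f i) (∑ j ∈ s, f j), ih] with x h1 h2
    rw [h1, Pi.add_apply, h2, Finset.sum_insert hi]

lemma coeFn_jacobiVec {lam₁ lam₂ : ℝ} (h₁ : 1 < lam₁) (h₂ : 1 < lam₂) (l : ℕ) (w : ℍ) :
    jacobiVec h₁ h₂ l w =ᵐ[(halfLine (1 - lam₁)).prod (halfLine (1 - lam₂))] fun p =>
      ((p.1 ^ (lam₁ - 1) * p.2 ^ (lam₂ - 1) * ∑ s ∈ Finset.range (l + 1),
        jacobiCoeff lam₁ lam₂ l s * (p.1 ^ s * p.2 ^ (l - s)) : ℝ) : ℂ) *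
          Complex.exp (-Complex.I * conj (w : ℂ) * ((p.1 + p.2 : ℝ) : ℂ)) := by
  have hsum := coeFn_finset_sum (μ := (halfLine (1 - lam₁)).prod (halfLine (1 - lam₂)))
    (Finset.range (l + 1)) fun s => (jacobiCoeff lam₁ lam₂ l s : ℂ) •
      tensor (powVec h₁ s w) (powVec h₂ (l - s) w)
  have hterm : ∀ᵐ p ∂((halfLine (1 - lam₁)).prod (halfLine (1 - lam₂))), ∀ s : ℕ,
      ((jacobiCoeff lam₁ lam₂ l s : ℂ) • tensor (powVec h₁ s w) (powVec h₂ (l - s) w) :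
        L2Quadrant lam₁ lam₂) p = (jacobiCoeff lam₁ lam₂ l s : ℂ) *
          (powExp (lam₁ - 1 + s) w p.1 * powExp (lam₂ - 1 + (l - s : ℕ)) w p.2) := by
    refine ae_all_iff.2 fun s => ?_
    filter_upwards [Lp.coeFn_smul (jacobiCoeff lam₁ lam₂ l s : ℂ)
        (tensor (powVec h₁ s w) (powVec h₂ (l - s) w)),
      coeFn_tensor (powVec h₁ s w) (powVec h₂ (l - s) w),
      Measure.quasiMeasurePreserving_fst.ae (coeFn_powVec h₁ s w),
      Measure.quasiMeasurePreserving_snd.ae (coeFn_powVec h₂ (l - s) w)] with p k₁ k₂ k₃ k₄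
    rw [k₁, Pi.smul_apply, k₂, k₃, k₄, smul_eq_mul]
  filter_upwards [hsum, hterm, Measure.quasiMeasurePreserving_fst.ae (ae_halfLine (1 - lam₁)),
    Measure.quasiMeasurePreserving_snd.ae (ae_halfLine (1 - lam₂))] with p k₁ k₂ hx hy
  rw [jacobiVec, k₁]
  simp only [k₂]
  rw [Complex.ofReal_mul, Complex.ofReal_sum, Finset.mul_sum, Finset.sum_mul]
  refine Finset.sum_congr rfl fun s _ => ?_
  rw [powExp, powExp, Real.rpow_add hx, Real.rpow_add hy, Real.rpow_natCast, Real.rpow_natCast,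
    Complex.ofReal_add p.1, mul_add, Complex.exp_add]
  push_cast
  ring

/-- The stratification weight cancels x^(lam₁-1) y^(lam₂-1), and x + y = t, so t^l P(v) exp(-i
conj(w) t) remains. The normalising constant is common to both sides. -/
lemma stratify_jacobiVec {lam₁ lam₂ : ℝ} (h₁ : 1 < lam₁) (h₂ : 1 < lam₂) (l : ℕ) (w : ℍ) :
    stratify lam₁ lam₂ (((jacobiNorm lam₁ lam₂ l)⁻¹ : ℂ) • jacobiVec h₁ h₂ l w) =
      thetaLinear h₁ h₂ l (powVec (one_lt_param h₁ h₂ l) 0 w) := by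
  rw [coe_thetaLinear, map_smul, map_smul]
  congr 1
  refine Lp.ext ?_
  have hq := (stratify_isWeightedComp lam₁ lam₂).qmp
  have hfst : Measure.QuasiMeasurePreserving Prod.fst
    ((halfLine (lam₁ + lam₂ - 1)).prod (jacobiMeasure lam₁ lam₂)) (halfLine (lam₁ + lam₂ - 1)) :=
    Measure.quasiMeasurePreserving_fst
  filter_upwards [ae_strat lam₁ lam₂,
    coeFn_weightedComp (stratify_isWeightedComp lam₁ lam₂) (jacobiVec h₁ h₂ l w),
    hq.ae (coeFn_jacobiVec h₁ h₂ l w),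
    coeFn_weightedComp (jacobiTensor_isWeightedComp h₁ h₂ l)
      (weightedComp (powWeight_isWeightedComp lam₁ lam₂ l)
        (powVec (one_lt_param h₁ h₂ l) 0 w)),
    hfst.ae (coeFn_weightedComp (powWeight_isWeightedComp lam₁ lam₂ l)
        (powVec (one_lt_param h₁ h₂ l) 0 w)),
    hfst.ae ((powWeight_isWeightedComp lam₁ lam₂ l).qmp.ae
      (coeFn_powVec (one_lt_param h₁ h₂ l) 0 w))] with p hp k₁ k₂ k₃ k₄ k₅
  obtain ⟨ht, hv1, hv2⟩ := hp
  have ht : 0 < p.1 := ht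
  have hv1 : 0 < 1 + p.2 := by linarith
  have hv2 : 0 < 1 - p.2 := by linarith
  have ht2 : 0 < p.1 / 2 := by positivity
  rw [stratify, jacobiTensor, k₁, k₂, k₃, k₄, k₅]
  simp only [stratification, id]
  rw [← jacobiP_eq_sum, stratWeight, powExp,
    show p.1 / 2 * (1 - p.2) + p.1 / 2 * (1 + p.2) = p.1 by ring]
  simp only [← mul_assoc]
  congr 1
  norm_cast
  have e : ∀ x : ℝ, 0 < x → ∀ a b : ℝ, a + b = 0 → x ^ a * x ^ b = 1 := by
    intro x hx a b hab
    rw [← Real.rpow_add hx, hab, Real.rpow_zero]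
  have e₀ : (p.1 / 2) ^ (2 - lam₁ - lam₂) * ((p.1 / 2) ^ (lam₁ - 1) * (p.1 / 2) ^ (lam₂ - 1)) = 1 := by
    rw [← Real.rpow_add ht2]
    exact e _ ht2 _ _ (by ring)
  have e₁ := e _ hv2 (1 - lam₁) (lam₁ - 1) (by ring)
  have e₂ := e _ hv1 (1 - lam₂) (lam₂ - 1) (by ring)
  -- On the side of `theta`, its power of `t` and that of the kernel vector of parameter lam₁ + lam₂
  -- + 2l combine to the same t^l.
  have e₃ : p.1 ^ (-(lam₁ + lam₂ + l - 1)) * p.1 ^ (lam₁ + lam₂ + 2 * l - 1 + (0 : ℕ)) =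
      p.1 ^ l := by
    rw [← Real.rpow_add ht, ← Real.rpow_natCast]
    congr 1
    push_cast
    ring
  rw [Real.mul_rpow ht2.le hv2.le, Real.mul_rpow ht2.le hv1.le]
  push_cast at e₃ ⊢
  rw [mul_assoc (jacobiP _ _ _ _), e₃]
  calc _ = ((p.1 / 2) ^ (2 - lam₁ - lam₂) * ((p.1 / 2) ^ (lam₁ - 1) * (p.1 / 2) ^ (lam₂ - 1))) *
        ((1 - p.2) ^ (1 - lam₁) * (1 - p.2) ^ (lam₁ - 1)) *
        ((1 + p.2) ^ (1 - lam₂) * (1 + p.2) ^ (lam₂ - 1)) *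
        (p.1 ^ l * jacobiP l (lam₁ - 1) (lam₂ - 1) p.2) := by ring
    _ = _ := by
      rw [e₀, e₁, e₂]
      ring

/-! ### The stratified model and its Jacobi components as representations -/

lemma stratModel_stratify {lam₁ lam₂ : ℝ} (h₁ : 1 < lam₁) (h₂ : 1 < lam₂) (g : USL2)
    (f : L2Quadrant lam₁ lam₂) : stratModel h₁ h₂ g (stratify lam₁ lam₂ f) =
      stratify lam₁ lam₂ ((kernelRep_tensor h₁ h₂).rep g f) := by
  rw [stratModel, Function.leftInverse_invFun (stratify_bijective lam₁ lam₂).1, l2Model₂_eq]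

lemma isUnitaryRep_stratModel {lam₁ lam₂ : ℝ} (h₁ : 1 < lam₁) (h₂ : 1 < lam₂) :
    IsUnitaryRep (stratModel h₁ h₂) :=
  (kernelRep_tensor h₁ h₂).isUnitaryRep.of_similitude (stratify_bijective lam₁ lam₂).2
    (norm_stratify lam₁ lam₂) (stratModel_stratify h₁ h₂)

lemma componentModel_theta {lam₁ lam₂ : ℝ} (h₁ : 1 < lam₁) (h₂ : 1 < lam₂) (l : ℕ) (g : USL2)
    (f : L2Half (lam₁ + lam₂ + 2 * l)) :
    componentModel h₁ h₂ l g (thetaLinear h₁ h₂ l f) =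
      thetaLinear h₁ h₂ l ((kernelRep_powVec (one_lt_param h₁ h₂ l)).rep g f) := by
  have hinj : Function.Injective (theta h₁ h₂ l) := (thetaLinear_bijective h₁ h₂ l).1
  rw [componentModel, thetaLinear_apply, Function.leftInverse_invFun hinj, l2Model_eq,
    thetaLinear_apply]

lemma isIrreducibleUnitaryRep_componentModel {lam₁ lam₂ : ℝ} (h₁ : 1 < lam₁) (h₂ : 1 < lam₂)
    (l : ℕ) : IsIrreducibleUnitaryRep (componentModel h₁ h₂ l) := by
  obtain ⟨κ, hκ⟩ := exists_norm_thetaLinear h₁ h₂ l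
  exact (isIrreducible_powVec (one_lt_param h₁ h₂ l)).of_similitude
    (thetaLinear_bijective h₁ h₂ l) hκ (componentModel_theta h₁ h₂ l)

/-- Both sides are continuous and linear in `f`, so it suffices to compare them on the kernel
vectors. There `stratify_jacobiVec` passes to the quadrant and `rep_jacobiVec` gives the same factor
and the same moved point. -/
lemma stratModel_theta {lam₁ lam₂ : ℝ} (h₁ : 1 < lam₁) (h₂ : 1 < lam₂) (l : ℕ) (g : USL2)
    (f : L2Half (lam₁ + lam₂ + 2 * l)) :
    stratModel h₁ h₂ g (thetaLinear h₁ h₂ l f) =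
      thetaLinear h₁ h₂ l ((kernelRep_powVec (one_lt_param h₁ h₂ l)).rep g f) := by
  obtain ⟨κ, hκ⟩ := exists_norm_thetaLinear h₁ h₂ l
  have hU := isUnitaryRep_stratModel h₁ h₂
  let Θ : L2Half (lam₁ + lam₂ + 2 * l) →L[ℂ] L2Strat lam₁ lam₂ :=
    (jacobiComponent h₁ h₂ l).subtypeL.comp
      ((thetaLinear h₁ h₂ l).mkContinuous κ fun f => (hκ f).le)
  let σ : L2Strat lam₁ lam₂ →L[ℂ] L2Strat lam₁ lam₂ :=
    LinearIsometry.toContinuousLinearMap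
      ⟨⟨⟨stratModel h₁ h₂ g, hU.map_add g⟩, hU.map_smul g⟩, hU.norm_map g⟩
  let ρ := ((kernelRep_powVec (one_lt_param h₁ h₂ l)).rep g).toContinuousLinearMap
  have h : σ.comp Θ = Θ.comp ρ := by
    refine (total_powVec (one_lt_param h₁ h₂ l)).ext_clm fun w => ?_
    change stratModel h₁ h₂ g (thetaLinear h₁ h₂ l _) =
      (thetaLinear h₁ h₂ l ((kernelRep_powVec (one_lt_param h₁ h₂ l)).rep g _) : L2Strat lam₁ lam₂)
    rw [← stratify_jacobiVec, stratModel_stratify, KernelRep.rep_apply, map_smul, rep_jacobiVec,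
      map_smul (thetaLinear h₁ h₂ l), Submodule.coe_smul, ← stratify_jacobiVec, ← map_smul,
      smul_comm]
  exact DFunLike.congr_fun h f

/-- This is the intertwining property of the inclusion, and it also shows that the Jacobi component
is invariant under the stratified model. -/
lemma coe_componentModel {lam₁ lam₂ : ℝ} (h₁ : 1 < lam₁) (h₂ : 1 < lam₂) (l : ℕ) (g : USL2)
    (v : jacobiComponent h₁ h₂ l) :
    (componentModel h₁ h₂ l g v : L2Strat lam₁ lam₂) = stratModel h₁ h₂ g v := by
  obtain ⟨f, rfl⟩ := (thetaLinear_bijective h₁ h₂ l).2 v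
  rw [componentModel_theta, stratModel_theta]

/-- The projection onto an invariant subspace commutes with a unitary representation, and on the
component the two actions coincide. -/
lemma jacobiProjection_stratModel {lam₁ lam₂ : ℝ} (h₁ : 1 < lam₁) (h₂ : 1 < lam₂) (l : ℕ)
    (g : USL2) (v : L2Strat lam₁ lam₂) :
    jacobiProjection h₁ h₂ l (stratModel h₁ h₂ g v) =
      componentModel h₁ h₂ l g (jacobiProjection h₁ h₂ l v) := by
  refine Subtype.ext ?_
  rw [coe_componentModel]
  refine (isUnitaryRep_stratModel h₁ h₂).starProjection_apply (W := jacobiComponent h₁ h₂ l)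
    (fun g v hv => ?_) g v
  rw [← coe_componentModel h₁ h₂ l g ⟨v, hv⟩]
  exact Subtype.property _

end JacobiModel

end
/-- For `lam₁, lam₂ > 1` and `l : ℕ`, the orthogonal projection of the stratified `L²`-model onto the
`l`-th Jacobi component is a symmetry breaking operator, the canonical injection is a holographic
operator, and they are adjoint to each other. -/
theorem mainTheorem4 (lam₁ lam₂ : ℝ) (h₁ : 1 < lam₁) (h₂ : 1 < lam₂) (l : ℕ) :
    JacobiModel.IsSymmetryBreakingOperator
        (JacobiModel.stratModel h₁ h₂)
        (JacobiModel.componentModel h₁ h₂ l)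
        (JacobiModel.jacobiProjection h₁ h₂ l) ∧
      JacobiModel.IsHolographicOperator
        (JacobiModel.componentModel h₁ h₂ l)
        (JacobiModel.stratModel h₁ h₂)
        (JacobiModel.jacobiComponent h₁ h₂ l).subtypeL ∧
      ContinuousLinearMap.adjoint (JacobiModel.jacobiProjection h₁ h₂ l) =
        (JacobiModel.jacobiComponent h₁ h₂ l).subtypeL :=
  have hσ := JacobiModel.isUnitaryRep_stratModel h₁ h₂
  have hρ := JacobiModel.isIrreducibleUnitaryRep_componentModel h₁ h₂ l
  ⟨⟨hσ, hρ, JacobiModel.jacobiProjection_stratModel h₁ h₂ l⟩,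
    ⟨hρ, hσ, JacobiModel.coe_componentModel h₁ h₂ l⟩,
    Submodule.adjoint_orthogonalProjectionOnto _⟩
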